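/- Let $M$ be a smooth (finite-dimensional, Hausdorff, second countable) manifold and let $A\to M$ be a smooth affine bundle of positive finite rank, modelled on the vector bundle $V=\mathbb V(A)$. Let $A^\dagger\to M$ be the vector bundle whose fibre at $x$ is the space of affine functions $A_x\to\mathbb R$, let $1_A$ be its section of constant functions $1$, and let $\rho:A^\dagger\to A^\dagger/\langle 1_A\rangle\simeq V^*$ map an affine function to its linear part. Then $\rho$ is a one-dimensional affine bundle over the manifold $V^*$; its smooth sections form an affine space $\mathrm{Sec}(\rho)$ modelled on $C^\infty(V^*)$ by $(\sigma+f)(\lambda)=\sigma(\lambda)+f(\lambda)1_A$. Let $\mathrm{LinSec}(\rho)\subset\mathrm{Sec}(\rho)$ be the set of sections $V^*\to A^\dagger$ of $\rho$ that are vector bundle morphisms. Definitions. An affine Lie bracket on an affine space $\mathcal S$ modelled on a vector space $\mathcal W$ is a bi-affine skew-symmetric map $[\cdot,\cdot]:\mathcal S\times\mathcal S\to\mathcal W$ with $[s,[t,u]]^{v}+[t,[u,s]]^{v}+[u,[s,t]]^{v}=0$ for all $s,t,u\in\mathcal S$, where $[s,\cdot]^{v}:\mathcal W\to\mathcal W$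 is the linear part of the affine map $[s,\cdot]$. A Lie affgebroid bracket on $A$ is an affine Lie bracket on $\mathrm{Sec}(A)$ for which there is a morphism of affine bundles $\gamma:A\to TM$ over $\mathrm{id}_M$ such that $[a,fX]^{v}=f[a,X]^{v}+\gamma(a)(f)X$ for all $a\in\mathrm{Sec}(A)$, $X\in\mathrm{Sec}(V)$, $f\in C^\infty(M)$. An aff-Poisson bracket on $\rho$ is an affine Lie bracket $\{\cdot,\cdot\}$ on $\mathrm{Sec}(\rho)$, with values in $C^\infty(V^*)$, such that $\{\sigma,\cdot\}^{v}$ is a derivation of the algebra $C^\infty(V^*)$ for every $\sigma\in\mathrm{Sec}(\rho)$; it is called linear if $\{\sigma_1,\sigma_2\}$ is linear on the fibres of $V^*$ for all $\sigma_1,\sigma_2\in\mathrm{LinSec}(\rho)$. For $X\in\mathrm{Sec}(V)$ let $\iota_X\in C^\infty(V^*)$, $\iota_X(\lambda)=\lambda(X)$. Theorem. There is a bijection $\mathrm{LinSec}(\rho)\to\mathrm{Sec}(A)$, $\sigma\mapsto a_\sigma$, determined by $$\varphi(a_\sigma(x))\,1_A(x)=\varphi-\sigma(\rho(\varphi))\qquad(x\in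 M,\ \varphi\in A^\dagger_x),$$ and the condition $$\{\sigma_1,\sigma_2\}=\iota_{[a_{\sigma_1},a_{\sigma_2}]}\qquad\text{for all }\sigma_1,\sigma_2\in\mathrm{LinSec}(\rho)$$ defines a one-to-one correspondence between Lie affgebroid brackets $[\cdot,\cdot]$ on $A$ and linear aff-Poisson brackets $\{\cdot,\cdot\}$ on $\rho$: for every Lie affgebroid bracket $[\cdot,\cdot]$ on $A$ there is exactly one linear aff-Poisson bracket $\{\cdot,\cdot\}$ on $\rho$ satisfying it, and for every linear aff-Poisson bracket on $\rho$ there is exactly one Lie affgebroid bracket on $A$ satisfying it. -/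

import Mathlib

open Bundle Set
open scoped Manifold ContDiff Bundle Topology

noncomputable section

namespace AffBundle

/-! ### Affine bundles -/

section AffineBundle

variable {M : Type*} [TopologicalSpace M]
  (F : Type*) [NormedAddCommGroup F] [NormedSpace ℝ F]
  (V : M → Type*) [∀ x, AddCommGroup (V x)] [∀ x, Module ℝ (V x)]
  (A : M → Type*) [∀ x, AddTorsor (V x) (A x)]
  [TopologicalSpace (TotalSpace F A)] [∀ x, TopologicalSpace (A x)] [FiberBundle F A]

/-- The fibre bundle `A`, whose fibres `A x` are affine spaces modelled on the vector spaces `V x`,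
is an affine bundle: the trivializations of its atlas are affine on the fibres. -/
class AffineBundle : Prop where
  affine : ∀ (e : Trivialization F (π F A)) [MemTrivializationAtlas e], ∀ x ∈ e.baseSet,
    ∃ L : V x →ₗ[ℝ] F, ∀ (v : V x) (a : A x), (e ⟨x, v +ᵥ a⟩).2 = L v + (e ⟨x, a⟩).2

/-- The affine bundle `A` is smooth and modelled on the smooth vector bundle `V`: the transition maps
of `A` are smooth, and the linear parts of the trivializations of `A`, expressed in trivializations
of `V`, depend smoothly on the base point. -/
class SmoothAffineBundle {E H : Type*} [NormedAddCommGroup E] [NormedSpace ℝ E] [TopologicalSpace H]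
    (I : ModelWithCorners ℝ E H) [ChartedSpace H M]
    [TopologicalSpace (TotalSpace F V)] [∀ x, TopologicalSpace (V x)] [FiberBundle F V] : Prop where
  smooth_transition : ∀ (e e' : Trivialization F (π F A))
    [MemTrivializationAtlas e] [MemTrivializationAtlas e'],
    ContMDiffOn (I.prod 𝓘(ℝ, F)) 𝓘(ℝ, F) ∞ (fun q : M × F => (e ⟨q.1, e'.symm q.1 q.2⟩).2)
      ((e.baseSet ∩ e'.baseSet) ×ˢ univ)
  smooth_linear : ∀ (e : Trivialization F (π F A)) (e' : Trivialization F (π F V))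
    [MemTrivializationAtlas e] [MemTrivializationAtlas e'],
    ∃ g : M → F →L[ℝ] F, ContMDiffOn I 𝓘(ℝ, F →L[ℝ] F) ∞ g (e.baseSet ∩ e'.baseSet) ∧
      ∀ x ∈ e.baseSet ∩ e'.baseSet, ∀ (v : V x) (a : A x),
        (e ⟨x, v +ᵥ a⟩).2 = g x (e' ⟨x, v⟩).2 + (e ⟨x, a⟩).2

end AffineBundle

/-! ### The vector bundle `A†` of affine functions on the fibres of `A` -/

section AffDual

variable {M : Type*} (F : Type*) {V : M → Type*} [∀ x, AddCommGroup (V x)] [∀ x, Module ℝ (V x)]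
  (A : M → Type*) [∀ x, AddTorsor (V x) (A x)]

/-- The fibre of `A†` at `x`: affine functions on `A x`. (The model fibre `F` of `A` is recorded only
because the topology below is built from the trivializations of `A`.) -/
def AffDual (_F : Type*) (A : M → Type*) [∀ x, AddTorsor (V x) (A x)] (x : M) : Type _ :=
  A x →ᵃ[ℝ] ℝ

instance (x : M) : AddCommGroup (AffDual F A x) := inferInstanceAs (AddCommGroup (A x →ᵃ[ℝ] ℝ))
instance (x : M) : Module ℝ (AffDual F A x) := inferInstanceAs (Module ℝ (A x →ᵃ[ℝ] ℝ))
instance (x : M) : FunLike (AffDual F A x) (A x) ℝ :=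
  inferInstanceAs (FunLike (A x →ᵃ[ℝ] ℝ) (A x) ℝ)

/-- The distinguished section `1_A` of `A†`. -/
def oneA (x : M) : AffDual F A x := AffineMap.const ℝ (A x) (1 : ℝ)

end AffDual

section Coordinates

variable {F : Type*} [NormedAddCommGroup F] [NormedSpace ℝ F] [FiniteDimensional ℝ F]
  {W P : Type*} [AddCommGroup W] [Module ℝ W] [AddTorsor W P]

/-- Affine coordinates `c` on `P` identify an affine function `φ` on `P` with the pair `(α, b)` such
that `φ p = α (c p) + b`. -/
def dualCoord (c : P ≃ᵃ[ℝ] F) : (P →ᵃ[ℝ] ℝ) ≃ₗ[ℝ] (F →L[ℝ] ℝ) × ℝ where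
  toFun φ := (LinearMap.toContinuousLinearMap (φ.comp c.symm.toAffineMap).linear, φ (c.symm 0))
  map_add' φ ψ := by
    refine Prod.ext ?_ rfl
    ext u
    simp
  map_smul' r φ := by
    refine Prod.ext ?_ rfl
    ext u
    simp
  invFun q := ((q.1 : F →ₗ[ℝ] ℝ).toAffineMap + AffineMap.const ℝ F q.2).comp c.toAffineMap
  left_inv φ := by
    ext p
    have h := (φ.comp c.symm.toAffineMap).map_vadd 0 (c p)
    simp only [vadd_eq_add, add_zero, AffineMap.comp_apply, AffineEquiv.coe_toAffineMap,
      AffineEquiv.symm_apply_apply] at h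
    simp only [AffineMap.comp_apply, AffineMap.const_apply, Pi.add_apply,
      AffineMap.coe_add, AffineEquiv.coe_toAffineMap, LinearMap.coe_toAffineMap]
    exact h.symm
  right_inv q := by
    refine Prod.ext ?_ ?_
    · ext u
      simp
    · simp

theorem dualCoord_symm_apply (c : P ≃ᵃ[ℝ] F) (q : (F →L[ℝ] ℝ) × ℝ) (p : P) :
    (dualCoord c).symm q p = q.1 (c p) + q.2 := rfl

end Coordinates

section AffDualBundle

set_option synthInstance.maxHeartbeats 200000

variable {M : Type*} [TopologicalSpace M]
  {F : Type*} [NormedAddCommGroup F] [NormedSpace ℝ F]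
  {V : M → Type*} [∀ x, AddCommGroup (V x)] [∀ x, Module ℝ (V x)]
  {A : M → Type*} [∀ x, AddTorsor (V x) (A x)]
  [TopologicalSpace (TotalSpace F A)] [∀ x, TopologicalSpace (A x)] [FiberBundle F A]
  [AffineBundle F V A]

/-- A trivialization of `A` in its atlas, restricted to a fibre. -/
def fibreMap (e : Trivialization F (π F A)) [MemTrivializationAtlas e] {x : M}
    (hx : x ∈ e.baseSet) : A x →ᵃ[ℝ] F where
  toFun a := (e ⟨x, a⟩).2
  linear := (AffineBundle.affine (V := V) e x hx).choose
  map_vadd' a v := (AffineBundle.affine (V := V) e x hx).choose_spec v a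

theorem fibreMap_bijective (e : Trivialization F (π F A)) [MemTrivializationAtlas e] {x : M}
    (hx : x ∈ e.baseSet) : Function.Bijective (fibreMap e hx) := by
  refine ⟨fun a b h => ?_, fun u => ⟨e.symm x u, ?_⟩⟩
  · rw [← e.symm_apply_apply_mk hx a, ← e.symm_apply_apply_mk hx b]
    exact congrArg _ h
  · exact congrArg Prod.snd (e.apply_mk_symm hx u)

/-- A trivialization of `A` in its atlas, restricted to a fibre, as an affine isomorphism. -/
def fibreEquiv (e : Trivialization F (π F A)) [MemTrivializationAtlas e] {x : M}
    (hx : x ∈ e.baseSet) : A x ≃ᵃ[ℝ] F :=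
  AffineEquiv.ofBijective (fibreMap_bijective e hx)

theorem fibreEquiv_apply (e : Trivialization F (π F A)) [MemTrivializationAtlas e] {x : M}
    (hx : x ∈ e.baseSet) (a : A x) : fibreEquiv e hx a = (e ⟨x, a⟩).2 := rfl

theorem fibreEquiv_symm_apply (e : Trivialization F (π F A)) [MemTrivializationAtlas e] {x : M}
    (hx : x ∈ e.baseSet) (u : F) : (fibreEquiv e hx).symm u = e.symm x u := by
  apply (fibreEquiv e hx).injective
  rw [AffineEquiv.apply_symm_apply, fibreEquiv_apply, e.apply_mk_symm hx]

variable [FiniteDimensional ℝ F]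

/-- Coordinates on a fibre of `A†` induced by a trivialization of `A`: they map an affine function
`φ` on `A x` to the pair `(α, b)` such that `φ a = α u + b`, where `u ∈ F` is the coordinate
of `a`. -/
def dualFibre (e : Trivialization F (π F A)) [MemTrivializationAtlas e] {x : M}
    (hx : x ∈ e.baseSet) : AffDual F A x ≃ₗ[ℝ] (F →L[ℝ] ℝ) × ℝ :=
  dualCoord (fibreEquiv e hx)

theorem dualFibre_fst (e : Trivialization F (π F A)) [MemTrivializationAtlas e] {x : M}
    (hx : x ∈ e.baseSet) (φ : AffDual F A x) (u : F) :
    (dualFibre e hx φ).1 u = φ (e.symm x u) - φ (e.symm x 0) := by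
  have h := (AffineMap.comp (P1 := F) (P2 := A x) (P3 := ℝ) φ
    (fibreEquiv e hx).symm.toAffineMap).linearMap_vsub u 0
  simp only [vsub_eq_sub, sub_zero] at h
  rw [← fibreEquiv_symm_apply e hx, ← fibreEquiv_symm_apply e hx]
  exact h

theorem dualFibre_snd (e : Trivialization F (π F A)) [MemTrivializationAtlas e] {x : M}
    (hx : x ∈ e.baseSet) (φ : AffDual F A x) : (dualFibre e hx φ).2 = φ (e.symm x 0) := by
  rw [← fibreEquiv_symm_apply e hx]
  rfl

theorem dualFibre_symm_apply (e : Trivialization F (π F A)) [MemTrivializationAtlas e] {x : M}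
    (hx : x ∈ e.baseSet) (q : (F →L[ℝ] ℝ) × ℝ) (a : A x) :
    (dualFibre e hx).symm q a = q.1 (e ⟨x, a⟩).2 + q.2 := rfl

open Classical in
/-- The pretrivialization of `A†` induced by a trivialization of `A`. -/
def dualPretriv (e : Trivialization F (π F A)) [MemTrivializationAtlas e] :
    Pretrivialization ((F →L[ℝ] ℝ) × ℝ) (π ((F →L[ℝ] ℝ) × ℝ) (AffDual F A)) where
  toFun p := (p.1, if h : p.1 ∈ e.baseSet then dualFibre e h p.2 else 0)
  invFun q := ⟨q.1, if h : q.1 ∈ e.baseSet then (dualFibre e h).symm q.2 else 0⟩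
  source := TotalSpace.proj ⁻¹' e.baseSet
  target := e.baseSet ×ˢ univ
  map_source' := fun ⟨_, _⟩ h => ⟨h, mem_univ _⟩
  map_target' := fun ⟨_, _⟩ h => h.1
  left_inv' := fun ⟨x, φ⟩ h => by
    have h' : x ∈ e.baseSet := h
    simp [h']
  right_inv' := fun ⟨x, q⟩ h => by
    have h' : x ∈ e.baseSet := h.1
    simp [h']
  open_target := e.open_baseSet.prod isOpen_univ
  baseSet := e.baseSet
  open_baseSet := e.open_baseSet
  source_eq := rfl
  target_eq := rfl
  proj_toFun _ _ := rfl

theorem dualPretriv_apply (e : Trivialization F (π F A)) [MemTrivializationAtlas e] {x : M}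
    (hx : x ∈ e.baseSet) (φ : AffDual F A x) :
    dualPretriv e ⟨x, φ⟩ = (x, dualFibre e hx φ) := by
  change (x, _) = _
  rw [dif_pos hx]

theorem dualPretriv_symm_apply (e : Trivialization F (π F A)) [MemTrivializationAtlas e] {x : M}
    (hx : x ∈ e.baseSet) (q : (F →L[ℝ] ℝ) × ℝ) :
    (dualPretriv e).symm x q = (dualFibre e hx).symm q := by
  have h := (dualPretriv e).mk_symm (b := x) hx q
  have h2 : (dualPretriv e).toPartialEquiv.symm (x, q) =
      ⟨x, (dualFibre e hx).symm q⟩ := by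
    change TotalSpace.mk x _ = _
    rw [dif_pos hx]
  rw [h2] at h
  exact TotalSpace.mk_inj.1 h

instance dualPretriv.isLinear (e : Trivialization F (π F A)) [MemTrivializationAtlas e] :
    (dualPretriv e).IsLinear ℝ where
  linear x hx :=
    { map_add φ ψ := by
        simp only [dualPretriv_apply e (show x ∈ e.baseSet from hx), map_add]
      map_smul r φ := by
        simp only [dualPretriv_apply e (show x ∈ e.baseSet from hx), map_smul] }

open Classical in
/-- The linear part of the transition map from `e'` to `e`. -/
def transLinear (e e' : Trivialization F (π F A)) [MemTrivializationAtlas e]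
    [MemTrivializationAtlas e'] (x : M) : F →L[ℝ] F :=
  if h : x ∈ e.baseSet ∩ e'.baseSet then
    LinearMap.toContinuousLinearMap
      ((fibreEquiv e h.1).toAffineMap.comp (fibreEquiv e' h.2).symm.toAffineMap).linear
  else 0

theorem transLinear_apply (e e' : Trivialization F (π F A)) [MemTrivializationAtlas e]
    [MemTrivializationAtlas e'] {x : M} (h : x ∈ e.baseSet ∩ e'.baseSet) (u : F) :
    transLinear e e' x u = (e ⟨x, e'.symm x u⟩).2 - (e ⟨x, e'.symm x 0⟩).2 := by
  have h2 := ((fibreEquiv e h.1).toAffineMap.comp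
    (fibreEquiv e' h.2).symm.toAffineMap).linearMap_vsub u 0
  simp only [vsub_eq_sub, sub_zero, AffineMap.comp_apply, AffineEquiv.coe_toAffineMap,
    fibreEquiv_symm_apply, fibreEquiv_apply] at h2
  rw [transLinear, dif_pos h]
  exact h2

theorem continuousOn_trans (e e' : Trivialization F (π F A)) (u : F) :
    ContinuousOn (fun x => (e ⟨x, e'.symm x u⟩).2) (e.baseSet ∩ e'.baseSet) := by
  have h1 : ContinuousOn (fun x => e'.toOpenPartialHomeomorph.symm (x, u))
      (e.baseSet ∩ e'.baseSet) := e'.continuousOn_symm_prodMk_left.mono inter_subset_right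
  have h2 : ContinuousOn (fun x => e (e'.toOpenPartialHomeomorph.symm (x, u)))
      (e.baseSet ∩ e'.baseSet) := by
    refine e.continuousOn.comp h1 fun x hx => ?_
    rw [e.mem_source, e'.proj_symm_apply' hx.2]
    exact hx.1
  refine h2.snd.congr fun x hx => ?_
  simp only
  rw [e'.mk_symm hx.2]

theorem continuousOn_transLinear (e e' : Trivialization F (π F A)) [MemTrivializationAtlas e]
    [MemTrivializationAtlas e'] : ContinuousOn (transLinear e e') (e.baseSet ∩ e'.baseSet) := by
  rw [continuousOn_clm_apply]
  intro u
  exact ((continuousOn_trans e e' u).sub (continuousOn_trans e e' 0)).congr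
    fun x hx => transLinear_apply e e' hx u

/-- The coordinate change `(α, b) ↦ (α ∘ g, α c + b)` of `A†` induced by the coordinate change
`u ↦ g u + c` of `A`. -/
def dualChange (g : F →L[ℝ] F) (c : F) : (F →L[ℝ] ℝ) × ℝ →L[ℝ] (F →L[ℝ] ℝ) × ℝ :=
  ((ContinuousLinearMap.compL ℝ F F ℝ).flip g ∘L ContinuousLinearMap.fst ℝ (F →L[ℝ] ℝ) ℝ).prod
    (ContinuousLinearMap.apply ℝ ℝ c ∘L ContinuousLinearMap.fst ℝ (F →L[ℝ] ℝ) ℝ +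
      ContinuousLinearMap.snd ℝ (F →L[ℝ] ℝ) ℝ)

theorem dualChange_apply (g : F →L[ℝ] F) (c : F) (q : (F →L[ℝ] ℝ) × ℝ) :
    dualChange g c q = (q.1 ∘L g, q.1 c + q.2) := rfl

theorem dualChange_eq (e e' : Trivialization F (π F A)) [MemTrivializationAtlas e]
    [MemTrivializationAtlas e'] {x : M} (hx : x ∈ e.baseSet ∩ e'.baseSet)
    (q : (F →L[ℝ] ℝ) × ℝ) :
    dualChange (transLinear e e' x) (e ⟨x, e'.symm x 0⟩).2 q =
      (dualPretriv e' ⟨x, (dualPretriv e).symm x q⟩).2 := by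
  rw [dualPretriv_symm_apply e hx.1, dualPretriv_apply e' hx.2, dualChange_apply]
  refine Prod.ext ?_ ?_
  · ext u
    rw [dualFibre_fst, dualFibre_symm_apply, dualFibre_symm_apply, ContinuousLinearMap.comp_apply,
      transLinear_apply e e' hx, map_sub]
    ring
  · rw [dualFibre_snd, dualFibre_symm_apply]

instance (x : M) : TopologicalSpace (AffDual F A x) :=
  TopologicalSpace.induced (dualFibre (trivializationAt F A x) (mem_baseSet_trivializationAt F A x))
    inferInstance

variable (F A)

/-- The vector bundle atlas of `A†` induced by the atlas of `A`. -/
def dualPrebundle : VectorPrebundle ℝ ((F →L[ℝ] ℝ) × ℝ) (AffDual F A) where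
  pretrivializationAtlas :=
    {p | ∃ (e : Trivialization F (π F A)) (_ : MemTrivializationAtlas e), p = dualPretriv e}
  pretrivialization_linear' := by
    rintro _ ⟨e, he, rfl⟩
    infer_instance
  pretrivializationAt x := dualPretriv (trivializationAt F A x)
  mem_base_pretrivializationAt x := mem_baseSet_trivializationAt F A x
  pretrivialization_mem_atlas x := ⟨trivializationAt F A x, inferInstance, rfl⟩
  exists_coordChange := by
    rintro _ ⟨e, he, rfl⟩ _ ⟨e', he', rfl⟩
    refine ⟨fun x => dualChange (transLinear e e' x) (e ⟨x, e'.symm x 0⟩).2, ?_,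
      fun x hx q => dualChange_eq e e' hx q⟩
    rw [continuousOn_clm_apply]
    intro q
    simp only [dualChange_apply]
    exact (continuousOn_const.clm_comp (continuousOn_transLinear e e')).prodMk
      ((q.1.continuous.comp_continuousOn (continuousOn_trans e e' 0)).add continuousOn_const)
  totalSpaceMk_isInducing x := by
    have h : Topology.IsInducing (dualFibre (trivializationAt F A x)
      (mem_baseSet_trivializationAt F A x)) := ⟨rfl⟩
    convert! (Topology.isInducing_const_prod (x := x)).mpr h using 1
    ext1 φ
    exact dualPretriv_apply _ _ φ

instance : TopologicalSpace (TotalSpace ((F →L[ℝ] ℝ) × ℝ) (AffDual F A)) :=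
  (dualPrebundle F A).totalSpaceTopology

instance : FiberBundle ((F →L[ℝ] ℝ) × ℝ) (AffDual F A) := (dualPrebundle F A).toFiberBundle

instance : VectorBundle ℝ ((F →L[ℝ] ℝ) × ℝ) (AffDual F A) := (dualPrebundle F A).toVectorBundle

end AffDualBundle

section AffDualSmooth

set_option synthInstance.maxHeartbeats 200000

variable {E H M : Type*} [NormedAddCommGroup E] [NormedSpace ℝ E] [TopologicalSpace H]
  {I : ModelWithCorners ℝ E H} [TopologicalSpace M] [ChartedSpace H M]

theorem contMDiffOn_clm_of_apply {G G' : Type*} [NormedAddCommGroup G] [NormedSpace ℝ G]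
    [FiniteDimensional ℝ G] [NormedAddCommGroup G'] [NormedSpace ℝ G'] {T : M → G →L[ℝ] G'}
    {s : Set M} (h : ∀ u, ContMDiffOn I 𝓘(ℝ, G') ∞ (fun x => T x u) s) :
    ContMDiffOn I 𝓘(ℝ, G →L[ℝ] G') ∞ T s := by
  let b := Module.finBasis ℝ G
  let c : Fin (Module.finrank ℝ G) → G →L[ℝ] ℝ := fun i =>
    LinearMap.toContinuousLinearMap (b.coord i)
  have hT : T = fun x => ∑ i, ContinuousLinearMap.smulRightL ℝ G G' (c i) (T x (b i)) := by
    funext x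
    ext u
    have h1 := congrArg (T x) (b.sum_repr u)
    simp only [map_sum, map_smul] at h1
    simpa [c] using h1.symm
  rw [hT]
  exact contMDiffOn_finsetSum fun i _ =>
    (ContinuousLinearMap.smulRightL ℝ G G' (c i)).contMDiff.comp_contMDiffOn (h (b i))

variable {F : Type*} [NormedAddCommGroup F] [NormedSpace ℝ F] [FiniteDimensional ℝ F]
  {V : M → Type*} [∀ x, AddCommGroup (V x)] [∀ x, Module ℝ (V x)]
  [TopologicalSpace (TotalSpace F V)] [∀ x, TopologicalSpace (V x)] [FiberBundle F V]
  {A : M → Type*} [∀ x, AddTorsor (V x) (A x)]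
  [TopologicalSpace (TotalSpace F A)] [∀ x, TopologicalSpace (A x)] [FiberBundle F A]
  [AffineBundle F V A] [SmoothAffineBundle F V A I]

theorem contMDiffOn_trans (e e' : Trivialization F (π F A)) [MemTrivializationAtlas e]
    [MemTrivializationAtlas e'] (u : F) :
    ContMDiffOn I 𝓘(ℝ, F) ∞ (fun x => (e ⟨x, e'.symm x u⟩).2) (e.baseSet ∩ e'.baseSet) :=
  (SmoothAffineBundle.smooth_transition (V := V) (I := I) e e').comp
    (contMDiffOn_id.prodMk contMDiffOn_const) fun _ hx => ⟨hx, mem_univ u⟩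

instance : (dualPrebundle F A).IsContMDiff I ∞ where
  exists_contMDiffCoordChange := by
    rintro _ ⟨e, he, rfl⟩ _ ⟨e', he', rfl⟩
    refine ⟨fun x => dualChange (transLinear e e' x) (e ⟨x, e'.symm x 0⟩).2, ?_,
      fun x hx q => dualChange_eq e e' hx q⟩
    refine contMDiffOn_clm_of_apply fun q => ?_
    simp only [dualChange_apply]
    have h1 : ContMDiffOn I 𝓘(ℝ, F →L[ℝ] F) ∞ (transLinear e e') (e.baseSet ∩ e'.baseSet) :=
      contMDiffOn_clm_of_apply fun u => ((contMDiffOn_trans e e' u).sub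
        (contMDiffOn_trans e e' 0)).congr fun x hx => transLinear_apply e e' hx u
    exact (contMDiffOn_const.clm_comp h1).prodMk_space
      ((q.1.contMDiff.comp_contMDiffOn (contMDiffOn_trans e e' 0)).add contMDiffOn_const)

/-- `A†` is a smooth vector bundle. -/
instance : ContMDiffVectorBundle ∞ ((F →L[ℝ] ℝ) × ℝ) (AffDual F A) I :=
  (dualPrebundle F A).contMDiffVectorBundle I

end AffDualSmooth

/-! ### The projection `ρ : A† → V*` -/

section Projection

variable {M : Type*} [TopologicalSpace M] {F : Type*} [NormedAddCommGroup F] [NormedSpace ℝ F]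
  {V : M → Type*} [∀ x, AddCommGroup (V x)] [∀ x, Module ℝ (V x)] [∀ x, TopologicalSpace (V x)]

/-- The fibre at `x` of the dual bundle `V*`. -/
abbrev VDual (V : M → Type*) [∀ x, AddCommGroup (V x)] [∀ x, Module ℝ (V x)]
    [∀ x, TopologicalSpace (V x)] (x : M) : Type _ :=
  V x →L[ℝ] Bundle.Trivial M ℝ x

/-- The total space of the dual bundle `V*`. -/
abbrev VDualTotal (F : Type*) [NormedAddCommGroup F] [NormedSpace ℝ F] (V : M → Type*)
    [∀ x, AddCommGroup (V x)] [∀ x, Module ℝ (V x)] [∀ x, TopologicalSpace (V x)] : Type _ :=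
  TotalSpace (F →L[ℝ] ℝ) (fun x : M => V x →L[ℝ] Bundle.Trivial M ℝ x)

variable [FiniteDimensional ℝ F] [TopologicalSpace (TotalSpace F V)] [FiberBundle F V]
  [VectorBundle ℝ F V]
  {A : M → Type*} [∀ x, AddTorsor (V x) (A x)]

theorem continuous_fibre_linear {x : M} (l : V x →ₗ[ℝ] ℝ) (F : Type*) [NormedAddCommGroup F]
    [NormedSpace ℝ F] [FiniteDimensional ℝ F] [TopologicalSpace (TotalSpace F V)] [FiberBundle F V]
    [VectorBundle ℝ F V] : Continuous l := by
  let c := (trivializationAt F V x).continuousLinearEquivAt ℝ x (mem_baseSet_trivializationAt F V x)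
  have h : Continuous (l ∘ₗ (c.symm : F →ₗ[ℝ] V x)) := LinearMap.continuous_of_finiteDimensional _
  have h2 := h.comp c.continuous
  convert h2 using 1
  ext v
  simp

/-- The projection `ρ : A† → V*` maps an affine function to its linear part. -/
def rho {x : M} : AffDual F A x →ₗ[ℝ] VDual V x where
  toFun φ := ⟨AffineMap.linear (k := ℝ) (P1 := A x) (P2 := ℝ) φ, continuous_fibre_linear _ F⟩
  map_add' _ _ := rfl
  map_smul' _ _ := rfl

/-- `ρ` is onto, so that it identifies `A† / ⟨1_A⟩` with `V*`, see `ker_rho`. -/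
theorem rho_surjective {x : M} : Function.Surjective (rho : AffDual F A x →ₗ[ℝ] VDual V x) := by
  intro l
  obtain ⟨a⟩ : Nonempty (A x) := inferInstance
  refine ⟨((l : V x →ₗ[ℝ] ℝ).toAffineMap.comp (AffineEquiv.vaddConst ℝ a).symm.toAffineMap : _), ?_⟩
  ext v
  change (l : V x →ₗ[ℝ] ℝ) ((AffineEquiv.vaddConst ℝ a).symm.linear v) = l v
  simp

theorem ker_rho {x : M} :
    LinearMap.ker (rho : AffDual F A x →ₗ[ℝ] VDual V x) = Submodule.span ℝ {oneA F A x} := by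
  ext φ
  rw [LinearMap.mem_ker, Submodule.mem_span_singleton]
  constructor
  · intro h
    obtain ⟨a⟩ : Nonempty (A x) := inferInstance
    refine ⟨φ a, ?_⟩
    refine AffineMap.ext (k := ℝ) (P1 := A x) (P2 := ℝ) fun b => ?_
    have h1 := AffineMap.linearMap_vsub (k := ℝ) (P1 := A x) (P2 := ℝ) φ b a
    have h2 : AffineMap.linear (k := ℝ) (P1 := A x) (P2 := ℝ) φ (b -ᵥ a) = 0 :=
      DFunLike.congr_fun h (b -ᵥ a)
    rw [h2, vsub_eq_sub] at h1
    change φ a * 1 = φ b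
    have h3 : (0 : ℝ) = φ b - φ a := h1
    linarith
  · rintro ⟨r, rfl⟩
    rw [map_smul]
    refine smul_eq_zero_of_right r ?_
    ext v
    rfl

end Projection

/-! ### Affine Lie brackets -/

section Brackets

variable {W S U : Type*} [AddCommGroup W] [Module ℝ W] [AddAction W S] [AddCommGroup U] [Module ℝ U]

/-- `D : S → U` is an affine map, where `S` is an affine space modelled on `W`. -/
def IsAffine (W : Type*) [AddCommGroup W] [Module ℝ W] [AddAction W S] (D : S → U) : Prop :=
  ∃ L : W →ₗ[ℝ] U, ∀ w s, D (w +ᵥ s) = L w + D s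

/-- The affine-linear part `[s, ·]ᵛ` of a bi-affine bracket. (The linear part of the affine map
`[s, ·]` can be computed at any base point, here at `s`.) -/
def vpart (B : S → S → U) (s : S) (w : W) : U := B s (w +ᵥ s) - B s s

/-- Affine Lie brackets on an affine space `S` modelled on `W`. -/
structure IsAffineLieBracket (B : S → S → W) : Prop where
  affine_left : ∀ t, IsAffine W fun s => B s t
  affine_right : ∀ s, IsAffine W (B s)
  skew : ∀ s t, B s t = -B t s
  jacobi : ∀ s t u, vpart B s (B t u) + vpart B t (B u s) + vpart B u (B s t) = 0

end Brackets

/-! ### Lie affgebroid brackets -/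

section Affgebroid

variable {E H M : Type*} [NormedAddCommGroup E] [NormedSpace ℝ E] [TopologicalSpace H]
  (I : ModelWithCorners ℝ E H) [TopologicalSpace M] [ChartedSpace H M]
  (F : Type*) [NormedAddCommGroup F] [NormedSpace ℝ F]
  (V : M → Type*) [∀ x, AddCommGroup (V x)] [∀ x, Module ℝ (V x)]
  [TopologicalSpace (TotalSpace F V)] [∀ x, TopologicalSpace (V x)] [FiberBundle F V]
  (A : M → Type*) [∀ x, AddTorsor (V x) (A x)]
  [TopologicalSpace (TotalSpace F A)] [∀ x, TopologicalSpace (A x)] [FiberBundle F A]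

variable {I F V A} in
theorem contMDiff_vadd [SmoothAffineBundle F V A I] (X : Cₛ^∞⟮I; F, V⟯) (a : Cₛ^∞⟮I; F, A⟯) :
    ContMDiff I (I.prod 𝓘(ℝ, F)) ∞ (fun x => TotalSpace.mk' F x (X x +ᵥ a x)) := by
  intro x₀
  have hX := X.contMDiff x₀
  have ha := a.contMDiff x₀
  rw [contMDiffAt_section] at hX ha ⊢
  obtain ⟨g, hg, h⟩ := SmoothAffineBundle.smooth_linear (I := I) (trivializationAt F A x₀)
    (trivializationAt F V x₀)
  have hU : (trivializationAt F A x₀).baseSet ∩ (trivializationAt F V x₀).baseSet ∈ 𝓝 x₀ :=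
    ((trivializationAt F A x₀).open_baseSet.inter (trivializationAt F V x₀).open_baseSet).mem_nhds
      ⟨mem_baseSet_trivializationAt F A x₀, mem_baseSet_trivializationAt F V x₀⟩
  refine (((hg.contMDiffAt hU).clm_apply hX).add ha).congr_of_eventuallyEq ?_
  filter_upwards [hU] with x hx using h x hx _ _

variable [VectorBundle ℝ F V]

/-- Sections of `A` form an affine space modelled on sections of `V`. -/
instance [SmoothAffineBundle F V A I] : AddAction Cₛ^∞⟮I; F, V⟯ Cₛ^∞⟮I; F, A⟯ where
  vadd X a := ⟨fun x => X x +ᵥ a x, contMDiff_vadd X a⟩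
  zero_vadd a := ContMDiffSection.ext fun x => zero_vadd (V x) (a x)
  add_vadd X Y a := ContMDiffSection.ext fun x => add_vadd (X x) (Y x) (a x)

/-- The product of a smooth function and a smooth section. -/
def smulSec {I : ModelWithCorners ℝ E H} {F : Type*} [NormedAddCommGroup F] [NormedSpace ℝ F]
    {V : M → Type*} [∀ x, AddCommGroup (V x)] [∀ x, Module ℝ (V x)]
    [TopologicalSpace (TotalSpace F V)] [∀ x, TopologicalSpace (V x)] [FiberBundle F V]
    [VectorBundle ℝ F V] (f : C^∞⟮I, M; 𝓘(ℝ, ℝ), ℝ⟯) (X : Cₛ^∞⟮I; F, V⟯) : Cₛ^∞⟮I; F, V⟯ :=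
  ⟨fun x => f x • X x, f.contMDiff.smul_section X.contMDiff⟩

/-- The derivative of the smooth function `f` in the direction of the tangent vector `v`. -/
def dirDeriv {I : ModelWithCorners ℝ E H} (f : C^∞⟮I, M; 𝓘(ℝ, ℝ), ℝ⟯) (x : M)
    (v : TangentSpace I x) : ℝ :=
  mfderiv I 𝓘(ℝ, ℝ) f x v

/-- Morphisms `A → TM` of affine bundles over the identity of `M`. -/
structure AnchorMap [IsManifold I 1 M] where
  toFun : ∀ x, A x →ᵃ[ℝ] TangentSpace I x
  smooth : ContMDiff (I.prod 𝓘(ℝ, F)) I.tangent ∞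
    (fun p : TotalSpace F A => (⟨p.1, toFun p.1 p.2⟩ : TangentBundle I M))

variable {I F V A}

/-- Lie affgebroid brackets on the affine bundle `A`. -/
structure IsLieAffgebroidBracket [IsManifold I 1 M] [SmoothAffineBundle F V A I]
    (B : Cₛ^∞⟮I; F, A⟯ → Cₛ^∞⟮I; F, A⟯ → Cₛ^∞⟮I; F, V⟯) : Prop where
  isAffineLieBracket : IsAffineLieBracket B
  exists_anchor : ∃ γ : AnchorMap I F V A, ∀ (a : Cₛ^∞⟮I; F, A⟯) (f : C^∞⟮I, M; 𝓘(ℝ, ℝ), ℝ⟯)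
    (X : Cₛ^∞⟮I; F, V⟯) (x : M),
    vpart B a (smulSec f X) x =
      f x • vpart B a X x + dirDeriv f x (γ.toFun x (a x)) • X x

end Affgebroid

/-! ### Linear aff-Poisson brackets -/

section AffPoisson

variable {E H M : Type*} [NormedAddCommGroup E] [NormedSpace ℝ E] [TopologicalSpace H]
  (I : ModelWithCorners ℝ E H) [TopologicalSpace M] [ChartedSpace H M]
  (F : Type*) [NormedAddCommGroup F] [NormedSpace ℝ F] [FiniteDimensional ℝ F]
  (V : M → Type*) [∀ x, AddCommGroup (V x)] [∀ x, Module ℝ (V x)]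
  [TopologicalSpace (TotalSpace F V)] [∀ x, TopologicalSpace (V x)] [FiberBundle F V]
  [VectorBundle ℝ F V]
  (A : M → Type*) [∀ x, AddTorsor (V x) (A x)]
  [TopologicalSpace (TotalSpace F A)] [∀ x, TopologicalSpace (A x)] [FiberBundle F A]
  [AffineBundle F V A]

/-- The algebra `C^∞(V*)` of smooth functions on the total space of the dual bundle of `V`. -/
abbrev DualFun : Type _ :=
  C^∞⟮I.prod 𝓘(ℝ, F →L[ℝ] ℝ), VDualTotal F V; 𝓘(ℝ, ℝ), ℝ⟯

/-- Smooth sections of `ρ : A† → V*`. -/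
@[ext]
structure RhoSection where
  toFun : ∀ p : VDualTotal F V, AffDual F A p.1
  smooth : ContMDiff (I.prod 𝓘(ℝ, F →L[ℝ] ℝ)) (I.prod 𝓘(ℝ, (F →L[ℝ] ℝ) × ℝ)) ∞
    (fun p => TotalSpace.mk' ((F →L[ℝ] ℝ) × ℝ) p.1 (toFun p))
  rho_toFun : ∀ p, rho (toFun p) = p.2

variable {I F V A}

theorem RhoSection.smooth_vadd (f : DualFun I F V) (σ : RhoSection I F V A) :
    ContMDiff (I.prod 𝓘(ℝ, F →L[ℝ] ℝ)) (I.prod 𝓘(ℝ, (F →L[ℝ] ℝ) × ℝ)) ∞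
      (fun p : VDualTotal F V =>
        TotalSpace.mk' ((F →L[ℝ] ℝ) × ℝ) p.1 (σ.toFun p + f p • oneA F A p.1)) := by
  intro p₀
  have h := σ.smooth p₀
  rw [contMDiffAt_totalSpace] at h ⊢
  refine ⟨h.1, ?_⟩
  have h2 : ContMDiffAt (I.prod 𝓘(ℝ, F →L[ℝ] ℝ)) 𝓘(ℝ, (F →L[ℝ] ℝ) × ℝ) ∞
      (fun p : VDualTotal F V => f p • ((0, 1) : (F →L[ℝ] ℝ) × ℝ)) p₀ :=
    (f.contMDiff p₀).smul contMDiffAt_const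
  refine (h.2.add h2).congr_of_eventuallyEq ?_
  have hU : (fun p : VDualTotal F V => p.1) ⁻¹' (trivializationAt F A p₀.1).baseSet ∈ 𝓝 p₀ :=
    h.1.continuousAt.preimage_mem_nhds
      ((trivializationAt F A p₀.1).open_baseSet.mem_nhds (mem_baseSet_trivializationAt F A p₀.1))
  filter_upwards [hU] with p hp
  have hp' : p.1 ∈ (trivializationAt F A p₀.1).baseSet := hp
  have key : ∀ φ : AffDual F A p.1,
      ((trivializationAt ((F →L[ℝ] ℝ) × ℝ) (AffDual F A) p₀.1) ⟨p.1, φ⟩).2 =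
        dualFibre (trivializationAt F A p₀.1) hp' φ := fun φ =>
    congrArg Prod.snd (dualPretriv_apply (trivializationAt F A p₀.1) hp' φ)
  have h1 : dualFibre (trivializationAt F A p₀.1) hp' (oneA F A p.1) = (0, 1) := by
    refine Prod.ext ?_ ?_
    · ext u
      rw [dualFibre_fst]
      exact sub_self (1 : ℝ)
    · rw [dualFibre_snd]
      rfl
  change ((trivializationAt ((F →L[ℝ] ℝ) × ℝ) (AffDual F A) p₀.1)
      ⟨p.1, σ.toFun p + f p • oneA F A p.1⟩).2 =
    ((trivializationAt ((F →L[ℝ] ℝ) × ℝ) (AffDual F A) p₀.1) ⟨p.1, σ.toFun p⟩).2 + _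
  rw [key, key, map_add, map_smul, h1]

/-- Sections of `ρ` form an affine space modelled on `C^∞(V*)`: the difference of two sections is a
multiple of `1_A`. -/
instance : AddAction (DualFun I F V) (RhoSection I F V A) where
  vadd f σ :=
    { toFun := fun p => σ.toFun p + f p • oneA F A p.1
      smooth := RhoSection.smooth_vadd f σ
      rho_toFun := fun p => by
        have h : rho (oneA F A p.1) = 0 := by
          rw [← LinearMap.mem_ker, ker_rho]
          exact Submodule.mem_span_singleton_self _
        rw [map_add, map_smul, h, smul_zero, add_zero, σ.rho_toFun] }
  zero_vadd σ := RhoSection.ext (funext fun p => by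
    change σ.toFun p + (0 : ℝ) • oneA F A p.1 = _
    rw [zero_smul, add_zero])
  add_vadd f g σ := RhoSection.ext (funext fun p => by
    change σ.toFun p + (f p + g p) • oneA F A p.1 =
      (σ.toFun p + g p • oneA F A p.1) + f p • oneA F A p.1
    rw [add_smul]
    abel)

/-- Aff-Poisson brackets on the one-dimensional affine bundle `ρ : A† → V*`: affine Lie brackets on
its sections such that each `{σ, ·}` is an affine derivation. -/
structure IsAffPoisson (P : RhoSection I F V A → RhoSection I F V A → DualFun I F V) : Prop where
  isAffineLieBracket : IsAffineLieBracket P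
  leibniz : ∀ (σ : RhoSection I F V A) (f g : DualFun I F V),
    vpart P σ (f * g) = f * vpart P σ g + vpart P σ f * g

/-- Linear sections of `ρ`: those that are morphisms of vector bundles `V* → A†`. -/
def RhoSection.IsLinear (σ : RhoSection I F V A) : Prop :=
  ∀ x, IsLinearMap ℝ (fun l : VDual V x => σ.toFun ⟨x, l⟩)

/-- The smooth function `f` on `V*` is linear on the fibres. -/
def IsLinearFun (f : DualFun I F V) : Prop :=
  ∀ x, IsLinearMap ℝ (fun l : VDual V x => f ⟨x, l⟩)

/-- Linear aff-Poisson brackets: the bracket of linear sections is a linear function. -/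
structure IsLinearAffPoisson (P : RhoSection I F V A → RhoSection I F V A → DualFun I F V) :
    Prop where
  isAffPoisson : IsAffPoisson P
  linear : ∀ σ₁ σ₂ : RhoSection I F V A, σ₁.IsLinear → σ₂.IsLinear → IsLinearFun (P σ₁ σ₂)

variable (I F V A)

/-- The space `LinSec(ρ)` of linear sections of `ρ`. -/
abbrev LinSec : Type _ := {σ : RhoSection I F V A // σ.IsLinear}

end AffPoisson

end AffBundle

end

noncomputable section

namespace AffBundle

/-!
A linear section of `ρ` is `σ_a : λ ↦ (b ↦ λ (b - a))` for a unique section `a` of `A`, and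
`σ_(a + X) = σ_a - ι_X`. After the choice of a section `s`, an affine Lie bracket is the same thing
as a Lie bracket on the model space, its bilinear part, together with a derivation `[s, ·]ᵛ` of it.

For a Lie affgebroid bracket, the Leibniz rule makes these two operations on `Sec(V)` of first order
with scalar symbol given by the anchor. Acting on `C^∞(M)` through the anchor as well, they are
defined on the functions `ι_X + h` on `V*`, and their values at a point depend only on the
differentials there. These functions contain local coordinates, so the operations extend to a
derivation and a biderivation of `C^∞(V*)`. A derivation `δ` that vanishes on all `ι_X` is zero: as
`ι_(fX) = f ι_X`, it satisfies `δ(f) ι_X = 0` for `f ∈ C^∞(M)`, every nonzero covector pairs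
nontrivially with some `X`, and the nonzero covectors are dense because the rank is positive. Hence
the Jacobi identities need only be checked on the `ι_X`, and the extension is unique.

Conversely, if `{σ_a, ·}ᵛ` preserves the fibrewise linear functions, then by the Leibniz rule on
`ι_(fX) = f ι_X` it also preserves the functions pulled back from `M`, and acts on them by a vector
field. The anchor consists of these vector fields. It is `C^∞(M)`-linear in its linear part because
the bilinear part vanishes on pairs of pulled-back functions `f`, `g`: its value on them, multiplied
by `ι_X` for any `X`, is pulled back from `M`, hence vanishes like `ι_X` on the zero section.
-/

section Hadamard

variable {E : Type*} [NormedAddCommGroup E] [NormedSpace ℝ E]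
  {G : Type*} [NormedAddCommGroup G] [NormedSpace ℝ G]

open MeasureTheory in
theorem contDiff_integral_unitInterval {g : E × ℝ → G} (hg : ContDiff ℝ ∞ g) :
    ContDiff ℝ ∞ (fun z => ∫ t in (0 : ℝ)..1, g (z, t)) := by
  -- The integral is the convolution of the indicator function of `(0, 1]` with a cut-off of
  -- `t ↦ g (z, -t)`, evaluated at `0`; Mathlib differentiates convolutions in parameters.
  let χ : ContDiffBump (0 : ℝ) := ⟨2, 3, by norm_num, by norm_num⟩
  let k : E → ℝ → G := fun z s => χ s • g (z, -s)
  let f : ℝ → ℝ := (Ioc (0 : ℝ) 1).indicator 1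
  have hk : ContDiffOn ℝ ∞ ↿k (univ ×ˢ univ) :=
    ((χ.contDiff.comp contDiff_snd).smul
      (hg.comp (contDiff_fst.prodMk contDiff_snd.neg))).contDiffOn
  have hf : LocallyIntegrable f volume :=
    ((integrable_indicator_iff measurableSet_Ioc).2
      (integrableOn_const (by simp) (by simp))).locallyIntegrable
  have hk_zero : ∀ z s, z ∈ univ → s ∉ Metric.closedBall (0 : ℝ) 3 → k z s = 0 := fun z s _ hs => by
    have hχ : χ s = 0 := χ.zero_of_le_dist (by
      rw [Metric.mem_closedBall, not_le] at hs
      exact hs.le)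
    simp only [k, hχ, zero_smul]
  have h := contDiffOn_convolution_right_with_param_comp (μ := volume) (n := ⊤)
    (ContinuousLinearMap.lsmul ℝ ℝ : ℝ →L[ℝ] G →L[ℝ] G) (s := (univ : Set E))
    (v := fun _ => (0 : ℝ)) contDiffOn_const isOpen_univ
    (isCompact_closedBall _ _) hk_zero hf hk
  rw [contDiffOn_univ] at h
  convert h using 2 with z
  rw [intervalIntegral.integral_of_le zero_le_one, convolution_def,
    ← integral_indicator measurableSet_Ioc]
  congr 1
  ext t
  by_cases ht : t ∈ Ioc (0 : ℝ) 1
  · have hχ : χ (-t) = 1 := χ.one_of_mem_closedBall (by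
      rw [mem_closedBall_zero_iff, norm_neg, Real.norm_eq_abs, abs_of_pos ht.1]
      exact ht.2.trans (by norm_num))
    simp [f, k, ht, hχ]
  · simp [f, ht]

/-- Hadamard's lemma. -/
theorem exists_contDiff_eq_add_apply_sub {f : E → ℝ} (hf : ContDiff ℝ ∞ f) (z₀ : E) :
    ∃ g : E → E →L[ℝ] ℝ, ContDiff ℝ ∞ g ∧ ∀ z, f z = f z₀ + g z (z - z₀) := by
  have hline : ContDiff ℝ ∞ (fun q : E × ℝ => fderiv ℝ f (z₀ + q.2 • (q.1 - z₀))) :=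
    (hf.fderiv_right (by simp)).comp
      (contDiff_const.add (contDiff_snd.smul (contDiff_fst.sub contDiff_const)))
  refine ⟨fun z => ∫ t in (0 : ℝ)..1, fderiv ℝ f (z₀ + t • (z - z₀)),
    contDiff_integral_unitInterval hline, fun z => ?_⟩
  have hcont : Continuous fun t : ℝ => fderiv ℝ f (z₀ + t • (z - z₀)) :=
    hline.continuous.comp (continuous_const.prodMk continuous_id)
  have hderiv : ∀ t ∈ uIcc (0 : ℝ) 1, HasDerivAt (fun t : ℝ => f (z₀ + t • (z - z₀)))
      (fderiv ℝ f (z₀ + t • (z - z₀)) (z - z₀)) t := fun t _ => by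
    have hsegment : HasDerivAt (fun t : ℝ => z₀ + t • (z - z₀)) (z - z₀) t := by
      simpa using ((hasDerivAt_id t).smul_const (z - z₀)).const_add z₀
    exact ((hf.differentiable (by simp)).differentiableAt.hasFDerivAt).comp_hasDerivAt t hsegment
  rw [ContinuousLinearMap.intervalIntegral_apply (hcont.intervalIntegrable _ _),
    intervalIntegral.integral_eq_sub_of_hasDerivAt hderiv
      ((hcont.clm_apply continuous_const).intervalIntegrable _ _)]
  simp

end Hadamard

theorem apply_eq_sum_apply_basis_mul_coord {ι E : Type*} [Fintype ι] [NormedAddCommGroup E]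
    [NormedSpace ℝ E] (b : Module.Basis ι ℝ E) (T : E →L[ℝ] ℝ) (v : E) :
    T v = ∑ i, T (b i) * b.coord i v := by
  conv_lhs => rw [← b.sum_repr v, map_sum]
  exact Finset.sum_congr rfl fun i _ => (map_smul T _ _).trans (mul_comm _ _)

section SmoothFunctions

variable {E H N : Type*} [NormedAddCommGroup E] [NormedSpace ℝ E]
  [TopologicalSpace H] {I : ModelWithCorners ℝ E H} [TopologicalSpace N] [ChartedSpace H N]

variable (I) in
/-- The differential `df_p` of a smooth function, as a linear map in `f`. -/
def differential (p : N) : C^∞⟮I, N; ℝ⟯ →ₗ[ℝ] TangentSpace I p →L[ℝ] ℝ where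
  toFun f := mvfderiv I f p
  map_add' f g := mvfderiv_add (f.contMDiff.mdifferentiable (by simp) p)
    (g.contMDiff.mdifferentiable (by simp) p)
  map_smul' r f := by
    have h := mvfderiv_smul (mdifferentiableAt_const (c := r))
      (f.contMDiff.mdifferentiable (by simp) p)
    rw [mvfderiv_const] at h
    exact h.trans (by simp)

theorem differential_mul (p : N) (f g : C^∞⟮I, N; ℝ⟯) :
    differential I p (f * g) = f p • differential I p g + g p • differential I p f :=
  mvfderiv_mul (f.contMDiff.mdifferentiable (by simp) p)
    (g.contMDiff.mdifferentiable (by simp) p)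

theorem differential_congr {p : N} {f g : C^∞⟮I, N; ℝ⟯} (h : f =ᶠ[𝓝 p] g) :
    differential I p f = differential I p g := by
  have hd := h.mfderiv_eq (I := I) (I' := 𝓘(ℝ, ℝ))
  ext v
  exact congrArg (fun T : E →L[ℝ] ℝ => T v) hd

theorem differential_comp (k : C^∞⟮𝓘(ℝ, E), E; ℝ⟯) (Y : C^∞⟮I, N; 𝓘(ℝ, E), E⟯) (p : N)
    (v : TangentSpace I p) :
    differential I p (k.comp Y) v = fderiv ℝ k (Y p) (mvfderiv I Y p v) := by
  have h := mfderiv_comp p (k.contMDiff.mdifferentiable (by simp) (Y p))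
    (Y.contMDiff.mdifferentiable (by simp) p)
  rw [mfderiv_eq_fderiv] at h
  exact congrArg (fun T : E →L[ℝ] ℝ => T v) h

theorem pointDerivation_mul {p : N} (D : PointDerivation I p) (f g : C^∞⟮I, N; ℝ⟯) :
    D (f * g) = f p * D g + g p * D f :=
  D.leibniz f g

theorem pointDerivation_const {p : N} (D : PointDerivation I p) (r : ℝ) :
    D (r • (1 : C^∞⟮I, N; ℝ⟯)) = 0 :=
  (D.map_smul r 1).trans ((congrArg (r • ·) D.map_one_eq_zero).trans (smul_zero r))

/-- The derivation `f ↦ df_p(v)` at `p` defined by a tangent vector `v`. -/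
def tangentDerivation {p : N} (v : TangentSpace I p) : PointDerivation I p :=
  Derivation.mk'
    { toFun := fun f => differential I p f v
      map_add' := fun f g => congrArg (· v) (map_add (differential I p) f g)
      map_smul' := fun r f => congrArg (· v) (map_smul (differential I p) r f) }
    fun f g => congrArg (· v) (differential_mul p f g)

theorem tangentDerivation_apply {p : N} (v : TangentSpace I p) (f : C^∞⟮I, N; ℝ⟯) :
    tangentDerivation v f = differential I p f v := rfl

variable [FiniteDimensional ℝ E] [IsManifold I ∞ N] [T2Space N]

theorem exists_contMDiffMap_eventuallyEq_one {p : N} {U : Set N} (hU : U ∈ 𝓝 p) :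
    ∃ χ : C^∞⟮I, N; ℝ⟯, χ =ᶠ[𝓝 p] 1 ∧ tsupport χ ⊆ U := by
  obtain ⟨χ, -, hχ⟩ := (SmoothBumpFunction.nhds_basis_tsupport (I := I) p).mem_iff.1 hU
  exact ⟨⟨χ, χ.contMDiff⟩, χ.eventuallyEq_one, hχ⟩

theorem exists_contMDiffMap_eventuallyEq {G : Type*} [NormedAddCommGroup G] [NormedSpace ℝ G]
    {p : N} {U : Set N} (hU : U ∈ 𝓝 p) {g : N → G} (hg : ContMDiffOn I 𝓘(ℝ, G) ∞ g U) :
    ∃ g' : C^∞⟮I, N; 𝓘(ℝ, G), G⟯, g' =ᶠ[𝓝 p] g := by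
  obtain ⟨χ, hχ_one, hχ⟩ := exists_contMDiffMap_eventuallyEq_one (I := I) (interior_mem_nhds.2 hU)
  refine ⟨⟨fun q => χ q • g q, contMDiff_of_tsupport fun q hq => ?_⟩, ?_⟩
  · have hq' : q ∈ interior U := hχ (tsupport_smul_subset_left _ _ hq)
    exact (χ.contMDiff q).smul (hg.contMDiffAt (mem_interior_iff_mem_nhds.1 hq'))
  · filter_upwards [hχ_one] with q hq
    exact (congrArg (· • g q) hq).trans (one_smul ℝ (g q))

theorem pointDerivation_congr {p : N} (D : PointDerivation I p) {f g : C^∞⟮I, N; ℝ⟯}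
    (h : f =ᶠ[𝓝 p] g) : D f = D g := by
  obtain ⟨χ, hχ_one, hχ⟩ := exists_contMDiffMap_eventuallyEq_one (I := I) h
  have hfactor : f - g = (1 - χ) * (f - g) := by
    ext q
    change f q - g q = (1 - χ q) * (f q - g q)
    by_cases hq : q ∈ tsupport χ
    · rw [hχ hq]
      ring
    · rw [image_eq_zero_of_notMem_tsupport hq]
      ring
  have hχp : (1 - χ) p = 0 := sub_eq_zero.2 hχ_one.self_of_nhds.symm
  have hfg : (f - g) p = 0 := sub_eq_zero.2 h.self_of_nhds
  have hD : D (f - g) = 0 := by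
    rw [hfactor, pointDerivation_mul, hχp, hfg, zero_mul, zero_mul, add_zero]
  exact sub_eq_zero.1 ((map_sub D f g).symm.trans hD)

variable (I) in
theorem exists_eventuallyEq_extChartAt (p : N) :
    ∃ Y : C^∞⟮I, N; 𝓘(ℝ, E), E⟯, Y =ᶠ[𝓝 p] extChartAt I p := by
  refine exists_contMDiffMap_eventuallyEq (extChartAt_source_mem_nhds (I := I) p) ?_
  rw [extChartAt_source]
  exact contMDiffOn_extChartAt

omit [T2Space N] in
theorem exists_eventuallyEq_comp [I.Boundaryless] {p : N} {Y : C^∞⟮I, N; 𝓘(ℝ, E), E⟯}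
    (hY : Y =ᶠ[𝓝 p] extChartAt I p) (f : C^∞⟮I, N; ℝ⟯) :
    ∃ k : C^∞⟮𝓘(ℝ, E), E; ℝ⟯, f =ᶠ[𝓝 p] k.comp Y := by
  obtain ⟨k, hk⟩ := exists_contMDiffMap_eventuallyEq (I := 𝓘(ℝ, E)) (extChartAt_target_mem_nhds p)
    (f.contMDiff.comp_contMDiffOn (contMDiffOn_extChartAt_symm p))
  refine ⟨k, ?_⟩
  filter_upwards [hY, (continuousAt_extChartAt (I := I) p).eventually hk,
    extChartAt_source_mem_nhds (I := I) p] with q hYq hkq hq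
  rw [ContMDiffMap.comp_apply, hYq, hkq, Function.comp_apply, (extChartAt I p).left_inv hq]

end SmoothFunctions

section Coordinates

variable {E H N : Type*} [NormedAddCommGroup E] [NormedSpace ℝ E] [FiniteDimensional ℝ E]
  [TopologicalSpace H] {I : ModelWithCorners ℝ E H} [TopologicalSpace N] [ChartedSpace H N]
  {ι : Type*}

/-- The components with respect to a basis of a smooth vector-valued function. -/
def coordinate (b : Module.Basis ι ℝ E) (Y : C^∞⟮I, N; 𝓘(ℝ, E), E⟯) (i : ι) : C^∞⟮I, N; ℝ⟯ :=
  ContMDiffMap.comp ⟨b.coord i, (LinearMap.toContinuousLinearMap (b.coord i)).contMDiff⟩ Y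

theorem coordinate_apply (b : Module.Basis ι ℝ E) (Y : C^∞⟮I, N; 𝓘(ℝ, E), E⟯) (i : ι) (p : N) :
    coordinate b Y i p = b.coord i (Y p) := rfl

theorem differential_coordinate (b : Module.Basis ι ℝ E) (Y : C^∞⟮I, N; 𝓘(ℝ, E), E⟯) (i : ι)
    (p : N) (v : TangentSpace I p) :
    differential I p (coordinate b Y i) v = b.coord i (mvfderiv I Y p v) :=
  (differential_comp _ Y p v).trans (congrArg (fun T : E →L[ℝ] ℝ => T (mvfderiv I Y p v))
    (LinearMap.toContinuousLinearMap (b.coord i)).fderiv)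

end Coordinates

section CoordinateExpansion

variable {E H N : Type*} [NormedAddCommGroup E] [NormedSpace ℝ E] [FiniteDimensional ℝ E]
  [TopologicalSpace H] {I : ModelWithCorners ℝ E H} [I.Boundaryless] [TopologicalSpace N]
  [ChartedSpace H N] [IsManifold I ∞ N] [T2Space N]
  {ι : Type*} [Fintype ι] {b : Module.Basis ι ℝ E} {p : N} {y : ι → C^∞⟮I, N; ℝ⟯}

theorem exists_differential_eventuallyEq_sum
    (hy : ∀ i, y i =ᶠ[𝓝 p] fun q => b.coord i (extChartAt I p q)) (f : C^∞⟮I, N; ℝ⟯) :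
    ∃ w : ι → C^∞⟮I, N; ℝ⟯,
      ∀ᶠ q in 𝓝 p, differential I q f = ∑ i, w i q • differential I q (y i) := by
  obtain ⟨Y, hY⟩ := exists_eventuallyEq_extChartAt I p
  obtain ⟨k, hk⟩ := exists_eventuallyEq_comp hY f
  have hdk : ContDiff ℝ ∞ (fderiv ℝ k) := k.contMDiff.contDiff.fderiv_right (by simp)
  let w : ι → C^∞⟮I, N; ℝ⟯ := fun i =>
    ⟨fun q => fderiv ℝ k (Y q) (b i), (hdk.clm_apply contDiff_const).contMDiff.comp Y.contMDiff⟩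
  refine ⟨w, ?_⟩
  have hyY : ∀ i, y i =ᶠ[𝓝 p] coordinate b Y i := fun i => by
    filter_upwards [hy i, hY] with q hyq hYq
    rw [hyq, coordinate_apply, hYq]
  filter_upwards [hk.eventuallyEq_nhds,
    Filter.eventually_all.2 fun i => (hyY i).eventuallyEq_nhds] with q hkq hyq
  ext v
  rw [differential_congr hkq, differential_comp, apply_eq_sum_apply_basis_mul_coord b, sum_apply]
  refine Finset.sum_congr rfl fun i _ => ?_
  rw [differential_congr (hyq i), smul_apply, differential_coordinate, smul_eq_mul]
  rfl

theorem exists_pointDerivation_eq_sum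
    (hy : ∀ i, y i =ᶠ[𝓝 p] fun q => b.coord i (extChartAt I p q)) (f : C^∞⟮I, N; ℝ⟯) :
    ∃ w : ι → ℝ, ∀ D : PointDerivation I p, D f = ∑ i, w i * D (y i) := by
  obtain ⟨Y, hY⟩ := exists_eventuallyEq_extChartAt I p
  obtain ⟨k, hk⟩ := exists_eventuallyEq_comp hY f
  obtain ⟨g, hg, hkg⟩ := exists_contDiff_eq_add_apply_sub k.contMDiff.contDiff (Y p)
  let w : ι → C^∞⟮I, N; ℝ⟯ := fun i =>
    ⟨fun q => g (Y q) (b i), (hg.clm_apply contDiff_const).contMDiff.comp Y.contMDiff⟩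
  have hf : f =ᶠ[𝓝 p] (k (Y p) • 1 + ∑ i, w i * (y i - y i p • 1) : C^∞⟮I, N; ℝ⟯) := by
    filter_upwards [hk, hY, Filter.eventually_all.2 hy] with q hkq hYq hyq
    have hsum : (∑ i, w i * (y i - y i p • 1) : C^∞⟮I, N; ℝ⟯) q =
        ∑ i, w i q * (y i q - y i p) := by
      rw [← ContMDiffMap.coeFnAddMonoidHom_apply, map_sum, Finset.sum_apply]
      exact Finset.sum_congr rfl fun i _ => congrArg (fun r => w i q * (y i q - r)) (mul_one _)
    rw [hkq, ContMDiffMap.comp_apply, hkg, apply_eq_sum_apply_basis_mul_coord b,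
      ContMDiffMap.coe_add, Pi.add_apply, hsum, hYq, hY.self_of_nhds]
    refine congrArg₂ (· + ·) (mul_one _).symm (Finset.sum_congr rfl fun i _ => ?_)
    rw [map_sub, hyq, (hy i).self_of_nhds, ← hYq]
    rfl
  refine ⟨fun i => w i p, fun D => ?_⟩
  rw [pointDerivation_congr D hf]
  refine (D.map_add _ _).trans ?_
  rw [pointDerivation_const, zero_add]
  refine (map_sum D.toLinearMap _ _).trans (Finset.sum_congr rfl fun i _ => ?_)
  have hp : (y i - y i p • (1 : C^∞⟮I, N; ℝ⟯)) p = 0 := sub_eq_zero.2 (mul_one _).symm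
  refine (pointDerivation_mul D _ _).trans ?_
  rw [hp, zero_mul, add_zero]
  refine congrArg (w i p * ·) ((D.map_sub _ _).trans ?_)
  rw [pointDerivation_const, sub_zero]

omit [Fintype ι] in
theorem pointDerivation_ext_of_coordinates [Finite ι]
    (hy : ∀ i, y i =ᶠ[𝓝 p] fun q => b.coord i (extChartAt I p q)) {D D' : PointDerivation I p}
    (h : ∀ i, D (y i) = D' (y i)) : D = D' := by
  have := Fintype.ofFinite ι
  refine Derivation.ext fun f => ?_
  obtain ⟨w, hw⟩ := exists_pointDerivation_eq_sum hy f
  simp only [hw, h]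

end CoordinateExpansion

section TangentVectors

variable {E H N : Type*} [NormedAddCommGroup E] [NormedSpace ℝ E] [FiniteDimensional ℝ E]
  [TopologicalSpace H] {I : ModelWithCorners ℝ E H} [TopologicalSpace N]
  [ChartedSpace H N] [IsManifold I ∞ N]

omit [FiniteDimensional ℝ E] in
theorem mvfderiv_bijective {p : N} {Y : C^∞⟮I, N; 𝓘(ℝ, E), E⟯}
    (hY : Y =ᶠ[𝓝 p] extChartAt I p) : Function.Bijective (mvfderiv I Y p) := by
  have h := isInvertible_mfderiv_extChartAt (mem_extChartAt_source (I := I) p)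
  rw [← hY.mfderiv_eq (I' := 𝓘(ℝ, E))] at h
  exact h.bijective

variable [T2Space N]

theorem tangentDerivation_injective {p : N} :
    Function.Injective (tangentDerivation : TangentSpace I p → PointDerivation I p) := by
  intro v w h
  obtain ⟨Y, hY⟩ := exists_eventuallyEq_extChartAt I p
  refine (mvfderiv_bijective hY).injective ((Module.finBasis ℝ E).ext_elem fun i => ?_)
  have hi : differential I p (coordinate (Module.finBasis ℝ E) Y i) v =
      differential I p (coordinate (Module.finBasis ℝ E) Y i) w := DFunLike.congr_fun h _
  rwa [differential_coordinate, differential_coordinate] at hi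

theorem exists_tangentDerivation_eq [I.Boundaryless] {p : N} (D : PointDerivation I p) :
    ∃ v, tangentDerivation v = D := by
  obtain ⟨Y, hY⟩ := exists_eventuallyEq_extChartAt I p
  let b := Module.finBasis ℝ E
  have hy : ∀ i, coordinate b Y i =ᶠ[𝓝 p] fun q => b.coord i (extChartAt I p q) := fun i => by
    filter_upwards [hY] with q hq
    rw [coordinate_apply, hq]
  obtain ⟨v, hv⟩ := (mvfderiv_bijective hY).surjective (∑ i, D (coordinate b Y i) • b i)
  refine ⟨v, pointDerivation_ext_of_coordinates hy fun i => ?_⟩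
  rw [tangentDerivation_apply, differential_coordinate, hv]
  exact congrFun (b.repr_sum_self fun i => D (coordinate b Y i)) i

variable (I) in
/-- The identification of tangent vectors at `p` with derivations at `p`. -/
def tangentDerivationEquiv [I.Boundaryless] (p : N) :
    TangentSpace I p ≃ₗ[ℝ] PointDerivation I p :=
  LinearEquiv.ofBijective
    ({  toFun := tangentDerivation
        map_add' := fun v w => Derivation.ext fun f => map_add (differential I p f) v w
        map_smul' := fun r v => Derivation.ext fun f => map_smul (differential I p f) r v } :
      TangentSpace I p →ₗ[ℝ] PointDerivation I p)
    ⟨tangentDerivation_injective, exists_tangentDerivation_eq⟩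

theorem differential_tangentDerivationEquiv_symm [I.Boundaryless] {p : N} (D : PointDerivation I p)
    (f : C^∞⟮I, N; ℝ⟯) : differential I p f ((tangentDerivationEquiv I p).symm D) = D f :=
  DFunLike.congr_fun ((tangentDerivationEquiv I p).apply_symm_apply D) f

theorem pointDerivation_eq_of_differential_eq [I.Boundaryless] {p : N} (D : PointDerivation I p)
    {f g : C^∞⟮I, N; ℝ⟯} (h : differential I p f = differential I p g) : D f = D g := by
  obtain ⟨v, rfl⟩ := exists_tangentDerivation_eq D
  exact congrArg (· v) h

theorem contMDiffAt_tangentBundle_of_differential {E' H' N' : Type*} [NormedAddCommGroup E']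
    [NormedSpace ℝ E'] [TopologicalSpace H'] {I' : ModelWithCorners ℝ E' H'} [TopologicalSpace N']
    [ChartedSpace H' N'] {v : N' → TangentBundle I N} {q : N'}
    (hproj : ContMDiffAt I' I ∞ (fun p => (v p).1) q)
    (h : ∀ f : C^∞⟮I, N; ℝ⟯,
      ContMDiffAt I' 𝓘(ℝ, ℝ) ∞ (fun p => differential I (v p).1 f (v p).2) q) :
    ContMDiffAt I' I.tangent ∞ v q := by
  refine contMDiffAt_totalSpace.2 ⟨hproj, ?_⟩
  obtain ⟨Y, hY⟩ := exists_eventuallyEq_extChartAt I (v q).1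
  let b := Module.finBasis ℝ E
  have hsum : ContMDiffAt I' 𝓘(ℝ, E) ∞ (fun p => ∑ i, differential I (v p).1
      (coordinate b Y i) (v p).2 • b i) q :=
    contMDiffAt_finsetSum fun i _ => (h _).smul contMDiffAt_const
  refine hsum.congr_of_eventuallyEq ?_
  filter_upwards [hproj.continuousAt.eventually hY.eventuallyEq_nhds,
    hproj.continuousAt.preimage_mem_nhds ((chartAt H (v q).1).open_source.mem_nhds
      (mem_chart_source H (v q).1))] with p hYp hp
  have htriv : (trivializationAt E (TangentSpace I) (v q).1 (v p)).2 =
      mvfderiv I Y (v p).1 (v p).2 := by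
    have hd : mvfderiv I Y (v p).1 = mfderiv I 𝓘(ℝ, E) (extChartAt I (v q).1) (v p).1 :=
      hYp.mfderiv_eq
    rw [hd, ← TangentBundle.continuousLinearMapAt_trivializationAt hp]
    exact (Trivialization.continuousLinearMapAt_apply_of_mem ℝ _ (by simpa using hp) _).symm
  rw [htriv]
  simp only [differential_coordinate]
  exact (b.sum_repr _).symm

end TangentVectors

section DerivationExtension

variable {E H N G : Type*} [NormedAddCommGroup E] [NormedSpace ℝ E]
  [TopologicalSpace H] {I : ModelWithCorners ℝ E H} [TopologicalSpace N] [ChartedSpace H N]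
  [AddCommGroup G] [Module ℝ G] {gen : G →ₗ[ℝ] C^∞⟮I, N; ℝ⟯}

/-- The family of smooth functions `gen c` contains, up to germs, all the linear functions of the
preferred charts. -/
def ContainsCoordinates (gen : G →ₗ[ℝ] C^∞⟮I, N; ℝ⟯) : Prop :=
  ∀ (p : N) (ℓ : E →L[ℝ] ℝ), ∃ c, gen c =ᶠ[𝓝 p] fun q => ℓ (extChartAt I p q)

namespace ContainsCoordinates

variable [FiniteDimensional ℝ E] [I.Boundaryless] [IsManifold I ∞ N] [T2Space N]

theorem exists_differential_eventuallyEq_sum (hgen : ContainsCoordinates gen) (p : N) :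
    ∃ (n : ℕ) (c : Fin n → G), ∀ f : C^∞⟮I, N; ℝ⟯, ∃ w : Fin n → C^∞⟮I, N; ℝ⟯,
      ∀ᶠ q in 𝓝 p, differential I q f = ∑ i, w i q • differential I q (gen (c i)) := by
  let b := Module.finBasis ℝ E
  choose c hc using fun i => hgen p (LinearMap.toContinuousLinearMap (b.coord i))
  exact ⟨_, c, AffBundle.exists_differential_eventuallyEq_sum hc⟩

theorem exists_differential_eq (hgen : ContainsCoordinates gen) (f : C^∞⟮I, N; ℝ⟯) (p : N) :
    ∃ c, differential I p (gen c) = differential I p f := by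
  obtain ⟨n, c, hc⟩ := hgen.exists_differential_eventuallyEq_sum p
  obtain ⟨w, hw⟩ := hc f
  exact ⟨∑ i, w i p • c i, by simp only [map_sum, map_smul, hw.self_of_nhds]⟩

theorem derivation_eq_zero (hgen : ContainsCoordinates gen)
    {δ : Derivation ℝ C^∞⟮I, N; ℝ⟯ C^∞⟮I, N; ℝ⟯} (h : ∀ c, δ (gen c) = 0) : δ = 0 := by
  refine Derivation.ext fun f => ContMDiffMap.ext fun p => ?_
  obtain ⟨c, hc⟩ := hgen.exists_differential_eq f p
  have hδ : δ f p = δ (gen c) p :=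
    pointDerivation_eq_of_differential_eq (Derivation.evalAt p δ) hc.symm
  rw [hδ, h]
  rfl

section Extension

variable {T : G →ₗ[ℝ] C^∞⟮I, N; ℝ⟯}

omit [FiniteDimensional ℝ E] [I.Boundaryless] [IsManifold I ∞ N] [T2Space N] in
theorem apply_eq_of_differential_eq (hT : ∀ p c, differential I p (gen c) = 0 → T c p = 0)
    {p : N} {c d : G} (h : differential I p (gen c) = differential I p (gen d)) :
    T c p = T d p := by
  have h0 : T (c - d) p = 0 := hT p _ (by rw [map_sub, map_sub, h, sub_self])
  rw [map_sub] at h0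
  exact sub_eq_zero.1 h0

theorem contMDiff_apply_of_differential_eq (hgen : ContainsCoordinates gen)
    (hT : ∀ p c, differential I p (gen c) = 0 → T c p = 0) {f : C^∞⟮I, N; ℝ⟯} {c : N → G}
    (hc : ∀ p, differential I p (gen (c p)) = differential I p f) :
    ContMDiff I 𝓘(ℝ, ℝ) ∞ fun p => T (c p) p := by
  intro p
  obtain ⟨n, d, hd⟩ := hgen.exists_differential_eventuallyEq_sum p
  obtain ⟨w, hw⟩ := hd f
  have hsum : ContMDiffAt I 𝓘(ℝ, ℝ) ∞ (fun q => ∑ i, w i q * T (d i) q) p :=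
    contMDiffAt_finsetSum fun i _ => ((w i).contMDiff p).mul ((T (d i)).contMDiff p)
  refine hsum.congr_of_eventuallyEq ?_
  filter_upwards [hw] with q hq
  have hcd : differential I q (gen (c q)) = differential I q (gen (∑ i, w i q • d i)) := by
    simp only [hc, hq, map_sum, map_smul]
  rw [apply_eq_of_differential_eq hT hcd, map_sum, ← ContMDiffMap.coeFnAddMonoidHom_apply,
    map_sum, Finset.sum_apply]
  exact Finset.sum_congr rfl fun i _ => by rw [map_smul]; rfl

theorem exists_derivation (hgen : ContainsCoordinates gen)
    (hT : ∀ p c, differential I p (gen c) = 0 → T c p = 0) :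
    ∃ δ : Derivation ℝ C^∞⟮I, N; ℝ⟯ C^∞⟮I, N; ℝ⟯,
      ∀ f p c, differential I p (gen c) = differential I p f → δ f p = T c p := by
  choose c hc using hgen.exists_differential_eq
  have hc_eq : ∀ f p d, differential I p (gen d) = differential I p f → T (c f p) p = T d p :=
    fun f p d hd => apply_eq_of_differential_eq hT ((hc f p).trans hd.symm)
  let δ : C^∞⟮I, N; ℝ⟯ →ₗ[ℝ] C^∞⟮I, N; ℝ⟯ :=
    { toFun := fun f => ⟨fun p => T (c f p) p, hgen.contMDiff_apply_of_differential_eq hT (hc f)⟩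
      map_add' := fun f g => ContMDiffMap.ext fun p =>
        (hc_eq (f + g) p (c f p + c g p) (by simp only [map_add, hc])).trans
          (by rw [map_add]; rfl)
      map_smul' := fun r f => ContMDiffMap.ext fun p =>
        (hc_eq (r • f) p (r • c f p) (by simp only [map_smul, hc])).trans
          (by rw [map_smul]; rfl) }
  refine ⟨Derivation.mk' δ fun f g => ContMDiffMap.ext fun p => ?_, hc_eq⟩
  refine (hc_eq (f * g) p (f p • c g p + g p • c f p) ?_).trans ?_
  · simp only [map_add, map_smul, hc, differential_mul]
  · rw [map_add, map_smul, map_smul]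
    rfl

end Extension

theorem exists_linearMap_derivation {G' : Type*} [AddCommGroup G'] [Module ℝ G']
    (hgen : ContainsCoordinates gen) {T : G' →ₗ[ℝ] G →ₗ[ℝ] C^∞⟮I, N; ℝ⟯}
    (hT : ∀ d p c, differential I p (gen c) = 0 → T d c p = 0) :
    ∃ δ : G' →ₗ[ℝ] Derivation ℝ C^∞⟮I, N; ℝ⟯ C^∞⟮I, N; ℝ⟯,
      ∀ d f p c, differential I p (gen c) = differential I p f → δ d f p = T d c p := by
  choose δ hδ using fun d => hgen.exists_derivation (hT d)
  refine ⟨⟨⟨δ, fun d d' => Derivation.ext fun f => ContMDiffMap.ext fun p => ?_⟩,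
    fun r d => Derivation.ext fun f => ContMDiffMap.ext fun p => ?_⟩, hδ⟩
  · obtain ⟨c, hc⟩ := hgen.exists_differential_eq f p
    rw [Derivation.add_apply, ContMDiffMap.coe_add, Pi.add_apply, hδ d f p c hc, hδ d' f p c hc,
      hδ _ f p c hc, map_add]
    rfl
  · obtain ⟨c, hc⟩ := hgen.exists_differential_eq f p
    rw [RingHom.id_apply, Derivation.smul_apply, ContMDiffMap.coe_smul, Pi.smul_apply,
      hδ d f p c hc, hδ _ f p c hc, map_smul]
    rfl

theorem exists_biderivation (hgen : ContainsCoordinates gen) {S : G →ₗ[ℝ] G →ₗ[ℝ] C^∞⟮I, N; ℝ⟯}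
    (skew : ∀ c d, S c d = -S d c)
    (hS : ∀ p c d, differential I p (gen c) = 0 → S c d p = 0) :
    ∃ pb : C^∞⟮I, N; ℝ⟯ →ₗ[ℝ] Derivation ℝ C^∞⟮I, N; ℝ⟯ C^∞⟮I, N; ℝ⟯,
      (∀ f g, pb f g = -pb g f) ∧ ∀ f g p c d, differential I p (gen c) = differential I p f →
        differential I p (gen d) = differential I p g → pb f g p = S c d p := by
  obtain ⟨δ, hδ⟩ := hgen.exists_linearMap_derivation (T := S.flip) fun d p c hc => hS p c d hc
  let T : C^∞⟮I, N; ℝ⟯ →ₗ[ℝ] G →ₗ[ℝ] C^∞⟮I, N; ℝ⟯ :=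
    LinearMap.mk₂ ℝ (fun f d => δ d f) (fun _ _ _ => map_add _ _ _)
      (fun _ _ _ => Derivation.map_smul _ _ _) (fun _ _ _ => by rw [map_add, Derivation.add_apply])
      (fun _ _ _ => by rw [map_smul, Derivation.smul_apply])
  obtain ⟨pb, hpb⟩ := hgen.exists_linearMap_derivation (T := T) fun f p d hd => by
    obtain ⟨c, hc⟩ := hgen.exists_differential_eq f p
    refine (hδ d f p c hc).trans ?_
    rw [LinearMap.flip_apply, skew, ContMDiffMap.coe_neg, Pi.neg_apply, hS p d c hd, neg_zero]
  have pb_eq : ∀ f g p c d, differential I p (gen c) = differential I p f →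
      differential I p (gen d) = differential I p g → pb f g p = S c d p :=
    fun f g p c d hc hd => (hpb f g p d hd).trans (hδ d f p c hc)
  refine ⟨pb, fun f g => ContMDiffMap.ext fun p => ?_, pb_eq⟩
  obtain ⟨c, hc⟩ := hgen.exists_differential_eq f p
  obtain ⟨d, hd⟩ := hgen.exists_differential_eq g p
  rw [ContMDiffMap.coe_neg, Pi.neg_apply, pb_eq f g p c d hc hd, pb_eq g f p d c hd hc, skew]
  rfl

end ContainsCoordinates

end DerivationExtension

section Biderivation

variable {R 𝒜 ι : Type*} [CommRing R] [CommRing 𝒜] [Algebra R 𝒜]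

/-- A linear family of derivations, as a bilinear map. -/
def derivationBilin {W : Type*} [AddCommGroup W] [Module R W] (D : W →ₗ[R] Derivation R 𝒜 𝒜) :
    W →ₗ[R] 𝒜 →ₗ[R] 𝒜 where
  toFun w := D w
  map_add' w w' := by rw [map_add, Derivation.coe_add_linearMap]
  map_smul' r w := by rw [map_smul, Derivation.coe_smul_linearMap, RingHom.id_apply]

theorem biderivation_mul_left {pb : 𝒜 →ₗ[R] Derivation R 𝒜 𝒜} (skew : ∀ f g, pb f g = -pb g f)
    (f g k : 𝒜) : pb (f * g) k = f * pb g k + g * pb f k := by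
  rw [skew, Derivation.leibniz, skew g, skew f, smul_eq_mul, smul_eq_mul]
  ring

variable {s : ι → 𝒜} (hs : ∀ δ : Derivation R 𝒜 𝒜, (∀ i, δ (s i) = 0) → δ = 0)
  {pb : 𝒜 →ₗ[R] Derivation R 𝒜 𝒜} (skew : ∀ f g, pb f g = -pb g f)
include hs skew

theorem jacobi_of_forall_generators {f g : 𝒜}
    (h : ∀ i, pb f (pb g (s i)) + pb g (pb (s i) f) + pb (s i) (pb f g) = 0) (k : 𝒜) :
    pb f (pb g k) + pb g (pb k f) + pb k (pb f g) = 0 := by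
  have commutator_sub_apply : ∀ k, (⁅pb f, pb g⁆ - pb (pb f g)) k =
      pb f (pb g k) + pb g (pb k f) + pb k (pb f g) := fun k => by
    rw [skew k f, skew k (pb f g), map_neg, Derivation.sub_apply, Derivation.commutator_apply]
    abel
  rw [← commutator_sub_apply, hs _ fun i => (commutator_sub_apply _).trans (h i)]
  rfl

theorem biderivation_jacobi
    (h : ∀ i j k, pb (s i) (pb (s j) (s k)) + pb (s j) (pb (s k) (s i)) +
      pb (s k) (pb (s i) (s j)) = 0) (f g k : 𝒜) :
    pb f (pb g k) + pb g (pb k f) + pb k (pb f g) = 0 := by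
  have rotate : ∀ f g k : 𝒜, pb k (pb f g) + pb f (pb g k) + pb g (pb k f) =
      pb f (pb g k) + pb g (pb k f) + pb k (pb f g) := fun f g k => by abel
  have h₂ : ∀ i j f, pb (s i) (pb (s j) f) + pb (s j) (pb f (s i)) + pb f (pb (s i) (s j)) = 0 :=
    fun i j => jacobi_of_forall_generators hs skew (h i j)
  have h₁ : ∀ i f g, pb (s i) (pb f g) + pb f (pb g (s i)) + pb g (pb (s i) f) = 0 := fun i f =>
    jacobi_of_forall_generators hs skew fun j => by rw [← rotate, h₂]
  exact jacobi_of_forall_generators hs skew (fun i => by rw [← rotate, h₁]) k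

theorem derivation_biderivation {D : Derivation R 𝒜 𝒜}
    (h : ∀ i j, D (pb (s i) (s j)) = pb (D (s i)) (s j) + pb (s i) (D (s j))) (f g : 𝒜) :
    D (pb f g) = pb (D f) g + pb f (D g) := by
  have extend : ∀ f, (∀ i, D (pb f (s i)) = pb (D f) (s i) + pb f (D (s i))) →
      ∀ g, D (pb f g) = pb (D f) g + pb f (D g) := fun f hf g => by
    have h0 := hs (⁅D, pb f⁆ - pb (D f)) fun i => by
      rw [Derivation.sub_apply, Derivation.commutator_apply, hf]
      abel
    rw [← sub_eq_zero.1 h0, Derivation.commutator_apply, sub_add_cancel]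
  refine extend f (fun i => ?_) g
  rw [skew f, map_neg, extend (s i) (h i) f, skew (D f), skew f (D (s i)), neg_add, add_comm]

end Biderivation

theorem t2Space_totalSpace {B F : Type*} {V : B → Type*} [TopologicalSpace B] [TopologicalSpace F]
    [TopologicalSpace (TotalSpace F V)] [∀ x, TopologicalSpace (V x)] [FiberBundle F V]
    [T2Space B] [T2Space F] : T2Space (TotalSpace F V) := by
  refine ⟨fun p q hpq => ?_⟩
  by_cases h : p.1 = q.1
  · let e := trivializationAt F V q.1
    have hq : q ∈ e.source := FiberBundle.mem_trivializationAt_proj_source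
    have hp : p ∈ e.source := by rwa [e.mem_source, h, ← e.mem_source]
    obtain ⟨U, W, hU, hW, hpU, hqW, hUW⟩ := t2_separation fun he => hpq (e.injOn hp hq he)
    exact ⟨_, _, e.toOpenPartialHomeomorph.isOpen_inter_preimage hU,
      e.toOpenPartialHomeomorph.isOpen_inter_preimage hW, ⟨hp, hpU⟩, ⟨hq, hqW⟩,
      (hUW.preimage _).mono inter_subset_right inter_subset_right⟩
  · obtain ⟨U, W, hU, hW, hpU, hqW, hUW⟩ := t2_separation h
    have hc : Continuous (π F V) := FiberBundle.continuous_proj F V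
    exact ⟨_, _, hU.preimage hc, hW.preimage hc, hpU, hqW, hUW.preimage _⟩

section DualFibre

variable {M : Type*} [TopologicalSpace M] {F : Type*} [NormedAddCommGroup F] [NormedSpace ℝ F]
  {V : M → Type*} [∀ x, AddCommGroup (V x)] [∀ x, Module ℝ (V x)]
  [TopologicalSpace (TotalSpace F V)] [∀ x, TopologicalSpace (V x)] [FiberBundle F V]
  [VectorBundle ℝ F V]

variable (F V) in
/-- The trivialization of `V*` induced by the preferred trivialization of `V` at `x₀`. -/
abbrev dualTriv (x₀ : M) : Trivialization (F →L[ℝ] ℝ)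
    (π (F →L[ℝ] ℝ) (fun x : M => V x →L[ℝ] Bundle.Trivial M ℝ x)) :=
  trivializationAt (F →L[ℝ] ℝ) (fun x : M => V x →L[ℝ] Bundle.Trivial M ℝ x) x₀

theorem eventually_fst_mem {p₀ : VDualTotal F V} {U : Set M} (hU : U ∈ 𝓝 p₀.1) :
    ∀ᶠ p : VDualTotal F V in 𝓝 p₀, p.1 ∈ U :=
  (FiberBundle.continuous_proj (F →L[ℝ] ℝ)
    (fun x : M => V x →L[ℝ] Bundle.Trivial M ℝ x)).continuousAt.preimage_mem_nhds hU

instance [T2Space M] : T2Space (VDualTotal F V) := t2Space_totalSpace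

theorem mem_baseSet_dualTriv {x₀ y : M} (hy : y ∈ (trivializationAt F V x₀).baseSet) :
    y ∈ (dualTriv F V x₀).baseSet :=
  ⟨hy, mem_univ _⟩

theorem dualTriv_apply {x₀ y : M} (hy : y ∈ (trivializationAt F V x₀).baseSet) (l : VDual V y)
    (u : F) : (dualTriv F V x₀ ⟨y, l⟩).2 u = l ((trivializationAt F V x₀).symm y u) := by
  have h : dualTriv F V x₀ ⟨y, l⟩ = _ := hom_trivializationAt_apply (RingHom.id ℝ) x₀ ⟨y, l⟩
  rw [h]
  simp [ContinuousLinearMap.inCoordinates, hy]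

theorem apply_eq_dualTriv {x₀ y : M} (hy : y ∈ (trivializationAt F V x₀).baseSet) (l : VDual V y)
    (v : V y) : l v = (dualTriv F V x₀ ⟨y, l⟩).2 (trivializationAt F V x₀ ⟨y, v⟩).2 := by
  rw [dualTriv_apply hy, Trivialization.symm_apply_apply_mk _ hy]

theorem dualTriv_symm_apply {x₀ y : M} (hy : y ∈ (trivializationAt F V x₀).baseSet)
    (β : F →L[ℝ] ℝ) (v : V y) :
    ((dualTriv F V x₀).symm y β : VDual V y) v = β (trivializationAt F V x₀ ⟨y, v⟩).2 := by
  rw [apply_eq_dualTriv hy, (dualTriv F V x₀).apply_mk_symm (mem_baseSet_dualTriv hy)]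

theorem eq_sum_coord_smul_symm {ι : Type*} [Fintype ι] (b : Module.Basis ι ℝ F) {x₀ y : M}
    (hy : y ∈ (trivializationAt F V x₀).baseSet) (v : V y) :
    v = ∑ i, b.coord i (trivializationAt F V x₀ ⟨y, v⟩).2 •
      (trivializationAt F V x₀).symm y (b i) := by
  conv_lhs => rw [← Trivialization.symm_apply_apply_mk (trivializationAt F V x₀) hy v,
    ← b.sum_repr (trivializationAt F V x₀ ⟨y, v⟩).2]
  rw [← Trivialization.symmL_apply (R := ℝ) _ hy, map_sum]
  exact Finset.sum_congr rfl fun i _ => by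
    rw [map_smul, Trivialization.symmL_apply _ hy, Module.Basis.coord_apply]

theorem eq_of_forall_dual_apply_eq (F : Type*) [NormedAddCommGroup F] [NormedSpace ℝ F]
    [TopologicalSpace (TotalSpace F V)] [FiberBundle F V] [VectorBundle ℝ F V] {x : M} {v w : V x}
    (h : ∀ l : VDual V x, l v = l w) : v = w := by
  have hx := mem_baseSet_trivializationAt F V x
  have hvw : (trivializationAt F V x ⟨x, v⟩).2 = (trivializationAt F V x ⟨x, w⟩).2 := by
    by_contra hne
    obtain ⟨β, hβ⟩ := SeparatingDual.exists_separating_of_ne (R := ℝ) hne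
    refine hβ ?_
    rw [← dualTriv_symm_apply hx, ← dualTriv_symm_apply hx, h]
  rw [← Trivialization.symm_apply_apply_mk _ hx v, hvw, Trivialization.symm_apply_apply_mk _ hx]

variable (F V) in
theorem exists_dual_ne_zero [Nontrivial F] (x : M) : ∃ l : VDual V x, l ≠ 0 := by
  have hx := mem_baseSet_trivializationAt F V x
  obtain ⟨u, hu⟩ := exists_ne (0 : F)
  obtain ⟨β, hβ⟩ := SeparatingDual.exists_ne_zero (R := ℝ) hu
  refine ⟨(dualTriv F V x).symm x β, fun h => hβ ?_⟩
  have hβu := dualTriv_symm_apply hx β ((trivializationAt F V x).symm x u)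
  rw [h, Trivialization.apply_mk_symm _ hx] at hβu
  exact hβu.symm

theorem exists_dual_eval_eq {F : Type*} [NormedAddCommGroup F] [NormedSpace ℝ F]
    [FiniteDimensional ℝ F] (T : (F →L[ℝ] ℝ) →ₗ[ℝ] ℝ) : ∃ u : F, ∀ β : F →L[ℝ] ℝ, T β = β u := by
  let T' : Module.Dual ℝ (Module.Dual ℝ F) :=
    T ∘ₗ (LinearMap.toContinuousLinearMap : (F →ₗ[ℝ] ℝ) ≃ₗ[ℝ] F →L[ℝ] ℝ).toLinearMap
  exact ⟨(Module.evalEquiv ℝ F).symm T', fun β =>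
    (Module.apply_evalEquiv_symm_apply ℝ F (β : F →ₗ[ℝ] ℝ) T').symm⟩

variable (F) in
theorem exists_dual_fibre_eval_eq [FiniteDimensional ℝ F] {x : M} (T : VDual V x →ₗ[ℝ] ℝ) :
    ∃ v : V x, ∀ l : VDual V x, T l = l v := by
  have hx := mem_baseSet_trivializationAt F V x
  obtain ⟨u, hu⟩ := exists_dual_eval_eq (T ∘ₗ (dualTriv F V x).symmₗ ℝ x)
  refine ⟨(trivializationAt F V x).symm x u, fun l => ?_⟩
  rw [← dualTriv_apply hx, ← hu, LinearMap.comp_apply,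
    Trivialization.coe_symmₗ (hb := mem_baseSet_dualTriv hx),
    Trivialization.symm_apply_apply_mk _ (mem_baseSet_dualTriv hx)]

end DualFibre

section Sections

variable {E : Type*} [NormedAddCommGroup E] [NormedSpace ℝ E]
  {M : Type*} [TopologicalSpace M] [ChartedSpace E M]
  {F : Type*} [NormedAddCommGroup F] [NormedSpace ℝ F]
  {V : M → Type*} [∀ x, AddCommGroup (V x)] [∀ x, Module ℝ (V x)]
  [TopologicalSpace (TotalSpace F V)] [∀ x, TopologicalSpace (V x)] [FiberBundle F V]
  [VectorBundle ℝ F V]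

theorem contMDiffOn_trivialization_symm_const [ContMDiffVectorBundle ∞ F V 𝓘(ℝ, E)]
    (e : Trivialization F (π F V)) [MemTrivializationAtlas e] (u : F) :
    ContMDiffOn 𝓘(ℝ, E) (𝓘(ℝ, E).prod 𝓘(ℝ, F)) ∞
      (fun y => TotalSpace.mk' F y (e.symm y u)) e.baseSet := by
  rw [Trivialization.contMDiffOn_section_baseSet_iff]
  exact (contMDiffOn_const (c := u)).congr fun y hy => by rw [Trivialization.apply_mk_symm _ hy]

variable [FiniteDimensional ℝ E] [IsManifold 𝓘(ℝ, E) ∞ M] [T2Space M]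

theorem exists_section_eventuallyEq {x : M} {U : Set M} (hU : U ∈ 𝓝 x) {s : ∀ y, V y}
    (hs : ContMDiffOn 𝓘(ℝ, E) (𝓘(ℝ, E).prod 𝓘(ℝ, F)) ∞ (fun y => TotalSpace.mk' F y (s y)) U) :
    ∃ X : Cₛ^∞⟮𝓘(ℝ, E); F, V⟯, ∀ᶠ y in 𝓝 x, X y = s y := by
  obtain ⟨χ, hχ_one, hχ⟩ :=
    exists_contMDiffMap_eventuallyEq_one (I := 𝓘(ℝ, E)) (interior_mem_nhds.2 hU)
  refine ⟨⟨fun y => χ y • s y, ContMDiffOn.smul_section_of_tsupport χ.contMDiff.contMDiffOn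
    isOpen_interior hχ (hs.mono interior_subset)⟩, ?_⟩
  filter_upwards [hχ_one] with y hy
  change χ y • s y = s y
  rw [hy, Pi.one_apply, one_smul]

variable [ContMDiffVectorBundle ∞ F V 𝓘(ℝ, E)]

theorem exists_section_eventuallyEq_symm_const (x₀ : M) (u : F) :
    ∃ X : Cₛ^∞⟮𝓘(ℝ, E); F, V⟯, ∀ᶠ y in 𝓝 x₀, X y = (trivializationAt F V x₀).symm y u :=
  exists_section_eventuallyEq ((trivializationAt F V x₀).open_baseSet.mem_nhds
    (mem_baseSet_trivializationAt F V x₀)) (contMDiffOn_trivialization_symm_const _ u)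

variable (E F) in
theorem exists_section_apply_eq {x : M} (v : V x) : ∃ X : Cₛ^∞⟮𝓘(ℝ, E); F, V⟯, X x = v := by
  obtain ⟨X, hX⟩ := exists_section_eventuallyEq_symm_const (E := E) (V := V) x
    (trivializationAt F V x ⟨x, v⟩).2
  exact ⟨X, by rw [hX.self_of_nhds,
    Trivialization.symm_apply_apply_mk _ (mem_baseSet_trivializationAt F V x)]⟩

variable (E F) in
theorem exists_section_dual_apply_ne_zero {x : M} {l : VDual V x} (hl : l ≠ 0) :
    ∃ X : Cₛ^∞⟮𝓘(ℝ, E); F, V⟯, l (X x) ≠ 0 := by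
  by_contra! h
  refine hl (ContinuousLinearMap.ext fun v => ?_)
  obtain ⟨X, rfl⟩ := exists_section_apply_eq E F v
  exact h X

end Sections

section FunctionsOnDual

variable {E : Type*} [NormedAddCommGroup E] [NormedSpace ℝ E]
  {M : Type*} [TopologicalSpace M] [ChartedSpace E M]
  {F : Type*} [NormedAddCommGroup F] [NormedSpace ℝ F]
  {V : M → Type*} [∀ x, AddCommGroup (V x)] [∀ x, Module ℝ (V x)]
  [TopologicalSpace (TotalSpace F V)] [∀ x, TopologicalSpace (V x)] [FiberBundle F V]
  [VectorBundle ℝ F V]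

theorem contMDiff_dual_apply (X : Cₛ^∞⟮𝓘(ℝ, E); F, V⟯) :
    ContMDiff (𝓘(ℝ, E).prod 𝓘(ℝ, F →L[ℝ] ℝ)) 𝓘(ℝ, ℝ) ∞
      (fun p : VDualTotal F V => (p.2 (X p.1) : ℝ)) := by
  have hid : ContMDiff (𝓘(ℝ, E).prod 𝓘(ℝ, F →L[ℝ] ℝ)) (𝓘(ℝ, E).prod 𝓘(ℝ, F →L[ℝ] ℝ)) ∞
    (fun p : VDualTotal F V => TotalSpace.mk' (F →L[ℝ] ℝ)
      (E := fun x : M => V x →L[ℝ] Bundle.Trivial M ℝ x) p.1 p.2) := contMDiff_id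
  have hX : ContMDiff (𝓘(ℝ, E).prod 𝓘(ℝ, F →L[ℝ] ℝ)) (𝓘(ℝ, E).prod 𝓘(ℝ, F)) ∞
    (fun p : VDualTotal F V => TotalSpace.mk' F p.1 (X p.1)) :=
    X.contMDiff.comp (contMDiff_proj _)
  exact fun p => (contMDiffAt_totalSpace.1 (ContMDiff.clm_bundle_apply hid hX p)).2

/-- The linear map `X ↦ ι_X`. -/
def iota : Cₛ^∞⟮𝓘(ℝ, E); F, V⟯ →ₗ[ℝ] DualFun 𝓘(ℝ, E) F V where
  toFun X := ⟨fun p => p.2 (X p.1), contMDiff_dual_apply X⟩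
  map_add' X Y := ContMDiffMap.ext fun p => map_add p.2 (X p.1) (Y p.1)
  map_smul' r X := ContMDiffMap.ext fun p => map_smul p.2 r (X p.1)

theorem iota_apply (X : Cₛ^∞⟮𝓘(ℝ, E); F, V⟯) (p : VDualTotal F V) : iota X p = p.2 (X p.1) := rfl

theorem isLinearFun_iota (X : Cₛ^∞⟮𝓘(ℝ, E); F, V⟯) : IsLinearFun (iota X) :=
  fun _ => ⟨fun _ _ => rfl, fun _ _ => rfl⟩

theorem iota_injective :
    Function.Injective (iota : Cₛ^∞⟮𝓘(ℝ, E); F, V⟯ → DualFun 𝓘(ℝ, E) F V) := fun _ _ h =>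
  ContMDiffSection.ext fun x => eq_of_forall_dual_apply_eq F fun l =>
    congrArg (fun f : DualFun 𝓘(ℝ, E) F V => f ⟨x, l⟩) h

variable (F V) in
/-- The pullback to `V*` of functions on the base. -/
def basic : C^∞⟮𝓘(ℝ, E), M; ℝ⟯ →ₗ[ℝ] DualFun 𝓘(ℝ, E) F V where
  toFun f := ⟨fun p => f p.1, f.contMDiff.comp (contMDiff_proj _)⟩
  map_add' _ _ := rfl
  map_smul' _ _ := rfl

theorem basic_apply (f : C^∞⟮𝓘(ℝ, E), M; ℝ⟯) (p : VDualTotal F V) : basic F V f p = f p.1 := rfl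

theorem iota_smulSec (f : C^∞⟮𝓘(ℝ, E), M; ℝ⟯) (X : Cₛ^∞⟮𝓘(ℝ, E); F, V⟯) :
    iota (smulSec f X) = basic F V f * iota X :=
  ContMDiffMap.ext fun p => map_smul p.2 (f p.1) (X p.1)

variable (E F V) in
/-- The functions `ι_X + h` on `V*`, which are those that are affine on the fibres. -/
abbrev fibreAffine :
    Cₛ^∞⟮𝓘(ℝ, E); F, V⟯ × C^∞⟮𝓘(ℝ, E), M; ℝ⟯ →ₗ[ℝ] DualFun 𝓘(ℝ, E) F V :=
  LinearMap.coprod iota (basic F V)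

theorem fibreAffine_apply (c : Cₛ^∞⟮𝓘(ℝ, E); F, V⟯ × C^∞⟮𝓘(ℝ, E), M; ℝ⟯) (p : VDualTotal F V) :
    fibreAffine E F V c p = p.2 (c.1 p.1) + c.2 p.1 := rfl

variable [ContMDiffVectorBundle ∞ F V 𝓘(ℝ, E)]

theorem contMDiff_fibre_line (x : M) (l m : VDual V x) :
    ContMDiff 𝓘(ℝ, ℝ) (𝓘(ℝ, E).prod 𝓘(ℝ, F →L[ℝ] ℝ)) ∞
      (fun t : ℝ => (⟨x, l + t • m⟩ : VDualTotal F V)) := by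
  have hx := mem_baseSet_dualTriv (mem_baseSet_trivializationAt F V x)
  rw [(dualTriv F V x).contMDiff_iff fun t => by rw [Trivialization.mem_source]; exact hx]
  refine ⟨contMDiff_const, ?_⟩
  have hline : (fun t : ℝ => (dualTriv F V x ⟨x, l + t • m⟩).2) =
      fun t : ℝ => (dualTriv F V x ⟨x, l⟩).2 + t • (dualTriv F V x ⟨x, m⟩).2 := funext fun t => by
    have hlin := (dualTriv F V x).linear ℝ hx
    rw [hlin.map_add, hlin.map_smul]
  rw [hline]
  exact contMDiff_const.add (contMDiff_id.smul contMDiff_const)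

theorem dualFun_ext_of_ne_zero [Nontrivial F] {f g : DualFun 𝓘(ℝ, E) F V}
    (h : ∀ x (l : VDual V x), l ≠ 0 → f ⟨x, l⟩ = g ⟨x, l⟩) : f = g := by
  refine ContMDiffMap.ext fun ⟨x, l⟩ => ?_
  by_cases hl : l = 0
  · obtain ⟨m, hm⟩ := exists_dual_ne_zero F V x
    have hc := (contMDiff_fibre_line (E := E) (F := F) x 0 m).continuous
    have hline : (fun t : ℝ => f ⟨x, 0 + t • m⟩) = fun t : ℝ => g ⟨x, 0 + t • m⟩ :=
      Continuous.ext_on (dense_compl_singleton (0 : ℝ)) (f.contMDiff.continuous.comp hc)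
        (g.contMDiff.continuous.comp hc) fun t ht => h x _ (by
          rw [zero_add]
          exact smul_ne_zero ht hm)
    simpa only [hl, zero_smul, add_zero] using congrFun hline 0
  · exact h x l hl

theorem contMDiffOn_of_dual_apply [FiniteDimensional ℝ F] {s : ∀ x, V x} (x₀ : M)
    (hs : ∀ β : F →L[ℝ] ℝ, ContMDiffOn 𝓘(ℝ, E) 𝓘(ℝ, ℝ) ∞
      (fun y => ((dualTriv F V x₀).symm y β : VDual V y) (s y))
      (trivializationAt F V x₀).baseSet) :
    ContMDiffOn 𝓘(ℝ, E) (𝓘(ℝ, E).prod 𝓘(ℝ, F)) ∞ (fun y => TotalSpace.mk' F y (s y))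
      (trivializationAt F V x₀).baseSet := by
  rw [Trivialization.contMDiffOn_section_baseSet_iff]
  let b := Module.finBasis ℝ F
  have hsum : (fun y => (trivializationAt F V x₀ ⟨y, s y⟩).2) =
      fun y => ∑ i, b.coord i (trivializationAt F V x₀ ⟨y, s y⟩).2 • b i :=
    funext fun y => (b.sum_repr _).symm
  rw [hsum]
  refine contMDiffOn_finsetSum fun i _ => ContMDiffOn.smul
    ((hs (LinearMap.toContinuousLinearMap (b.coord i))).congr fun y hy => ?_) contMDiffOn_const
  rw [dualTriv_symm_apply hy]
  rfl

theorem IsLinearFun.exists_iota [FiniteDimensional ℝ F] {f : DualFun 𝓘(ℝ, E) F V}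
    (hf : IsLinearFun f) : ∃ X : Cₛ^∞⟮𝓘(ℝ, E); F, V⟯, f = iota X := by
  choose v hv using fun x => exists_dual_fibre_eval_eq F (hf x).mk'
  refine ⟨⟨v, fun x₀ => ?_⟩, ContMDiffMap.ext fun p => hv p.1 p.2⟩
  refine (contMDiffOn_of_dual_apply x₀ fun β => ?_).contMDiffAt
    ((trivializationAt F V x₀).open_baseSet.mem_nhds (mem_baseSet_trivializationAt F V x₀))
  refine (f.contMDiff.comp_contMDiffOn ((contMDiffOn_trivialization_symm_const
    (dualTriv F V x₀) β).mono fun y hy => mem_baseSet_dualTriv hy)).congr fun y _ => ?_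
  exact (hv y _).symm

variable [FiniteDimensional ℝ E] [IsManifold 𝓘(ℝ, E) ∞ M] [T2Space M]

theorem eq_zero_of_forall_mul_iota_eq_zero [Nontrivial F] {f : DualFun 𝓘(ℝ, E) F V}
    (h : ∀ X : Cₛ^∞⟮𝓘(ℝ, E); F, V⟯, f * iota X = 0) : f = 0 := by
  refine dualFun_ext_of_ne_zero fun x l hl => ?_
  obtain ⟨X, hX⟩ := exists_section_dual_apply_ne_zero E F hl
  have hfX : f ⟨x, l⟩ * l (X x) = 0 := congrArg (fun f : DualFun 𝓘(ℝ, E) F V => f ⟨x, l⟩) (h X)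
  exact (mul_eq_zero.1 hfX).resolve_right hX

variable (E F V) in
theorem containsCoordinates_fibreAffine [FiniteDimensional ℝ F] :
    ContainsCoordinates (fibreAffine E F V) := by
  intro p ℓ
  obtain ⟨u, hu⟩ := exists_dual_eval_eq (ℓ ∘L .inr ℝ E (F →L[ℝ] ℝ)).toLinearMap
  obtain ⟨X, hX⟩ := exists_section_eventuallyEq_symm_const (E := E) (V := V) p.1 u
  have hcoord : ContMDiffOn 𝓘(ℝ, E) 𝓘(ℝ, ℝ) ∞ (fun y => ℓ (extChartAt 𝓘(ℝ, E) p.1 y, 0))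
      (extChartAt 𝓘(ℝ, E) p.1).source := by
    rw [extChartAt_source]
    exact (ℓ ∘L .inl ℝ E (F →L[ℝ] ℝ)).contMDiff.comp_contMDiffOn contMDiffOn_extChartAt
  obtain ⟨h, hh⟩ := exists_contMDiffMap_eventuallyEq (extChartAt_source_mem_nhds p.1) hcoord
  refine ⟨(X, h), ?_⟩
  filter_upwards [eventually_fst_mem hX, eventually_fst_mem hh, eventually_fst_mem
    ((trivializationAt F V p.1).open_baseSet.mem_nhds (mem_baseSet_trivializationAt F V p.1))]
    with q hXq hhq hq
  have hchart : extChartAt (𝓘(ℝ, E).prod 𝓘(ℝ, F →L[ℝ] ℝ)) p q =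
      (extChartAt 𝓘(ℝ, E) p.1 q.1, 0) + (0, (dualTriv F V p.1 q).2) := by
    rw [FiberBundle.extChartAt, Prod.mk_add_mk, add_zero, zero_add]
    rfl
  rw [fibreAffine_apply, hXq, hhq, ← dualTriv_apply hq, ← hu, hchart, map_add, add_comm]
  rfl

variable [FiniteDimensional ℝ F] [Nontrivial F]

theorem derivation_eq_zero_of_iota
    {δ : Derivation ℝ (DualFun 𝓘(ℝ, E) F V) (DualFun 𝓘(ℝ, E) F V)}
    (h : ∀ X : Cₛ^∞⟮𝓘(ℝ, E); F, V⟯, δ (iota X) = 0) : δ = 0 := by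
  refine (containsCoordinates_fibreAffine E F V).derivation_eq_zero fun c => ?_
  have hbasic : δ (basic F V c.2) = 0 := eq_zero_of_forall_mul_iota_eq_zero fun X => by
    have hX := h (smulSec c.2 X)
    rwa [iota_smulSec, Derivation.leibniz, h, smul_zero, zero_add, smul_eq_mul, mul_comm] at hX
  rw [LinearMap.coprod_apply, Derivation.map_add, h, hbasic, add_zero]

theorem derivation_ext_of_iota
    {δ δ' : Derivation ℝ (DualFun 𝓘(ℝ, E) F V) (DualFun 𝓘(ℝ, E) F V)}
    (h : ∀ X : Cₛ^∞⟮𝓘(ℝ, E); F, V⟯, δ (iota X) = δ' (iota X)) : δ = δ' :=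
  sub_eq_zero.1 (derivation_eq_zero_of_iota fun X => by rw [Derivation.sub_apply, h, sub_self])

end FunctionsOnDual

section AffineCoordinates

theorem baseSet_inter_baseSet_mem_nhds {M : Type*} [TopologicalSpace M] (F : Type*)
    [TopologicalSpace F] (V A : M → Type*) [TopologicalSpace (TotalSpace F V)]
    [∀ x, TopologicalSpace (V x)] [FiberBundle F V] [TopologicalSpace (TotalSpace F A)]
    [∀ x, TopologicalSpace (A x)] [FiberBundle F A] (x₀ : M) :
    (trivializationAt F A x₀).baseSet ∩ (trivializationAt F V x₀).baseSet ∈ 𝓝 x₀ :=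
  ((trivializationAt F A x₀).open_baseSet.inter (trivializationAt F V x₀).open_baseSet).mem_nhds
    ⟨mem_baseSet_trivializationAt F A x₀, mem_baseSet_trivializationAt F V x₀⟩

variable {M : Type*} [TopologicalSpace M] {F : Type*} [NormedAddCommGroup F] [NormedSpace ℝ F]
  {V : M → Type*} [∀ x, AddCommGroup (V x)] [∀ x, Module ℝ (V x)]
  [TopologicalSpace (TotalSpace F V)] [∀ x, TopologicalSpace (V x)] [FiberBundle F V]
  {A : M → Type*} [∀ x, AddTorsor (V x) (A x)]
  [TopologicalSpace (TotalSpace F A)] [∀ x, TopologicalSpace (A x)] [FiberBundle F A]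

omit [∀ x, TopologicalSpace (A x)] [FiberBundle F A] in
theorem injective_of_trivialization_vadd [VectorBundle ℝ F V] (e : Trivialization F (π F A))
    (e' : Trivialization F (π F V)) [MemTrivializationAtlas e'] {x : M} (hx : x ∈ e.baseSet)
    (hx' : x ∈ e'.baseSet) {L : F →ₗ[ℝ] F}
    (hL : ∀ (v : V x) (a : A x), (e ⟨x, v +ᵥ a⟩).2 = L (e' ⟨x, v⟩).2 + (e ⟨x, a⟩).2) :
    Function.Injective L := by
  rw [injective_iff_map_eq_zero]
  intro u hu
  obtain ⟨a⟩ : Nonempty (A x) := inferInstance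
  have hcoord := hL (e'.symm x u) a
  rw [e'.apply_mk_symm hx', hu, zero_add] at hcoord
  have hfix : e'.symm x u +ᵥ a = a := by
    rw [← e.symm_apply_apply_mk hx (e'.symm x u +ᵥ a), hcoord, e.symm_apply_apply_mk hx]
  have hzero : e'.symm x u = 0 := vadd_right_cancel a (hfix.trans (zero_vadd _ a).symm)
  have hu' := e'.apply_mk_symm hx' u
  rw [hzero] at hu'
  exact (congrArg Prod.snd hu').symm.trans (e'.linear ℝ hx').map_zero

end AffineCoordinates

section AffineFunctions

variable {M : Type*} {F : Type*}
  {V : M → Type*} [∀ x, AddCommGroup (V x)] [∀ x, Module ℝ (V x)]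
  {A : M → Type*} [∀ x, AddTorsor (V x) (A x)]

theorem affDual_ext {x : M} {φ ψ : AffDual F A x} (h : ∀ b : A x, φ b = ψ b) : φ = ψ :=
  AffineMap.ext (k := ℝ) (P1 := A x) (P2 := ℝ) h

/-- The affine function on `A x` with linear part `l` that vanishes at `a`. -/
def affFun [∀ x, TopologicalSpace (V x)] {x : M} (a : A x) (l : VDual V x) : AffDual F A x :=
  ((l : V x →ₗ[ℝ] ℝ).toAffineMap.comp (AffineEquiv.vaddConst ℝ a).symm.toAffineMap : _)

theorem affFun_apply [∀ x, TopologicalSpace (V x)] {x : M} (a : A x) (l : VDual V x) (b : A x) :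
    (affFun a l : AffDual F A x) b = l (b -ᵥ a) := rfl

variable [TopologicalSpace M] [NormedAddCommGroup F] [NormedSpace ℝ F] [FiniteDimensional ℝ F]
  [TopologicalSpace (TotalSpace F V)] [∀ x, TopologicalSpace (V x)] [FiberBundle F V]
  [VectorBundle ℝ F V]

theorem rho_apply_vsub {x : M} (φ : AffDual F A x) (b a : A x) : rho φ (b -ᵥ a) = φ b - φ a :=
  AffineMap.linearMap_vsub (k := ℝ) (P1 := A x) (P2 := ℝ) φ b a

theorem rho_affFun {x : M} (a : A x) (l : VDual V x) : rho (affFun a l : AffDual F A x) = l := by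
  ext v
  have h := rho_apply_vsub (affFun a l : AffDual F A x) (v +ᵥ a) a
  rwa [affFun_apply, affFun_apply, vsub_self, vadd_vsub, map_zero, sub_zero] at h

variable [TopologicalSpace (TotalSpace F A)] [∀ x, TopologicalSpace (A x)] [FiberBundle F A]
  [AffineBundle F V A]

omit [TopologicalSpace (TotalSpace F V)] [∀ x, TopologicalSpace (V x)] [FiberBundle F V]
  [VectorBundle ℝ F V] in
theorem trivializationAt_affDual_apply {x₀ y : M} (hy : y ∈ (trivializationAt F A x₀).baseSet)
    (φ : AffDual F A y) :
    (trivializationAt ((F →L[ℝ] ℝ) × ℝ) (AffDual F A) x₀ ⟨y, φ⟩).2 =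
      dualFibre (trivializationAt F A x₀) hy φ :=
  congrArg Prod.snd (dualPretriv_apply (trivializationAt F A x₀) hy φ)

theorem dualFibre_affFun {x₀ x : M} (hA : x ∈ (trivializationAt F A x₀).baseSet)
    (hV : x ∈ (trivializationAt F V x₀).baseSet) {T : F →L[ℝ] F}
    (hT : ∀ a b : A x, (trivializationAt F V x₀ ⟨x, (a -ᵥ b : V x)⟩).2 =
      T ((trivializationAt F A x₀ ⟨x, a⟩).2 - (trivializationAt F A x₀ ⟨x, b⟩).2))
    (a : A x) (l : VDual V x) :
    dualFibre (trivializationAt F A x₀) hA (affFun a l) =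
      ((dualTriv F V x₀ ⟨x, l⟩).2 ∘L T,
        -(dualTriv F V x₀ ⟨x, l⟩).2 (T (trivializationAt F A x₀ ⟨x, a⟩).2)) := by
  have haff (u : F) : (affFun a l : AffDual F A x) ((trivializationAt F A x₀).symm x u) =
      (dualTriv F V x₀ ⟨x, l⟩).2 (T (u - (trivializationAt F A x₀ ⟨x, a⟩).2)) := by
    rw [affFun_apply, apply_eq_dualTriv hV, hT, Trivialization.apply_mk_symm _ hA]
  refine Prod.ext (ContinuousLinearMap.ext fun u => ?_) ?_
  · rw [dualFibre_fst, haff, haff, ← map_sub, ← map_sub, sub_sub_sub_cancel_right, sub_zero]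
    rfl
  · rw [dualFibre_snd, haff, zero_sub, map_neg, map_neg]

end AffineFunctions

section AffineSections

variable {E : Type*} [NormedAddCommGroup E] [NormedSpace ℝ E]
  {M : Type*} [TopologicalSpace M] [ChartedSpace E M]
  {F : Type*} [NormedAddCommGroup F] [NormedSpace ℝ F] [FiniteDimensional ℝ F]
  {V : M → Type*} [∀ x, AddCommGroup (V x)] [∀ x, Module ℝ (V x)]
  [TopologicalSpace (TotalSpace F V)] [∀ x, TopologicalSpace (V x)] [FiberBundle F V]
  {A : M → Type*} [∀ x, AddTorsor (V x) (A x)]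
  [TopologicalSpace (TotalSpace F A)] [∀ x, TopologicalSpace (A x)] [FiberBundle F A]
  [SmoothAffineBundle F V A 𝓘(ℝ, E)]

variable (E A) in
theorem nonempty_section [FiniteDimensional ℝ E] [IsManifold 𝓘(ℝ, E) ∞ M] [T2Space M]
    [SecondCountableTopology M] [AffineBundle F V A] : Nonempty Cₛ^∞⟮𝓘(ℝ, E); F, A⟯ := by
  have : LocallyCompactSpace M := ChartedSpace.locallyCompactSpace E M
  have : SigmaCompactSpace M := sigmaCompactSpace_of_locallyCompact_secondCountable
  obtain ⟨ρ, hρ⟩ := SmoothPartitionOfUnity.exists_isSubordinate 𝓘(ℝ, E) isClosed_univ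
    (fun i : M => (trivializationAt F A i).baseSet)
    (fun i => (trivializationAt F A i).open_baseSet)
    fun x _ => mem_iUnion.2 ⟨x, mem_baseSet_trivializationAt F A x⟩
  have : ∀ x, Nonempty (A x) := fun x => AddTorsor.nonempty (G := V x)
  let a : M → ∀ x : M, A x := fun i x => (trivializationAt F A i).symm x 0
  refine ⟨⟨fun x => (∑ i ∈ ρ.finsupport x, ρ i x • (a i x -ᵥ a x x : V x)) +ᵥ a x x, fun x₀ => ?_⟩⟩
  rw [contMDiffAt_section]
  set e := trivializationAt F A x₀
  have hx₀ : x₀ ∈ e.baseSet := mem_baseSet_trivializationAt F A x₀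
  have hsum : ContMDiffAt 𝓘(ℝ, E) 𝓘(ℝ, F) ∞ (fun x => ∑ᶠ i, ρ i x • (e ⟨x, a i x⟩).2) x₀ := by
    refine ρ.contMDiffAt_finsum fun i hi => ?_
    exact (contMDiffOn_trans (V := V) e (trivializationAt F A i) 0).contMDiffAt
      ((e.open_baseSet.inter (trivializationAt F A i).open_baseSet).mem_nhds ⟨hx₀, hρ i hi⟩)
  refine hsum.congr_of_eventuallyEq ?_
  filter_upwards [e.open_baseSet.mem_nhds hx₀] with x hx
  rw [← ρ.sum_finsupport_smul_eq_finsum x (fun i x => (e ⟨x, a i x⟩).2)]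
  have hfibre (b : A x) : (e ⟨x, b⟩).2 = fibreMap (V := V) e hx b := rfl
  rw [hfibre, (fibreMap (V := V) e hx).map_vadd, map_sum, vadd_eq_add]
  simp_rw [map_smul, AffineMap.linearMap_vsub, vsub_eq_sub, smul_sub, Finset.sum_sub_distrib,
    ← Finset.sum_smul, ρ.sum_finsupport x (mem_univ x), one_smul, sub_add_cancel, hfibre]

variable [VectorBundle ℝ F V]

variable (E F V A) in
theorem exists_trivializationAt_vsub_eq (x₀ : M) :
    ∃ T : M → F →L[ℝ] F,
      ContMDiffOn 𝓘(ℝ, E) 𝓘(ℝ, F →L[ℝ] F) ∞ T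
        ((trivializationAt F A x₀).baseSet ∩ (trivializationAt F V x₀).baseSet) ∧
      ∀ x ∈ (trivializationAt F A x₀).baseSet ∩ (trivializationAt F V x₀).baseSet, ∀ a b : A x,
        (trivializationAt F V x₀ ⟨x, (a -ᵥ b : V x)⟩).2 =
          T x ((trivializationAt F A x₀ ⟨x, a⟩).2 - (trivializationAt F A x₀ ⟨x, b⟩).2) := by
  obtain ⟨g, hg, hgv⟩ := SmoothAffineBundle.smooth_linear (I := 𝓘(ℝ, E))
    (trivializationAt F A x₀) (trivializationAt F V x₀)
  choose! L hL using fun (x : M)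
      (hx : x ∈ (trivializationAt F A x₀).baseSet ∩ (trivializationAt F V x₀).baseSet) =>
    show ∃ L : F ≃L[ℝ] F, (L : F →L[ℝ] F) = g x from
      ⟨(LinearEquiv.ofInjectiveEndo (g x : F →ₗ[ℝ] F)
        (injective_of_trivialization_vadd _ _ hx.1 hx.2 (hgv x hx))).toContinuousLinearEquiv,
        ContinuousLinearMap.ext fun _ => rfl⟩
  refine ⟨fun x => ContinuousLinearMap.inverse (g x), fun x hx => ?_, fun x hx a b => ?_⟩
  · have hinverse : ContDiffAt ℝ ∞ (ContinuousLinearMap.inverse : (F →L[ℝ] F) → _) (g x) := by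
      rw [← hL x hx]
      exact contDiffAt_map_inverse (L x)
    exact hinverse.contMDiffAt.comp_contMDiffWithinAt x (hg x hx)
  · have hsub := hgv x hx (a -ᵥ b) b
    rw [vsub_vadd] at hsub
    beta_reduce
    rw [hsub, add_sub_cancel_right, ← hL x hx, ContinuousLinearMap.inverse_equiv]
    exact ((L x).symm_apply_apply _).symm

theorem exists_vadd_section (a b : Cₛ^∞⟮𝓘(ℝ, E); F, A⟯) :
    ∃ X : Cₛ^∞⟮𝓘(ℝ, E); F, V⟯, a = X +ᵥ b := by
  refine ⟨⟨fun x => a x -ᵥ b x, fun x₀ => ?_⟩,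
    ContMDiffSection.ext fun x => (vsub_vadd (a x) (b x)).symm⟩
  obtain ⟨T, hT, hsub⟩ := exists_trivializationAt_vsub_eq E F V A x₀
  have ha := a.contMDiff x₀
  have hb := b.contMDiff x₀
  rw [contMDiffAt_section] at ha hb ⊢
  have hU := baseSet_inter_baseSet_mem_nhds F V A x₀
  refine ((hT.contMDiffAt hU).clm_apply (ha.sub hb)).congr_of_eventuallyEq ?_
  filter_upwards [hU] with x hx using hsub x hx _ _

end AffineSections

section SectionsOfRho

variable {E : Type*} [NormedAddCommGroup E] [NormedSpace ℝ E]
  {M : Type*} [TopologicalSpace M] [ChartedSpace E M]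
  {F : Type*} [NormedAddCommGroup F] [NormedSpace ℝ F] [FiniteDimensional ℝ F]
  {V : M → Type*} [∀ x, AddCommGroup (V x)] [∀ x, Module ℝ (V x)]
  [TopologicalSpace (TotalSpace F V)] [∀ x, TopologicalSpace (V x)] [FiberBundle F V]
  [VectorBundle ℝ F V]
  {A : M → Type*} [∀ x, AddTorsor (V x) (A x)]
  [TopologicalSpace (TotalSpace F A)] [∀ x, TopologicalSpace (A x)] [FiberBundle F A]
  [AffineBundle F V A]

theorem rhoSection_ext {σ τ : RhoSection 𝓘(ℝ, E) F V A}
    (h : ∀ p (b : A p.1), σ.toFun p b = τ.toFun p b) : σ = τ :=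
  RhoSection.ext (funext fun p => affDual_ext (h p))

theorem rhoSection_sub_apply_eq (σ τ : RhoSection 𝓘(ℝ, E) F V A) (p : VDualTotal F V)
    (b b' : A p.1) : σ.toFun p b - τ.toFun p b = σ.toFun p b' - τ.toFun p b' := by
  have hσ := rho_apply_vsub (σ.toFun p) b b'
  have hτ := rho_apply_vsub (τ.toFun p) b b'
  rw [σ.rho_toFun] at hσ
  rw [τ.rho_toFun] at hτ
  exact sub_eq_sub_iff_sub_eq_sub.1 (hσ.symm.trans hτ)

theorem contMDiff_rhoSection_sub_apply (σ τ : RhoSection 𝓘(ℝ, E) F V A)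
    (b : ∀ p : VDualTotal F V, A p.1) :
    ContMDiff (𝓘(ℝ, E).prod 𝓘(ℝ, F →L[ℝ] ℝ)) 𝓘(ℝ, ℝ) ∞
      fun p => σ.toFun p (b p) - τ.toFun p (b p) := fun p₀ => by
  have hσ := σ.smooth p₀
  have hτ := τ.smooth p₀
  rw [contMDiffAt_totalSpace] at hσ hτ
  have hsnd : ContMDiff 𝓘(ℝ, (F →L[ℝ] ℝ) × ℝ) 𝓘(ℝ, ℝ) ∞ (Prod.snd : (F →L[ℝ] ℝ) × ℝ → ℝ) :=
    contDiff_snd.contMDiff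
  refine (((hsnd _).comp p₀ hσ.2).sub ((hsnd _).comp p₀ hτ.2)).congr_of_eventuallyEq ?_
  filter_upwards [eventually_fst_mem ((trivializationAt F A p₀.1).open_baseSet.mem_nhds
    (mem_baseSet_trivializationAt F A p₀.1))] with p hp
  rw [rhoSection_sub_apply_eq σ τ p _ ((trivializationAt F A p₀.1).symm p.1 0),
    ← dualFibre_snd _ hp, ← dualFibre_snd _ hp, ← trivializationAt_affDual_apply hp,
    ← trivializationAt_affDual_apply hp]
  rfl

theorem vadd_rhoSection_apply (f : DualFun 𝓘(ℝ, E) F V) (σ : RhoSection 𝓘(ℝ, E) F V A)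
    (p : VDualTotal F V) (b : A p.1) : (f +ᵥ σ).toFun p b = σ.toFun p b + f p :=
  congrArg (σ.toFun p b + ·) (mul_one (f p))

theorem exists_vadd_rhoSection (σ τ : RhoSection 𝓘(ℝ, E) F V A) :
    ∃ f : DualFun 𝓘(ℝ, E) F V, σ = f +ᵥ τ := by
  let f : DualFun 𝓘(ℝ, E) F V :=
    ⟨_, contMDiff_rhoSection_sub_apply σ τ fun _ => Classical.arbitrary _⟩
  refine ⟨f, rhoSection_ext fun p b => ?_⟩
  have hf : f p = σ.toFun p b - τ.toFun p b := rhoSection_sub_apply_eq σ τ p _ b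
  rw [vadd_rhoSection_apply, hf, add_sub_cancel]

section

variable [SmoothAffineBundle F V A 𝓘(ℝ, E)]

theorem contMDiff_affFun (a : Cₛ^∞⟮𝓘(ℝ, E); F, A⟯) :
    ContMDiff (𝓘(ℝ, E).prod 𝓘(ℝ, F →L[ℝ] ℝ)) (𝓘(ℝ, E).prod 𝓘(ℝ, (F →L[ℝ] ℝ) × ℝ)) ∞
      (fun p : VDualTotal F V =>
        TotalSpace.mk' ((F →L[ℝ] ℝ) × ℝ) (E := AffDual F A) p.1 (affFun (a p.1) p.2)) := by
  intro p₀
  obtain ⟨T, hT, hsub⟩ := exists_trivializationAt_vsub_eq E F V A p₀.1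
  rw [contMDiffAt_totalSpace]
  have hproj : ContMDiffAt (𝓘(ℝ, E).prod 𝓘(ℝ, F →L[ℝ] ℝ)) 𝓘(ℝ, E) ∞
      (fun p : VDualTotal F V => p.1) p₀ := contMDiff_proj _ p₀
  refine ⟨hproj, ?_⟩
  have hU := baseSet_inter_baseSet_mem_nhds F V A p₀.1
  have hl : ContMDiffAt (𝓘(ℝ, E).prod 𝓘(ℝ, F →L[ℝ] ℝ)) 𝓘(ℝ, F →L[ℝ] ℝ) ∞
    (fun p : VDualTotal F V => (dualTriv F V p₀.1 p).2) p₀ :=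
      (contMDiffAt_totalSpace.1 contMDiffAt_id).2
  have ha := ((contMDiffAt_section _).1 (a.contMDiff p₀.1)).comp p₀ hproj
  have hTp := (hT.contMDiffAt hU).comp p₀ hproj
  refine ((hl.clm_comp hTp).prodMk_space
    (hl.clm_apply (hTp.clm_apply ha)).neg).congr_of_eventuallyEq ?_
  filter_upwards [eventually_fst_mem hU] with p hp
  exact (trivializationAt_affDual_apply hp.1 _).trans
    (dualFibre_affFun hp.1 hp.2 (hsub p.1 hp) _ _)

/-- The section of `ρ` that maps a linear function to the affine function with this linear part
that vanishes on `a`. -/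
def vanishingSection (a : Cₛ^∞⟮𝓘(ℝ, E); F, A⟯) : RhoSection 𝓘(ℝ, E) F V A where
  toFun p := affFun (a p.1) p.2
  smooth := contMDiff_affFun a
  rho_toFun p := rho_affFun (a p.1) p.2

theorem vanishingSection_apply (a : Cₛ^∞⟮𝓘(ℝ, E); F, A⟯) (p : VDualTotal F V) (b : A p.1) :
    (vanishingSection a : RhoSection 𝓘(ℝ, E) F V A).toFun p b = p.2 (b -ᵥ a p.1) := rfl

theorem isLinear_vanishingSection (a : Cₛ^∞⟮𝓘(ℝ, E); F, A⟯) :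
    (vanishingSection a : RhoSection 𝓘(ℝ, E) F V A).IsLinear := fun _ =>
  ⟨fun _ _ => affDual_ext fun _ => rfl, fun _ _ => affDual_ext fun _ => rfl⟩

theorem vanishingSection_vadd (X : Cₛ^∞⟮𝓘(ℝ, E); F, V⟯) (a : Cₛ^∞⟮𝓘(ℝ, E); F, A⟯) :
    (vanishingSection (X +ᵥ a) : RhoSection 𝓘(ℝ, E) F V A) = -iota X +ᵥ vanishingSection a := by
  refine rhoSection_ext fun p b => ?_
  rw [vadd_rhoSection_apply, vanishingSection_apply, vanishingSection_apply]
  change p.2 (b -ᵥ (X p.1 +ᵥ a p.1)) = p.2 (b -ᵥ a p.1) + -p.2 (X p.1)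
  rw [vsub_vadd_eq_vsub_sub, map_sub, sub_eq_add_neg]

theorem iota_vadd_vanishingSection (X : Cₛ^∞⟮𝓘(ℝ, E); F, V⟯) (a : Cₛ^∞⟮𝓘(ℝ, E); F, A⟯) :
    (iota X +ᵥ vanishingSection a : RhoSection 𝓘(ℝ, E) F V A) = vanishingSection (-X +ᵥ a) := by
  rw [vanishingSection_vadd, map_neg, neg_neg]

theorem vanishingSection_injective : Function.Injective
    (vanishingSection : Cₛ^∞⟮𝓘(ℝ, E); F, A⟯ → RhoSection 𝓘(ℝ, E) F V A) := by
  intro a b h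
  refine ContMDiffSection.ext fun x => ?_
  rw [← vsub_eq_zero_iff_eq (G := V x)]
  refine eq_of_forall_dual_apply_eq F fun l => ?_
  have hl : l (a x -ᵥ a x) = l (a x -ᵥ b x) :=
    congrArg (fun σ : RhoSection 𝓘(ℝ, E) F V A => σ.toFun ⟨x, l⟩ (a x)) h
  rw [← hl, vsub_self]

end

variable [FiniteDimensional ℝ E] [IsManifold 𝓘(ℝ, E) ∞ M] [T2Space M] [SecondCountableTopology M]
  [ContMDiffVectorBundle ∞ F V 𝓘(ℝ, E)] [SmoothAffineBundle F V A 𝓘(ℝ, E)]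

theorem exists_vanishingSection_eq {σ : RhoSection 𝓘(ℝ, E) F V A} (hσ : σ.IsLinear) :
    ∃ a : Cₛ^∞⟮𝓘(ℝ, E); F, A⟯, vanishingSection a = σ := by
  obtain ⟨a₀⟩ := nonempty_section E (F := F) (V := V) A
  obtain ⟨f, rfl⟩ := exists_vadd_rhoSection σ (vanishingSection a₀)
  have hf : ∀ x (l : VDual V x),
      (f +ᵥ vanishingSection a₀ : RhoSection 𝓘(ℝ, E) F V A).toFun ⟨x, l⟩ (a₀ x) = f ⟨x, l⟩ := by
    intro x l
    rw [vadd_rhoSection_apply, vanishingSection_apply, vsub_self, map_zero]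
    exact zero_add _
  have hf_linear : IsLinearFun f := by
    refine fun x => ⟨fun l m => ?_, fun r l => ?_⟩
    · rw [← hf, ← hf, ← hf, (hσ x).map_add]
      rfl
    · rw [← hf, ← hf, (hσ x).map_smul]
      rfl
  obtain ⟨X, rfl⟩ := hf_linear.exists_iota
  exact ⟨-X +ᵥ a₀, by rw [vanishingSection_vadd, map_neg, neg_neg]⟩

variable (E F V A) in
/-- The bijection `σ ↦ a_σ` between linear sections of `ρ` and sections of `A`; its inverse is
`vanishingSection`. -/
def linSecEquiv : LinSec 𝓘(ℝ, E) F V A ≃ Cₛ^∞⟮𝓘(ℝ, E); F, A⟯ :=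
  (Equiv.ofBijective (fun a : Cₛ^∞⟮𝓘(ℝ, E); F, A⟯ =>
    (⟨vanishingSection a, isLinear_vanishingSection a⟩ : LinSec 𝓘(ℝ, E) F V A))
    ⟨fun _ _ h => vanishingSection_injective (congrArg Subtype.val h), fun σ =>
      (exists_vanishingSection_eq σ.2).imp fun _ ha => Subtype.ext ha⟩).symm

theorem linSecEquiv_symm_apply (a : Cₛ^∞⟮𝓘(ℝ, E); F, A⟯) :
    ((linSecEquiv E F V A).symm a).1 = vanishingSection a := rfl

theorem vanishingSection_linSecEquiv (σ : LinSec 𝓘(ℝ, E) F V A) :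
    vanishingSection (linSecEquiv E F V A σ) = σ.1 := by
  rw [← linSecEquiv_symm_apply, Equiv.symm_apply_apply]

theorem apply_linSecEquiv_smul_oneA (σ : LinSec 𝓘(ℝ, E) F V A) (x : M) (φ : AffDual F A x) :
    φ (linSecEquiv E F V A σ x) • oneA F A x = φ - σ.1.toFun ⟨x, rho φ⟩ := by
  rw [← vanishingSection_linSecEquiv σ]
  refine affDual_ext fun b => ?_
  change φ (linSecEquiv E F V A σ x) * 1 = φ b - rho φ (b -ᵥ linSecEquiv E F V A σ x)
  rw [rho_apply_vsub, mul_one, sub_sub_cancel]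

end SectionsOfRho

section AffineLieBrackets

variable {W S : Type*} [AddCommGroup W] [Module ℝ W] [AddAction W S]

/-- The bilinear part of a bi-affine bracket, computed at the base point `s`. -/
def bilinPart (B : S → S → W) (s : S) (w w' : W) : W := vpart B (w +ᵥ s) w' - vpart B s w'

omit [Module ℝ W] in
theorem vpart_vadd (B : S → S → W) (s : S) (w w' : W) :
    vpart B (w +ᵥ s) w' = vpart B s w' + bilinPart B s w w' := by
  rw [bilinPart]
  abel

namespace IsAffineLieBracket

variable {B : S → S → W}

theorem apply_self (hB : IsAffineLieBracket B) (s : S) : B s s = 0 := by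
  have h : (2 : ℝ) • B s s = 0 := by
    rw [two_smul]
    exact add_eq_zero_iff_eq_neg.2 (hB.skew s s)
  exact (smul_eq_zero.1 h).resolve_left two_ne_zero

theorem exists_vpart_eq (hB : IsAffineLieBracket B) (s : S) :
    ∃ L : W →ₗ[ℝ] W, ∀ w, vpart B s w = L w := by
  obtain ⟨L, hL⟩ := hB.affine_right s
  exact ⟨L, fun w => by rw [vpart, hL, add_sub_cancel_right]⟩

theorem apply_vadd (hB : IsAffineLieBracket B) (s t : S) (w : W) :
    B s (w +ᵥ t) = vpart B s w + B s t := by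
  obtain ⟨L, hL⟩ := hB.affine_right s
  rw [vpart, hL, hL, add_sub_cancel_right]

/-- `vpart B s` as a linear map. -/
def vpartₗ (hB : IsAffineLieBracket B) (s : S) : W →ₗ[ℝ] W where
  toFun := vpart B s
  map_add' w w' := by
    obtain ⟨L, hL⟩ := hB.exists_vpart_eq s
    simp only [hL, map_add]
  map_smul' r w := by
    obtain ⟨L, hL⟩ := hB.exists_vpart_eq s
    simp only [hL, map_smul, RingHom.id_apply]

theorem vpartₗ_apply (hB : IsAffineLieBracket B) (s : S) (w : W) :
    hB.vpartₗ s w = vpart B s w := rfl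

theorem vpart_add (hB : IsAffineLieBracket B) (s : S) (w w' : W) :
    vpart B s (w + w') = vpart B s w + vpart B s w' :=
  map_add (hB.vpartₗ s) w w'

theorem vpart_neg (hB : IsAffineLieBracket B) (s : S) (w : W) : vpart B s (-w) = -vpart B s w :=
  map_neg (hB.vpartₗ s) w

theorem vpart_sub (hB : IsAffineLieBracket B) (s : S) (w w' : W) :
    vpart B s (w - w') = vpart B s w - vpart B s w' :=
  map_sub (hB.vpartₗ s) w w'

theorem vpart_smul (hB : IsAffineLieBracket B) (s : S) (r : ℝ) (w : W) :
    vpart B s (r • w) = r • vpart B s w :=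
  map_smul (hB.vpartₗ s) r w

theorem apply_vadd_vadd (hB : IsAffineLieBracket B) (s : S) (w w' : W) :
    B (w +ᵥ s) (w' +ᵥ s) = vpart B s w' - vpart B s w + bilinPart B s w w' := by
  rw [hB.apply_vadd, hB.skew (w +ᵥ s) s, hB.apply_vadd, hB.apply_self, bilinPart]
  abel

theorem bilinPart_skew (hB : IsAffineLieBracket B) (s : S) (w w' : W) :
    bilinPart B s w w' = -bilinPart B s w' w := by
  have h := hB.skew (w +ᵥ s) (w' +ᵥ s)
  rw [hB.apply_vadd_vadd, hB.apply_vadd_vadd] at h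
  rw [← eq_sub_iff_add_eq'] at h
  rw [h]
  abel

/-- `bilinPart B s` as a bilinear map. -/
def bilinPartₗ (hB : IsAffineLieBracket B) (s : S) : W →ₗ[ℝ] W →ₗ[ℝ] W :=
  LinearMap.mk₂ ℝ (bilinPart B s)
    (fun w₁ w₂ w => by
      rw [hB.bilinPart_skew, hB.bilinPart_skew s w₁, hB.bilinPart_skew s w₂]
      simp only [bilinPart, hB.vpart_add]
      abel)
    (fun r w₁ w => by
      rw [hB.bilinPart_skew, hB.bilinPart_skew s w₁]
      simp only [bilinPart, hB.vpart_smul, ← smul_sub, smul_neg])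
    (fun w w₁ w₂ => by
      simp only [bilinPart, hB.vpart_add]
      abel)
    (fun r w w₁ => by simp only [bilinPart, hB.vpart_smul, ← smul_sub])

theorem bilinPartₗ_apply (hB : IsAffineLieBracket B) (s : S) (w w' : W) :
    hB.bilinPartₗ s w w' = bilinPart B s w w' := rfl

theorem vpart_bilinPart (hB : IsAffineLieBracket B) (s : S) (w w' : W) :
    vpart B s (bilinPart B s w w') =
      bilinPart B s (vpart B s w) w' + bilinPart B s w (vpart B s w') := by
  have h := hB.jacobi (w +ᵥ s) (w' +ᵥ s) s
  rw [hB.apply_vadd_vadd, hB.skew (w' +ᵥ s) s, hB.apply_vadd, hB.apply_vadd, hB.apply_self,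
    add_zero, add_zero, hB.vpart_neg, vpart_vadd, vpart_vadd, hB.vpart_add, hB.vpart_sub,
    hB.bilinPart_skew s w' (vpart B s w)] at h
  rw [← sub_eq_zero, ← h]
  abel

theorem bilinPart_jacobi (hB : IsAffineLieBracket B) (s : S) (w₁ w₂ w₃ : W) :
    bilinPart B s w₁ (bilinPart B s w₂ w₃) + bilinPart B s w₂ (bilinPart B s w₃ w₁) +
      bilinPart B s w₃ (bilinPart B s w₁ w₂) = 0 := by
  have h := hB.jacobi (w₁ +ᵥ s) (w₂ +ᵥ s) (w₃ +ᵥ s)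
  simp only [hB.apply_vadd_vadd, vpart_vadd, hB.vpart_add, hB.vpart_sub, hB.vpart_bilinPart] at h
  rw [hB.bilinPart_skew s (vpart B s w₂) w₃, hB.bilinPart_skew s (vpart B s w₃) w₁,
    hB.bilinPart_skew s (vpart B s w₁) w₂] at h
  rw [← h]
  abel

end IsAffineLieBracket

/-- The bi-affine bracket with linear part `D` and bilinear part `b`, where `κ` is the chart of the
affine space `S` that sends `w +ᵥ s₀` to `w` for some base point `s₀`. -/
def bracketOfParts (κ : S → W) (D : W →ₗ[ℝ] W) (b : W →ₗ[ℝ] W →ₗ[ℝ] W) (s t : S) : W :=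
  D (κ t) - D (κ s) + b (κ s) (κ t)

variable {κ : S → W} {D : W →ₗ[ℝ] W} {b : W →ₗ[ℝ] W →ₗ[ℝ] W}

theorem vpart_bracketOfParts (hκ : ∀ w s, κ (w +ᵥ s) = w + κ s) (s : S) (w : W) :
    vpart (bracketOfParts κ D b) s w = D w + b (κ s) w := by
  simp only [vpart, bracketOfParts, hκ, map_add]
  abel

theorem isAffineLieBracket_bracketOfParts (hκ : ∀ w s, κ (w +ᵥ s) = w + κ s)
    (hskew : ∀ w w', b w w' = -b w' w) (hD : ∀ w w', D (b w w') = b (D w) w' + b w (D w'))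
    (hjac : ∀ w₁ w₂ w₃, b w₁ (b w₂ w₃) + b w₂ (b w₃ w₁) + b w₃ (b w₁ w₂) = 0) :
    IsAffineLieBracket (bracketOfParts κ D b) where
  affine_left t := ⟨b.flip (κ t) - D, fun w s => by
    simp only [bracketOfParts, hκ, map_add, LinearMap.sub_apply, LinearMap.flip_apply,
      LinearMap.add_apply]
    abel⟩
  affine_right s := ⟨b (κ s) + D, fun w t => by
    simp only [bracketOfParts, hκ, map_add, LinearMap.add_apply]
    abel⟩
  skew s t := by
    simp only [bracketOfParts]
    rw [hskew (κ s)]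
    abel
  jacobi s t u := by
    simp only [vpart_bracketOfParts hκ]
    simp only [bracketOfParts, map_add, map_sub, hD]
    rw [hskew (D (κ s)) (κ t), hskew (D (κ t)) (κ u), hskew (D (κ u)) (κ s),
      ← hjac (κ s) (κ t) (κ u)]
    abel

end AffineLieBrackets

section AntiAffineMaps

variable {W S W' S' : Type*} [AddCommGroup W] [Module ℝ W] [AddAction W S]
  [AddCommGroup W'] [Module ℝ W'] [AddAction W' S'] {B : S → S → W} {P : S' → S' → W'}
  {k : W →ₗ[ℝ] W'} {σ : S → S'}

theorem map_vpart (hP : IsAffineLieBracket P) (hσ : ∀ w s, σ (w +ᵥ s) = -k w +ᵥ σ s)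
    (h : ∀ s t, P (σ s) (σ t) = k (B s t)) (s : S) (w : W) :
    k (vpart B s w) = -vpart P (σ s) (k w) := by
  rw [vpart, map_sub, ← h, ← h, hσ, hP.apply_vadd, hP.vpart_neg, add_sub_cancel_right]

theorem map_bilinPart (hP : IsAffineLieBracket P) (hσ : ∀ w s, σ (w +ᵥ s) = -k w +ᵥ σ s)
    (h : ∀ s t, P (σ s) (σ t) = k (B s t)) (s : S) (w w' : W) :
    k (bilinPart B s w w') = bilinPart P (σ s) (k w) (k w') := by
  rw [bilinPart, map_sub, map_vpart hP hσ h, map_vpart hP hσ h, hσ, vpart_vadd,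
    ← hP.bilinPartₗ_apply, map_neg, LinearMap.neg_apply, hP.bilinPartₗ_apply]
  abel

theorem isAffineLieBracket_of_injective (hP : IsAffineLieBracket P) (hk : Function.Injective k)
    (hσ : ∀ w s, σ (w +ᵥ s) = -k w +ᵥ σ s) (h : ∀ s t, P (σ s) (σ t) = k (B s t)) :
    IsAffineLieBracket B := by
  have hskew : ∀ s t, B s t = -B t s := fun s t => hk (by rw [map_neg, ← h, ← h, hP.skew])
  have hright : ∀ s, IsAffine W (B s) := fun s =>
    ⟨{ toFun := vpart B s
       map_add' := fun w w' => hk (by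
        rw [map_add]
        simp only [map_vpart hP hσ h, map_add, hP.vpart_add, neg_add])
       map_smul' := fun r w => hk (by
        rw [RingHom.id_apply, map_smul]
        simp only [map_vpart hP hσ h, map_smul, hP.vpart_smul, smul_neg]) },
      fun w t => hk (by
        rw [map_add]
        change _ = k (vpart B s w) + _
        rw [map_vpart hP hσ h, ← h, ← h, hσ, hP.apply_vadd, hP.vpart_neg])⟩
  refine ⟨fun t => ?_, hright, hskew, fun s t u => hk ?_⟩
  · obtain ⟨L, hL⟩ := hright t
    exact ⟨-L, fun w s => by
      change B (w +ᵥ s) t = (-L) w + B s t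
      rw [hskew, hL, hskew s, LinearMap.neg_apply, neg_add]⟩
  · rw [map_add, map_add, map_zero]
    simp only [map_vpart hP hσ h, ← h]
    rw [← neg_add, ← neg_add, hP.jacobi, neg_zero]

end AntiAffineMaps

section FirstOrderOperators

theorem mfderiv_comp_eq_zero {E H N E' H' N' : Type*} [NormedAddCommGroup E] [NormedSpace ℝ E]
    [TopologicalSpace H] {I : ModelWithCorners ℝ E H} [TopologicalSpace N] [ChartedSpace H N]
    [NormedAddCommGroup E'] [NormedSpace ℝ E'] [TopologicalSpace H'] {I' : ModelWithCorners ℝ E' H'}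
    [TopologicalSpace N'] [ChartedSpace H' N'] {f : C^∞⟮I, N; ℝ⟯} {γ : N' → N} {y : N'}
    (hf : differential I (γ y) f = 0) (hγ : MDifferentiableAt I' I γ y) :
    mfderiv I' 𝓘(ℝ, ℝ) (f ∘ γ) y = 0 := by
  rw [mfderiv_comp y (f.contMDiff.mdifferentiableAt (by simp)) hγ]
  exact ContinuousLinearMap.ext fun v => congrArg (fun T => T (mfderiv I' I γ y v)) hf

variable {E : Type*} [NormedAddCommGroup E] [NormedSpace ℝ E]
  {M : Type*} [TopologicalSpace M] [ChartedSpace E M]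
  {F : Type*} [NormedAddCommGroup F] [NormedSpace ℝ F]
  {V : M → Type*} [∀ x, AddCommGroup (V x)] [∀ x, Module ℝ (V x)]
  [TopologicalSpace (TotalSpace F V)] [∀ x, TopologicalSpace (V x)] [FiberBundle F V]
  [VectorBundle ℝ F V]

theorem dirDeriv_eq_differential (f : C^∞⟮𝓘(ℝ, E), M; ℝ⟯) (x : M) (v : TangentSpace 𝓘(ℝ, E) x) :
    dirDeriv f x v = differential 𝓘(ℝ, E) x f v := rfl

theorem contMDiff_dirDeriv [IsManifold 𝓘(ℝ, E) ∞ M] {v : ∀ x : M, TangentSpace 𝓘(ℝ, E) x}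
    (hv : ContMDiff 𝓘(ℝ, E) 𝓘(ℝ, E).tangent ∞ (fun x => (⟨x, v x⟩ : TangentBundle 𝓘(ℝ, E) M)))
    (f : C^∞⟮𝓘(ℝ, E), M; ℝ⟯) :
    ContMDiff 𝓘(ℝ, E) 𝓘(ℝ, ℝ) ∞ (fun x => dirDeriv f x (v x)) :=
  (contMDiff_snd_tangentBundle_modelSpace ℝ 𝓘(ℝ, ℝ)).comp
    ((f.contMDiff.contMDiff_tangentMap (m := ∞) (by simp)).comp hv)

variable (F V) in
/-- Evaluation of sections at the point `x`. -/
def evalSection (x : M) : Cₛ^∞⟮𝓘(ℝ, E); F, V⟯ →ₗ[ℝ] V x where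
  toFun X := X x
  map_add' _ _ := rfl
  map_smul' _ _ := rfl

/-- A first-order operator on sections of `V`, followed by evaluation at `x`, whose symbol is
scalar and given by the tangent vector `z`. -/
def HasSymbolAt {x : M} (D : Cₛ^∞⟮𝓘(ℝ, E); F, V⟯ →ₗ[ℝ] V x) (z : TangentSpace 𝓘(ℝ, E) x) : Prop :=
  ∀ (f : C^∞⟮𝓘(ℝ, E), M; ℝ⟯) X, D (smulSec f X) = f x • D X + dirDeriv f x z • X x

variable [ContMDiffVectorBundle ∞ F V 𝓘(ℝ, E)]

theorem apply_eq_zero_of_differential_fibreAffine {p : VDualTotal F V}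
    {c : Cₛ^∞⟮𝓘(ℝ, E); F, V⟯ × C^∞⟮𝓘(ℝ, E), M; ℝ⟯}
    (hc : differential _ p (fibreAffine E F V c) = 0) : c.1 p.1 = 0 := by
  obtain ⟨x, l⟩ := p
  refine eq_of_forall_dual_apply_eq F fun m => ?_
  rw [map_zero]
  let γ : ℝ → VDualTotal F V := fun t => ⟨x, l + t • m⟩
  have hγ_zero : γ 0 = ⟨x, l⟩ := by simp only [γ, zero_smul, add_zero]
  have hzero : mfderiv 𝓘(ℝ, ℝ) 𝓘(ℝ, ℝ) (fibreAffine E F V c ∘ γ) 0 = 0 :=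
    mfderiv_comp_eq_zero (by rwa [hγ_zero])
      ((contMDiff_fibre_line (E := E) x l m).mdifferentiableAt (by simp))
  have hline : HasDerivAt (fibreAffine E F V c ∘ γ) (m (c.1 x)) 0 := by
    change HasDerivAt (fun t : ℝ => (l (c.1 x) + t * m (c.1 x) : ℝ) + c.2 x) _ _
    simpa using (((hasDerivAt_id (0 : ℝ)).mul_const (m (c.1 x) : ℝ)).const_add
      (l (c.1 x) : ℝ)).add_const (c.2 x)
  rw [mfderiv_eq_fderiv] at hzero
  rw [← hline.deriv, ← fderiv_apply_one_eq_deriv]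
  exact congrArg (fun T : ℝ →L[ℝ] ℝ => T 1) hzero

variable [FiniteDimensional ℝ E] [IsManifold 𝓘(ℝ, E) ∞ M] [T2Space M]

omit [ContMDiffVectorBundle ∞ F V 𝓘(ℝ, E)] in
theorem exists_smulSec_eq_self {X : Cₛ^∞⟮𝓘(ℝ, E); F, V⟯} {x : M} (hX : ∀ᶠ y in 𝓝 x, X y = 0) :
    ∃ g : C^∞⟮𝓘(ℝ, E), M; ℝ⟯, g x = 0 ∧ smulSec g X = X := by
  obtain ⟨χ, hχ_one, hχ⟩ := exists_contMDiffMap_eventuallyEq_one (I := 𝓘(ℝ, E)) hX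
  refine ⟨1 - χ, sub_eq_zero.2 hχ_one.self_of_nhds.symm, ContMDiffSection.ext fun y => ?_⟩
  change (1 - χ y) • X y = X y
  by_cases hy : y ∈ tsupport χ
  · have hXy : X y = 0 := hχ hy
    rw [hXy, smul_zero]
  · rw [image_eq_zero_of_notMem_tsupport hy, sub_zero, one_smul]

theorem exists_eventuallyEq_sum_smulSec (X : Cₛ^∞⟮𝓘(ℝ, E); F, V⟯) (x : M) {ι : Type*} [Fintype ι]
    (b : Module.Basis ι ℝ F) :
    ∃ (f : ι → C^∞⟮𝓘(ℝ, E), M; ℝ⟯) (s : ι → Cₛ^∞⟮𝓘(ℝ, E); F, V⟯),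
      (∀ i, ∀ᶠ y in 𝓝 x, f i y = b.coord i (trivializationAt F V x ⟨y, X y⟩).2) ∧
      (∀ i, s i x = (trivializationAt F V x).symm x (b i)) ∧
      ∀ᶠ y in 𝓝 x, X y = (∑ i, smulSec (f i) (s i)) y := by
  have : FiniteDimensional ℝ F := Module.Finite.of_basis b
  have hU := (trivializationAt F V x).open_baseSet.mem_nhds (mem_baseSet_trivializationAt F V x)
  have hX : ContMDiffOn 𝓘(ℝ, E) 𝓘(ℝ, F) ∞ (fun y => (trivializationAt F V x ⟨y, X y⟩).2)
      (trivializationAt F V x).baseSet := by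
    rw [← Trivialization.contMDiffOn_section_baseSet_iff]
    exact X.contMDiff.contMDiffOn
  choose f hf using fun i => exists_contMDiffMap_eventuallyEq (I := 𝓘(ℝ, E)) hU
    ((LinearMap.toContinuousLinearMap (b.coord i)).contMDiff.comp_contMDiffOn hX)
  choose s hs using fun i => exists_section_eventuallyEq_symm_const (E := E) (V := V) x (b i)
  refine ⟨f, s, hf, fun i => (hs i).self_of_nhds, ?_⟩
  filter_upwards [Filter.eventually_all.2 hf, Filter.eventually_all.2 hs, hU] with y hfy hsy hy
  have hsum : (∑ i, smulSec (f i) (s i)) y = ∑ i, f i y • s i y := by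
    rw [← ContMDiffSection.coeAddHom_apply, map_sum, Finset.sum_apply]
    rfl
  rw [hsum, eq_sum_coord_smul_symm b hy (X y)]
  exact Finset.sum_congr rfl fun i _ => by
    rw [hfy, hsy]
    rfl

namespace HasSymbolAt

variable {x : M} {z : TangentSpace 𝓘(ℝ, E) x} {D : Cₛ^∞⟮𝓘(ℝ, E); F, V⟯ →ₗ[ℝ] V x}

omit [ContMDiffVectorBundle ∞ F V 𝓘(ℝ, E)] in
theorem congr (hD : HasSymbolAt D z) {X Y : Cₛ^∞⟮𝓘(ℝ, E); F, V⟯} (h : ∀ᶠ y in 𝓝 x, X y = Y y) :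
    D X = D Y := by
  obtain ⟨g, hg, hXY⟩ := exists_smulSec_eq_self (X := X - Y) (h.mono fun _ => sub_eq_zero.2)
  have hXY_zero : (X - Y) x = 0 := sub_eq_zero.2 h.self_of_nhds
  rw [← sub_eq_zero, ← map_sub, ← hXY, hD, hg, hXY_zero, zero_smul, smul_zero, add_zero]

variable [FiniteDimensional ℝ F]

theorem dual_apply_eq_dirDeriv (hD : HasSymbolAt D z) {X : Cₛ^∞⟮𝓘(ℝ, E); F, V⟯} (hX : X x = 0)
    (l : VDual V x) {f : C^∞⟮𝓘(ℝ, E), M; ℝ⟯} (hf : ∀ᶠ y in 𝓝 x,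
      f y = (dualTriv F V x ⟨x, l⟩).2 (trivializationAt F V x ⟨y, X y⟩).2) :
    l (D X) = dirDeriv f x z := by
  have hx := mem_baseSet_trivializationAt F V x
  let b := Module.finBasis ℝ F
  obtain ⟨g, s, hg, hs, hXgs⟩ := exists_eventuallyEq_sum_smulSec X x b
  have hg_zero : ∀ i, g i x = 0 := fun i => by
    have htriv : (trivializationAt F V x ⟨x, 0⟩).2 = 0 :=
      ((trivializationAt F V x).linear ℝ hx).map_zero
    rw [(hg i).self_of_nhds, hX, htriv, map_zero]
  have hl : ∀ i, l (s i x) = (dualTriv F V x ⟨x, l⟩).2 (b i) := fun i => by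
    rw [hs, dualTriv_apply hx]
  have hDX : l (D X) = ∑ i, l (s i x) * dirDeriv (g i) x z := by
    rw [hD.congr hXgs, map_sum, map_sum]
    refine Finset.sum_congr rfl fun i _ => ?_
    rw [hD, hg_zero, zero_smul, zero_add, map_smul, mul_comm]
    rfl
  have hfg : f =ᶠ[𝓝 x] (∑ i, (l (s i x) : ℝ) • g i : C^∞⟮𝓘(ℝ, E), M; ℝ⟯) := by
    filter_upwards [hf, Filter.eventually_all.2 hg] with y hfy hgy
    rw [hfy, apply_eq_sum_apply_basis_mul_coord b, ← ContMDiffMap.coeFnAddMonoidHom_apply, map_sum,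
      Finset.sum_apply]
    exact Finset.sum_congr rfl fun i _ => by
      rw [← hgy, ← hl]
      rfl
  rw [hDX, dirDeriv_eq_differential, differential_congr hfg, map_sum,
    sum_apply]
  exact Finset.sum_congr rfl fun i _ =>
    congrArg (· z) (map_smul (differential 𝓘(ℝ, E) x) (l (s i x)) (g i)).symm

theorem dual_apply_add_dirDeriv_eq_zero (hD : HasSymbolAt D z) {l : VDual V x}
    {c : Cₛ^∞⟮𝓘(ℝ, E); F, V⟯ × C^∞⟮𝓘(ℝ, E), M; ℝ⟯}
    (hc : differential _ (⟨x, l⟩ : VDualTotal F V) (fibreAffine E F V c) = 0) :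
    l (D c.1) + dirDeriv c.2 x z = 0 := by
  have hx := mem_baseSet_trivializationAt F V x
  have hU := (trivializationAt F V x).open_baseSet.mem_nhds hx
  set β := (dualTriv F V x ⟨x, l⟩).2
  obtain ⟨f, hf⟩ := exists_contMDiffMap_eventuallyEq (I := 𝓘(ℝ, E)) hU
    (β.contMDiff.comp_contMDiffOn ((Trivialization.contMDiffOn_section_baseSet_iff _).1
      c.1.contMDiff.contMDiffOn))
  rw [hD.dual_apply_eq_dirDeriv (apply_eq_zero_of_differential_fibreAffine hc) l hf]
  let γ : M → VDualTotal F V := fun y => ⟨y, (dualTriv F V x).symm y β⟩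
  have hγx : γ x = ⟨x, l⟩ := congrArg (TotalSpace.mk x)
    ((dualTriv F V x).symm_apply_apply_mk (mem_baseSet_dualTriv hx) l)
  have hγ : MDifferentiableAt 𝓘(ℝ, E) (𝓘(ℝ, E).prod 𝓘(ℝ, F →L[ℝ] ℝ)) γ x :=
    ((contMDiffOn_trivialization_symm_const (dualTriv F V x) β).contMDiffAt
      ((dualTriv F V x).open_baseSet.mem_nhds (mem_baseSet_dualTriv hx))).mdifferentiableAt
        (by simp)
  have hcomp : fibreAffine E F V c ∘ γ =ᶠ[𝓝 x] (f + c.2 : C^∞⟮𝓘(ℝ, E), M; ℝ⟯) := by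
    filter_upwards [hf, hU] with y hfy hy
    rw [Function.comp_apply, fibreAffine_apply, dualTriv_symm_apply hy]
    exact congrArg (· + c.2 y) hfy.symm
  have hzero := mfderiv_comp_eq_zero (by rwa [hγx]) hγ
  rw [hcomp.mfderiv_eq] at hzero
  rw [dirDeriv_eq_differential, dirDeriv_eq_differential, ← add_apply,
    ← map_add]
  exact congrArg (fun T : E →L[ℝ] ℝ => T z) hzero

end HasSymbolAt

end FirstOrderOperators

section BracketsOnDual

/-- The bracket of a semidirect product: `[(w, c), (w', c')] = ([w, w'], w · c' - w' · c)`. -/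
def semidirectBracket {R W C : Type*} [CommRing R] [AddCommGroup W] [Module R W] [AddCommGroup C]
    [Module R C] (br : W →ₗ[R] W →ₗ[R] W) (act : W →ₗ[R] C →ₗ[R] C) :
    W × C →ₗ[R] W × C →ₗ[R] W × C :=
  LinearMap.mk₂ R (fun c d => (br c.1 d.1, act c.1 d.2 - act d.1 c.2))
    (fun c c' d => Prod.ext (by simp) (by simp; abel))
    (fun r c d => Prod.ext (by simp) (by simp [smul_sub]))
    (fun c d d' => Prod.ext (by simp) (by simp; abel))
    (fun r c d => Prod.ext (by simp) (by simp [smul_sub]))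

variable {E : Type*} [NormedAddCommGroup E] [NormedSpace ℝ E]
  [FiniteDimensional ℝ E]
  {M : Type*} [TopologicalSpace M] [T2Space M] [ChartedSpace E M] [IsManifold 𝓘(ℝ, E) ∞ M]
  {F : Type*} [NormedAddCommGroup F] [NormedSpace ℝ F] [FiniteDimensional ℝ F]
  {V : M → Type*} [∀ x, AddCommGroup (V x)] [∀ x, Module ℝ (V x)]
  [TopologicalSpace (TotalSpace F V)] [∀ x, TopologicalSpace (V x)] [FiberBundle F V]
  [VectorBundle ℝ F V] [ContMDiffVectorBundle ∞ F V 𝓘(ℝ, E)]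

theorem exists_derivation_of_hasSymbolAt {D : Cₛ^∞⟮𝓘(ℝ, E); F, V⟯ →ₗ[ℝ] Cₛ^∞⟮𝓘(ℝ, E); F, V⟯}
    {v : ∀ x : M, TangentSpace 𝓘(ℝ, E) x}
    (hv : ContMDiff 𝓘(ℝ, E) 𝓘(ℝ, E).tangent ∞ (fun x => (⟨x, v x⟩ : TangentBundle 𝓘(ℝ, E) M)))
    (hD : ∀ x, HasSymbolAt (evalSection F V x ∘ₗ D) (v x)) :
    ∃ δ : Derivation ℝ (DualFun 𝓘(ℝ, E) F V) (DualFun 𝓘(ℝ, E) F V),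
      ∀ X, δ (iota X) = iota (D X) := by
  let Z : C^∞⟮𝓘(ℝ, E), M; ℝ⟯ →ₗ[ℝ] C^∞⟮𝓘(ℝ, E), M; ℝ⟯ :=
    { toFun := fun f => ⟨_, contMDiff_dirDeriv hv f⟩
      map_add' := fun f g => ContMDiffMap.ext fun x => map_add (tangentDerivation (v x)) f g
      map_smul' := fun r f =>
        ContMDiffMap.ext fun x => Derivation.map_smul (tangentDerivation (v x)) r f }
  obtain ⟨δ, hδ⟩ := (containsCoordinates_fibreAffine E F V).exists_derivation
    (T := fibreAffine E F V ∘ₗ D.prodMap Z) fun p _ hc =>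
      (hD p.1).dual_apply_add_dirDeriv_eq_zero hc
  refine ⟨δ, fun X => ContMDiffMap.ext fun p => ?_⟩
  rw [hδ (iota X) p (X, 0) (by rw [LinearMap.coprod_apply, map_zero, add_zero]),
    LinearMap.comp_apply, LinearMap.prodMap_apply, map_zero, LinearMap.coprod_apply, map_zero,
    add_zero]

theorem exists_biderivation_of_hasSymbolAt
    {br : Cₛ^∞⟮𝓘(ℝ, E); F, V⟯ →ₗ[ℝ] Cₛ^∞⟮𝓘(ℝ, E); F, V⟯ →ₗ[ℝ] Cₛ^∞⟮𝓘(ℝ, E); F, V⟯}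
    {act : Cₛ^∞⟮𝓘(ℝ, E); F, V⟯ →ₗ[ℝ] C^∞⟮𝓘(ℝ, E), M; ℝ⟯ →ₗ[ℝ] C^∞⟮𝓘(ℝ, E), M; ℝ⟯}
    {γ : ∀ x : M, V x →ₗ[ℝ] TangentSpace 𝓘(ℝ, E) x}
    (hact : ∀ X f x, act X f x = dirDeriv f x (γ x (X x))) (hskew : ∀ X Y, br X Y = -br Y X)
    (hbr : ∀ X x, HasSymbolAt (evalSection F V x ∘ₗ br X) (γ x (X x))) :
    ∃ pb : DualFun 𝓘(ℝ, E) F V →ₗ[ℝ] Derivation ℝ (DualFun 𝓘(ℝ, E) F V) (DualFun 𝓘(ℝ, E) F V),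
      (∀ f g, pb f g = -pb g f) ∧ ∀ X Y, pb (iota X) (iota Y) = iota (br X Y) := by
  let S := (semidirectBracket br act).compr₂ (fibreAffine E F V)
  have hS_apply : ∀ c d p, S c d p = p.2 (br c.1 d.1 p.1) + (act c.1 d.2 p.1 - act d.1 c.2 p.1) :=
    fun _ _ _ => rfl
  have hS_skew : ∀ c d, S c d = -S d c := fun c d => ContMDiffMap.ext fun p => by
    rw [ContMDiffMap.coe_neg, Pi.neg_apply, hS_apply, hS_apply, hskew c.1, ContMDiffSection.coe_neg,
      Pi.neg_apply, map_neg, neg_add, neg_sub]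
  have hS : ∀ p c d, differential _ p (fibreAffine E F V c) = 0 → S c d p = 0 := by
    intro p c d hc
    have hbr_add_act : p.2 (br d.1 c.1 p.1) + act d.1 c.2 p.1 = 0 := by
      rw [hact]
      exact (hbr d.1 p.1).dual_apply_add_dirDeriv_eq_zero hc
    have hact_zero : act c.1 d.2 p.1 = 0 := by
      rw [hact, apply_eq_zero_of_differential_fibreAffine hc, map_zero]
      exact map_zero _
    rw [hS_skew, ContMDiffMap.coe_neg, Pi.neg_apply, hS_apply, hact_zero, sub_zero, hbr_add_act,
      neg_zero]
  obtain ⟨pb, hpb_skew, hpb⟩ :=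
    (containsCoordinates_fibreAffine E F V).exists_biderivation hS_skew hS
  refine ⟨pb, hpb_skew, fun X Y => ContMDiffMap.ext fun p => ?_⟩
  have hiota : ∀ X : Cₛ^∞⟮𝓘(ℝ, E); F, V⟯, differential _ p (fibreAffine E F V (X, 0)) =
      differential _ p (iota X) := fun X => by
    rw [LinearMap.coprod_apply, map_zero, add_zero]
  rw [hpb _ _ p (X, 0) (Y, 0) (hiota X) (hiota Y), hS_apply, map_zero, map_zero, sub_self,
    add_zero, iota_apply]

end BracketsOnDual

section PoissonBrackets

variable {E : Type*} [NormedAddCommGroup E] [NormedSpace ℝ E]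
  {M : Type*} [TopologicalSpace M] [ChartedSpace E M]
  {F : Type*} [NormedAddCommGroup F] [NormedSpace ℝ F]
  {V : M → Type*} [∀ x, AddCommGroup (V x)] [∀ x, Module ℝ (V x)]
  [TopologicalSpace (TotalSpace F V)] [∀ x, TopologicalSpace (V x)] [FiberBundle F V]
  [VectorBundle ℝ F V]
  {A : M → Type*} [∀ x, AddTorsor (V x) (A x)]
  [TopologicalSpace (TotalSpace F A)] [∀ x, TopologicalSpace (A x)] [FiberBundle F A]

theorem HasSymbolAt.sub {x : M} {D D' : Cₛ^∞⟮𝓘(ℝ, E); F, V⟯ →ₗ[ℝ] V x}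
    {z z' : TangentSpace 𝓘(ℝ, E) x} (hD : HasSymbolAt D z) (hD' : HasSymbolAt D' z') :
    HasSymbolAt (D - D') (z - z') := fun f X => by
  have hz : dirDeriv f x (z - z') = dirDeriv f x z - dirDeriv f x z' :=
    map_sub (differential 𝓘(ℝ, E) x f) z z'
  rw [LinearMap.sub_apply, LinearMap.sub_apply, hD, hD', hz, sub_smul, smul_sub]
  abel

variable {B : Cₛ^∞⟮𝓘(ℝ, E); F, A⟯ → Cₛ^∞⟮𝓘(ℝ, E); F, A⟯ → Cₛ^∞⟮𝓘(ℝ, E); F, V⟯}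

theorem hasSymbolAt_bilinPart [IsManifold 𝓘(ℝ, E) ∞ M] [SmoothAffineBundle F V A 𝓘(ℝ, E)]
    {γ : AnchorMap 𝓘(ℝ, E) F V A} (hB : IsAffineLieBracket B)
    (hγ : ∀ a x, HasSymbolAt (evalSection F V x ∘ₗ hB.vpartₗ a) (γ.toFun x (a x)))
    (a : Cₛ^∞⟮𝓘(ℝ, E); F, A⟯) (X : Cₛ^∞⟮𝓘(ℝ, E); F, V⟯) (x : M) :
    HasSymbolAt (evalSection F V x ∘ₗ hB.bilinPartₗ a X) ((γ.toFun x).linear (X x)) := by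
  have hlinear : (γ.toFun x).linear (X x) = γ.toFun x ((X +ᵥ a) x) - γ.toFun x (a x) :=
    (sub_eq_of_eq_add ((γ.toFun x).map_vadd (a x) (X x))).symm
  rw [hlinear]
  exact (hγ (X +ᵥ a) x).sub (hγ a x)

variable [FiniteDimensional ℝ F] [AffineBundle F V A]

theorem vadd_rhoSection_right_cancel {f g : DualFun 𝓘(ℝ, E) F V} {σ : RhoSection 𝓘(ℝ, E) F V A}
    (h : f +ᵥ σ = g +ᵥ σ) : f = g := ContMDiffMap.ext fun p => by
  have b : A p.1 := Classical.arbitrary _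
  have hp : (f +ᵥ σ).toFun p b = (g +ᵥ σ).toFun p b := by rw [h]
  rw [vadd_rhoSection_apply, vadd_rhoSection_apply] at hp
  exact add_left_cancel hp

theorem exists_rhoSection_chart (σ₀ : RhoSection 𝓘(ℝ, E) F V A) :
    ∃ κ : RhoSection 𝓘(ℝ, E) F V A → DualFun 𝓘(ℝ, E) F V,
      (∀ f σ, κ (f +ᵥ σ) = f + κ σ) ∧ ∀ f, κ (f +ᵥ σ₀) = f := by
  choose κ hκ using fun σ => exists_vadd_rhoSection σ σ₀
  exact ⟨κ, fun f σ => vadd_rhoSection_right_cancel (σ := σ₀) (by rw [← hκ, add_vadd, ← hκ]),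
    fun f => vadd_rhoSection_right_cancel (hκ _).symm⟩

theorem isAffPoisson_bracketOfParts
    {κ : RhoSection 𝓘(ℝ, E) F V A → DualFun 𝓘(ℝ, E) F V} (hκ : ∀ f σ, κ (f +ᵥ σ) = f + κ σ)
    {δ : Derivation ℝ (DualFun 𝓘(ℝ, E) F V) (DualFun 𝓘(ℝ, E) F V)}
    {pb : DualFun 𝓘(ℝ, E) F V →ₗ[ℝ] Derivation ℝ (DualFun 𝓘(ℝ, E) F V) (DualFun 𝓘(ℝ, E) F V)}
    (hskew : ∀ f g, pb f g = -pb g f) (hδ : ∀ f g, δ (pb f g) = pb (δ f) g + pb f (δ g))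
    (hjac : ∀ f g k, pb f (pb g k) + pb g (pb k f) + pb k (pb f g) = 0) :
    IsAffPoisson (bracketOfParts κ (δ : DualFun 𝓘(ℝ, E) F V →ₗ[ℝ] DualFun 𝓘(ℝ, E) F V)
      (derivationBilin pb)) where
  isAffineLieBracket := isAffineLieBracket_bracketOfParts hκ hskew hδ hjac
  leibniz σ f g := by
    rw [vpart_bracketOfParts hκ, vpart_bracketOfParts hκ, vpart_bracketOfParts hκ]
    refine ((δ + pb (κ σ)).leibniz f g).trans ?_
    rw [smul_eq_mul, smul_eq_mul, mul_comm g]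
    rfl

namespace IsAffPoisson

variable {P P' : RhoSection 𝓘(ℝ, E) F V A → RhoSection 𝓘(ℝ, E) F V A → DualFun 𝓘(ℝ, E) F V}

/-- The derivation `{σ, ·}ᵛ` of `C^∞(V*)`. -/
def vpartDerivation (hP : IsAffPoisson P) (σ : RhoSection 𝓘(ℝ, E) F V A) :
    Derivation ℝ (DualFun 𝓘(ℝ, E) F V) (DualFun 𝓘(ℝ, E) F V) :=
  Derivation.mk' (hP.isAffineLieBracket.vpartₗ σ) fun f g => by
    rw [smul_eq_mul, smul_eq_mul, mul_comm g]
    exact hP.leibniz σ f g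

/-- The bilinear part of an aff-Poisson bracket, as a derivation in the second argument. -/
def bilinPartDerivation (hP : IsAffPoisson P) (σ : RhoSection 𝓘(ℝ, E) F V A) :
    DualFun 𝓘(ℝ, E) F V →ₗ[ℝ] Derivation ℝ (DualFun 𝓘(ℝ, E) F V) (DualFun 𝓘(ℝ, E) F V) where
  toFun f := hP.vpartDerivation (f +ᵥ σ) - hP.vpartDerivation σ
  map_add' f g := Derivation.ext
    (LinearMap.congr_fun (map_add (hP.isAffineLieBracket.bilinPartₗ σ) f g))
  map_smul' r f := Derivation.ext
    (LinearMap.congr_fun (map_smul (hP.isAffineLieBracket.bilinPartₗ σ) r f))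

end IsAffPoisson

variable [FiniteDimensional ℝ E] [IsManifold 𝓘(ℝ, E) ∞ M] [T2Space M] [SecondCountableTopology M]
  [SmoothAffineBundle F V A 𝓘(ℝ, E)]

namespace AnchorMap

theorem contMDiff_dirDeriv_linear (γ : AnchorMap 𝓘(ℝ, E) F V A) (X : Cₛ^∞⟮𝓘(ℝ, E); F, V⟯)
    (f : C^∞⟮𝓘(ℝ, E), M; ℝ⟯) :
    ContMDiff 𝓘(ℝ, E) 𝓘(ℝ, ℝ) ∞ (fun x => dirDeriv f x ((γ.toFun x).linear (X x))) := by
  obtain ⟨a⟩ := nonempty_section E (F := F) (V := V) A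
  refine ((contMDiff_dirDeriv (γ.smooth.comp (X +ᵥ a).contMDiff) f).sub
    (contMDiff_dirDeriv (γ.smooth.comp a.contMDiff) f)).congr fun x => ?_
  have hvadd : γ.toFun x ((X +ᵥ a) x) = (γ.toFun x).linear (X x) + γ.toFun x (a x) :=
    (γ.toFun x).map_vadd (a x) (X x)
  rw [eq_sub_iff_add_eq]
  exact (map_add (differential 𝓘(ℝ, E) x f) _ _).symm.trans
    (congrArg (differential 𝓘(ℝ, E) x f) hvadd.symm)

/-- The action of sections of `V` on smooth functions through the linear part of the anchor. -/
def linearAction (γ : AnchorMap 𝓘(ℝ, E) F V A) :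
    Cₛ^∞⟮𝓘(ℝ, E); F, V⟯ →ₗ[ℝ] C^∞⟮𝓘(ℝ, E), M; ℝ⟯ →ₗ[ℝ] C^∞⟮𝓘(ℝ, E), M; ℝ⟯ :=
  LinearMap.mk₂ ℝ (fun X f => ⟨_, γ.contMDiff_dirDeriv_linear X f⟩)
    (fun X Y f => ContMDiffMap.ext fun x =>
      map_add ((differential 𝓘(ℝ, E) x f).toLinearMap ∘ₗ (γ.toFun x).linear) (X x) (Y x))
    (fun r X f => ContMDiffMap.ext fun x =>
      map_smul ((differential 𝓘(ℝ, E) x f).toLinearMap ∘ₗ (γ.toFun x).linear) r (X x))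
    (fun X f g => ContMDiffMap.ext fun x =>
      map_add (tangentDerivation ((γ.toFun x).linear (X x))) f g)
    (fun r X f => ContMDiffMap.ext fun x =>
      Derivation.map_smul (tangentDerivation ((γ.toFun x).linear (X x))) r f)

theorem linearAction_apply (γ : AnchorMap 𝓘(ℝ, E) F V A) (X : Cₛ^∞⟮𝓘(ℝ, E); F, V⟯)
    (f : C^∞⟮𝓘(ℝ, E), M; ℝ⟯) (x : M) :
    γ.linearAction X f x = dirDeriv f x ((γ.toFun x).linear (X x)) := rfl

end AnchorMap

variable [ContMDiffVectorBundle ∞ F V 𝓘(ℝ, E)] [Nontrivial F]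

theorem IsAffPoisson.ext
    {P P' : RhoSection 𝓘(ℝ, E) F V A → RhoSection 𝓘(ℝ, E) F V A → DualFun 𝓘(ℝ, E) F V}
    (hP : IsAffPoisson P) (hP' : IsAffPoisson P')
    (h : ∀ a b, P (vanishingSection a) (vanishingSection b) =
      P' (vanishingSection a) (vanishingSection b)) : P = P' := by
  have hvpart : ∀ a f, vpart P (vanishingSection a) f = vpart P' (vanishingSection a) f :=
    fun a => DFunLike.congr_fun (derivation_ext_of_iota (δ := hP.vpartDerivation _)
      (δ' := hP'.vpartDerivation (vanishingSection a)) fun X => by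
        change vpart P _ _ = vpart P' _ _
        rw [vpart, vpart, iota_vadd_vanishingSection, h, h])
  obtain ⟨a₀⟩ := nonempty_section E (F := F) (V := V) A
  have hbilin : ∀ f g, bilinPart P (vanishingSection a₀) f g =
      bilinPart P' (vanishingSection a₀) f g := fun f =>
    DFunLike.congr_fun (derivation_ext_of_iota (δ := hP.bilinPartDerivation _ f)
      (δ' := hP'.bilinPartDerivation (vanishingSection a₀) f) fun X => by
        change bilinPart P _ _ _ = bilinPart P' _ _ _
        rw [hP.isAffineLieBracket.bilinPart_skew, hP'.isAffineLieBracket.bilinPart_skew, bilinPart,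
          bilinPart, iota_vadd_vanishingSection, hvpart, hvpart])
  funext σ τ
  obtain ⟨f, rfl⟩ := exists_vadd_rhoSection σ (vanishingSection a₀)
  obtain ⟨g, rfl⟩ := exists_vadd_rhoSection τ (vanishingSection a₀)
  rw [hP.isAffineLieBracket.apply_vadd_vadd, hP'.isAffineLieBracket.apply_vadd_vadd, hvpart,
    hvpart, hbilin]

theorem exists_affPoisson (hB : IsLieAffgebroidBracket B) :
    ∃ P : RhoSection 𝓘(ℝ, E) F V A → RhoSection 𝓘(ℝ, E) F V A → DualFun 𝓘(ℝ, E) F V,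
      IsAffPoisson P ∧
        ∀ a b, P (vanishingSection a) (vanishingSection b) = iota (B a b) := by
  obtain ⟨hB, γ, hγ⟩ := hB
  have hsymbol : ∀ a x, HasSymbolAt (evalSection F V x ∘ₗ hB.vpartₗ a) (γ.toFun x (a x)) :=
    fun a x f X => hγ a f X x
  obtain ⟨a₀⟩ := nonempty_section E (F := F) (V := V) A
  obtain ⟨δ, hδ⟩ := exists_derivation_of_hasSymbolAt (γ.smooth.comp a₀.contMDiff) (hsymbol a₀)
  obtain ⟨pb, hpb_skew, hpb⟩ := exists_biderivation_of_hasSymbolAt γ.linearAction_apply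
    (hB.bilinPart_skew a₀)
    (hasSymbolAt_bilinPart hB hsymbol a₀)
  have hjac := biderivation_jacobi (fun _ => derivation_eq_zero_of_iota) hpb_skew fun X Y Z => by
    simp only [hpb, ← map_add, hB.bilinPartₗ_apply, hB.bilinPart_jacobi, map_zero]
  have hcompat := derivation_biderivation (fun _ => derivation_eq_zero_of_iota) hpb_skew
    (D := -δ) fun X Y => by
      simp only [Derivation.neg_apply, hδ, hpb, map_neg, ← map_add, ← neg_add,
        hB.bilinPartₗ_apply, hB.vpartₗ_apply, hB.vpart_bilinPart]
  obtain ⟨κ, hκ, hκ₀⟩ := exists_rhoSection_chart (vanishingSection a₀ : RhoSection _ F V A)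
  refine ⟨_, isAffPoisson_bracketOfParts hκ hpb_skew hcompat hjac, fun a b => ?_⟩
  obtain ⟨X, rfl⟩ := exists_vadd_section (V := V) a a₀
  obtain ⟨Y, rfl⟩ := exists_vadd_section (V := V) b a₀
  rw [hB.apply_vadd_vadd, bracketOfParts, vanishingSection_vadd, vanishingSection_vadd, hκ₀, hκ₀]
  change -δ (-iota Y) - -δ (-iota X) + pb (-iota X) (-iota Y) = _
  simp only [map_neg, Derivation.neg_apply, neg_neg, hδ, hpb, map_add, map_sub,
    hB.vpartₗ_apply, hB.bilinPartₗ_apply]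

end PoissonBrackets

section Anchors

variable {E : Type*} [NormedAddCommGroup E] [NormedSpace ℝ E] [FiniteDimensional ℝ E]
  {M : Type*} [TopologicalSpace M] [ChartedSpace E M] [IsManifold 𝓘(ℝ, E) ∞ M] [T2Space M]
  {F : Type*} [NormedAddCommGroup F] [NormedSpace ℝ F] [FiniteDimensional ℝ F]
  {V : M → Type*} [∀ x, AddCommGroup (V x)] [∀ x, Module ℝ (V x)]
  [TopologicalSpace (TotalSpace F V)] [∀ x, TopologicalSpace (V x)] [FiberBundle F V]
  [VectorBundle ℝ F V] [ContMDiffVectorBundle ∞ F V 𝓘(ℝ, E)]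

theorem apply_eq_zero_of_map_smulSec {T : Cₛ^∞⟮𝓘(ℝ, E); F, V⟯ →ₗ[ℝ] C^∞⟮𝓘(ℝ, E), M; ℝ⟯}
    (hT : ∀ f X, T (smulSec f X) = f * T X) {X : Cₛ^∞⟮𝓘(ℝ, E); F, V⟯} {x : M} (hX : X x = 0) :
    T X x = 0 := by
  obtain ⟨f, s, hf, -, hXfs⟩ := exists_eventuallyEq_sum_smulSec X x (Module.finBasis ℝ F)
  obtain ⟨g, hg, hgX⟩ := exists_smulSec_eq_self (X := X - ∑ i, smulSec (f i) (s i))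
    (hXfs.mono fun _ => sub_eq_zero.2)
  have htriv : (trivializationAt F V x ⟨x, 0⟩).2 = 0 :=
    ((trivializationAt F V x).linear ℝ (mem_baseSet_trivializationAt F V x)).map_zero
  have hlocal : T X x = T (∑ i, smulSec (f i) (s i)) x := by
    have hgT : g x * T (X - ∑ i, smulSec (f i) (s i)) x =
        T (X - ∑ i, smulSec (f i) (s i)) x :=
      congrArg (· x) ((hT g _).symm.trans (congrArg T hgX))
    rw [hg, zero_mul, map_sub] at hgT
    exact sub_eq_zero.1 hgT.symm
  rw [hlocal, map_sum, ← ContMDiffMap.coeFnAddMonoidHom_apply, map_sum, Finset.sum_apply]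
  refine Finset.sum_eq_zero fun i _ => ?_
  rw [hT]
  change f i x * _ = 0
  rw [(hf i).self_of_nhds, hX, htriv, map_zero, zero_mul]

theorem exists_linear_anchor
    {act : Cₛ^∞⟮𝓘(ℝ, E); F, V⟯ →ₗ[ℝ] Derivation ℝ C^∞⟮𝓘(ℝ, E), M; ℝ⟯ C^∞⟮𝓘(ℝ, E), M; ℝ⟯}
    (hact : ∀ g X f, act (smulSec g X) f = g * act X f) :
    ∃ θ : ∀ x : M, V x →ₗ[ℝ] TangentSpace 𝓘(ℝ, E) x,
      ∀ X f x, dirDeriv f x (θ x (X x)) = act X f x := by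
  choose extend h_extend using fun x => (evalSection F V x).exists_rightInverse_of_surjective
    (LinearMap.range_eq_top.2 fun v => exists_section_apply_eq E F v)
  refine ⟨fun x => (tangentDerivationEquiv 𝓘(ℝ, E) x).symm.toLinearMap ∘ₗ
    (Derivation.evalAt x).restrictScalars ℝ ∘ₗ act ∘ₗ extend x, fun X f x => ?_⟩
  refine (differential_tangentDerivationEquiv_symm _ f).trans ?_
  have hX : (extend x (X x) - X) x = 0 := sub_eq_zero.2 (LinearMap.congr_fun (h_extend x) (X x))
  have hact_sub := apply_eq_zero_of_map_smulSec
    (T := (derivationBilin act).flip f) (fun g Y => hact g Y f) hX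
  rw [map_sub] at hact_sub
  exact sub_eq_zero.1 hact_sub

variable {A : M → Type*} [∀ x, AddTorsor (V x) (A x)]
  [TopologicalSpace (TotalSpace F A)] [∀ x, TopologicalSpace (A x)] [FiberBundle F A]
  [SmoothAffineBundle F V A 𝓘(ℝ, E)]

theorem exists_vsub_eq_sum (a₀ : Cₛ^∞⟮𝓘(ℝ, E); F, A⟯) (q : TotalSpace F A) {ι : Type*} [Fintype ι]
    (b : Module.Basis ι ℝ F) :
    ∃ (u : ι → TotalSpace F A → ℝ) (s : ι → Cₛ^∞⟮𝓘(ℝ, E); F, V⟯),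
      (∀ i, ContMDiffAt (𝓘(ℝ, E).prod 𝓘(ℝ, F)) 𝓘(ℝ, ℝ) ∞ (u i) q) ∧
      ∀ᶠ p in 𝓝 q, (p.2 -ᵥ a₀ p.1 : V p.1) = ∑ i, u i p • s i p.1 := by
  have hproj : ContMDiffAt (𝓘(ℝ, E).prod 𝓘(ℝ, F)) 𝓘(ℝ, E) ∞
      (fun p : TotalSpace F A => p.1) q := contMDiff_proj A q
  have hU := baseSet_inter_baseSet_mem_nhds F V A q.1
  obtain ⟨T, hT, hvsub⟩ := exists_trivializationAt_vsub_eq E F V A q.1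
  choose s hs using fun i => exists_section_eventuallyEq_symm_const (E := E) (V := V) q.1 (b i)
  have ha₀ : ContMDiffAt 𝓘(ℝ, E) 𝓘(ℝ, F) ∞
      (fun y => (trivializationAt F A q.1 ⟨y, a₀ y⟩).2) q.1 :=
    (contMDiffAt_section q.1).1 (a₀.contMDiff q.1)
  have hcoord : ContMDiffAt (𝓘(ℝ, E).prod 𝓘(ℝ, F)) 𝓘(ℝ, F) ∞
      (fun p : TotalSpace F A => (trivializationAt F A q.1 p).2) q :=
    (contMDiffAt_totalSpace.1 contMDiffAt_id).2
  refine ⟨fun i p => b.coord i (T p.1 ((trivializationAt F A q.1 p).2 -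
    (trivializationAt F A q.1 ⟨p.1, a₀ p.1⟩).2)), s, fun i => ?_, ?_⟩
  · exact (LinearMap.toContinuousLinearMap (b.coord i)).contMDiff.contMDiffAt.comp q
      (((hT.contMDiffAt hU).comp q hproj).clm_apply (hcoord.sub (ha₀.comp q hproj)))
  · filter_upwards [hproj.continuousAt.preimage_mem_nhds hU,
      hproj.continuousAt.eventually (Filter.eventually_all.2 hs)] with p hp hsp
    simp only [← hvsub p.1 hp p.2 (a₀ p.1), hsp]
    exact eq_sum_coord_smul_symm b hp.2 _

theorem exists_anchorMap (a₀ : Cₛ^∞⟮𝓘(ℝ, E); F, A⟯)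
    (Z₀ : Derivation ℝ C^∞⟮𝓘(ℝ, E), M; ℝ⟯ C^∞⟮𝓘(ℝ, E), M; ℝ⟯)
    {act : Cₛ^∞⟮𝓘(ℝ, E); F, V⟯ →ₗ[ℝ] Derivation ℝ C^∞⟮𝓘(ℝ, E), M; ℝ⟯ C^∞⟮𝓘(ℝ, E), M; ℝ⟯}
    (hact : ∀ g X f, act (smulSec g X) f = g * act X f) :
    ∃ γ : AnchorMap 𝓘(ℝ, E) F V A, ∀ X f x,
      dirDeriv f x (γ.toFun x ((X +ᵥ a₀) x)) = act X f x + Z₀ f x := by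
  obtain ⟨θ, hθ⟩ := exists_linear_anchor hact
  let v₀ (x : M) : TangentSpace 𝓘(ℝ, E) x :=
    (tangentDerivationEquiv 𝓘(ℝ, E) x).symm (Derivation.evalAt x Z₀)
  let τ (x : M) : A x →ᵃ[ℝ] TangentSpace 𝓘(ℝ, E) x :=
    { toFun := fun α => θ x (α -ᵥ a₀ x) + v₀ x
      linear := θ x
      map_vadd' := fun α w => by rw [vadd_vsub_assoc, map_add, vadd_eq_add, add_assoc] }
  have hτ : ∀ f x (α : A x), dirDeriv f x (τ x α) = dirDeriv f x (θ x (α -ᵥ a₀ x)) + Z₀ f x :=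
    fun f x α => by
      rw [← Derivation.evalAt_apply, ← differential_tangentDerivationEquiv_symm]
      exact map_add (differential 𝓘(ℝ, E) x f) _ _
  refine ⟨⟨τ, fun q => ?_⟩, fun X f x => ?_⟩
  · have hproj : ContMDiffAt (𝓘(ℝ, E).prod 𝓘(ℝ, F)) 𝓘(ℝ, E) ∞
        (fun p : TotalSpace F A => p.1) q := contMDiff_proj A q
    obtain ⟨u, s, hu, hus⟩ := exists_vsub_eq_sum (V := V) a₀ q (Module.finBasis ℝ F)
    refine contMDiffAt_tangentBundle_of_differential hproj fun f => ?_
    have hsmooth : ContMDiffAt (𝓘(ℝ, E).prod 𝓘(ℝ, F)) 𝓘(ℝ, ℝ) ∞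
        (fun p => ∑ i, u i p * act (s i) f p.1 + Z₀ f p.1) q :=
      (contMDiffAt_finsetSum fun i _ => (hu i).mul
        (((act (s i) f).contMDiff q.1).comp q hproj)).add (((Z₀ f).contMDiff q.1).comp q hproj)
    refine hsmooth.congr_of_eventuallyEq (hus.mono fun p hp => (hτ f p.1 p.2).trans ?_)
    rw [hp, map_sum, add_left_inj]
    refine (map_sum (differential 𝓘(ℝ, E) p.1 f) _ _).trans (Finset.sum_congr rfl fun i _ => ?_)
    rw [map_smul, ← hθ]
    exact map_smul (differential 𝓘(ℝ, E) p.1 f) _ _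
  · change dirDeriv f x (τ x (X x +ᵥ a₀ x)) = _
    rw [hτ, vadd_vsub, hθ]

end Anchors

section LinearPoissonBrackets

variable {E : Type*} [NormedAddCommGroup E] [NormedSpace ℝ E]
  {M : Type*} [TopologicalSpace M] [ChartedSpace E M]
  {F : Type*} [NormedAddCommGroup F] [NormedSpace ℝ F]
  {V : M → Type*} [∀ x, AddCommGroup (V x)] [∀ x, Module ℝ (V x)]
  [TopologicalSpace (TotalSpace F V)] [∀ x, TopologicalSpace (V x)] [FiberBundle F V]
  [VectorBundle ℝ F V]

theorem basic_injective : Function.Injective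
    (basic F V : C^∞⟮𝓘(ℝ, E), M; ℝ⟯ → DualFun 𝓘(ℝ, E) F V) := fun _ _ h =>
  ContMDiffMap.ext fun x => congrArg (fun f : DualFun 𝓘(ℝ, E) F V => f ⟨x, 0⟩) h

theorem basic_mul (f g : C^∞⟮𝓘(ℝ, E), M; ℝ⟯) :
    basic F V (f * g) = basic F V f * basic F V g := rfl

variable [ContMDiffVectorBundle ∞ F V 𝓘(ℝ, E)] [FiniteDimensional ℝ E]
  [IsManifold 𝓘(ℝ, E) ∞ M] [T2Space M]

theorem exists_basic_of_isLinearFun_mul_iota {g : DualFun 𝓘(ℝ, E) F V}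
    (h : ∀ X : Cₛ^∞⟮𝓘(ℝ, E); F, V⟯, IsLinearFun (g * iota X)) : ∃ k, g = basic F V k := by
  have hzero : ContMDiff 𝓘(ℝ, E) (𝓘(ℝ, E).prod 𝓘(ℝ, F →L[ℝ] ℝ)) ∞
      (fun x => (⟨x, 0⟩ : VDualTotal F V)) :=
    contMDiff_zeroSection ℝ (fun x : M => V x →L[ℝ] Bundle.Trivial M ℝ x)
  refine ⟨⟨_, g.contMDiff.comp hzero⟩, ContMDiffMap.ext fun ⟨x, l⟩ => ?_⟩
  change g ⟨x, l⟩ = g ⟨x, 0⟩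
  by_cases hl : l = 0
  · rw [hl]
  obtain ⟨X, hX⟩ := exists_section_dual_apply_ne_zero E F hl
  have hline := (contMDiff_fibre_line (E := E) (F := F) x 0 l).continuous
  have hconst : (fun t : ℝ => g ⟨x, 0 + t • l⟩) = fun _ : ℝ => g ⟨x, l⟩ := by
    refine Continuous.ext_on (dense_compl_singleton (0 : ℝ)) (g.contMDiff.continuous.comp hline)
      continuous_const fun t (ht : t ≠ 0) => ?_
    have hlin : g ⟨x, t • l⟩ * (t * l (X x) : ℝ) = t * (g ⟨x, l⟩ * l (X x)) :=
      (h X x).map_smul t l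
    rw [zero_add]
    exact mul_right_cancel₀ (mul_ne_zero ht hX) (hlin.trans (mul_left_comm _ _ _))
  simpa only [zero_smul, add_zero] using (congrFun hconst 0).symm

theorem eq_zero_of_mul_iota_eq_basic [Nontrivial F] {g : DualFun 𝓘(ℝ, E) F V}
    (h : ∀ X : Cₛ^∞⟮𝓘(ℝ, E); F, V⟯, ∃ k, g * iota X = basic F V k) : g = 0 := by
  refine eq_zero_of_forall_mul_iota_eq_zero fun X => ?_
  obtain ⟨k, hk⟩ := h X
  refine ContMDiffMap.ext fun p => ?_
  have hzero : g ⟨p.1, 0⟩ * (0 : ℝ) = k p.1 :=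
    congrArg (fun f : DualFun 𝓘(ℝ, E) F V => f ⟨p.1, 0⟩) hk
  rw [hk, basic_apply, ← hzero, mul_zero]
  rfl

variable [FiniteDimensional ℝ F]

theorem exists_derivation_basic
    {δ : Derivation ℝ (DualFun 𝓘(ℝ, E) F V) (DualFun 𝓘(ℝ, E) F V)}
    (hδ : ∀ X : Cₛ^∞⟮𝓘(ℝ, E); F, V⟯, IsLinearFun (δ (iota X))) :
    ∃ D : Derivation ℝ C^∞⟮𝓘(ℝ, E), M; ℝ⟯ C^∞⟮𝓘(ℝ, E), M; ℝ⟯,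
      ∀ f, basic F V (D f) = δ (basic F V f) := by
  choose T hT using fun X => (hδ X).exists_iota
  have hbasic : ∀ f, ∃ k, δ (basic F V f) = basic F V k := fun f =>
    exists_basic_of_isLinearFun_mul_iota fun X => by
      have hmul : δ (basic F V f) * iota X = iota (T (smulSec f X) - smulSec f (T X)) := by
        rw [map_sub, ← hT, iota_smulSec, iota_smulSec, ← hT, Derivation.leibniz, smul_eq_mul,
          smul_eq_mul, add_sub_cancel_left, mul_comm]
      rw [hmul]
      exact isLinearFun_iota _
  choose D hD using hbasic
  refine ⟨Derivation.mk' ⟨⟨D, fun f g => ?_⟩, fun r f => ?_⟩ fun f g => ?_, fun f => (hD f).symm⟩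
  all_goals refine basic_injective (F := F) (V := V) ?_
  · rw [map_add, ← hD, ← hD, ← hD, map_add, Derivation.map_add]
  · rw [RingHom.id_apply, map_smul, ← hD, ← hD, map_smul, Derivation.map_smul]
  · change basic F V (D (f * g)) = basic F V (f * D g + g * D f)
    rw [map_add, basic_mul, basic_mul, ← hD, ← hD, ← hD, basic_mul, Derivation.leibniz]
    rfl

section BracketsOfBasicFunctions

variable [Nontrivial F]
  {pb : DualFun 𝓘(ℝ, E) F V →ₗ[ℝ] Derivation ℝ (DualFun 𝓘(ℝ, E) F V) (DualFun 𝓘(ℝ, E) F V)}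

theorem biderivation_basic_basic (skew : ∀ f g, pb f g = -pb g f)
    (hpb : ∀ X Y : Cₛ^∞⟮𝓘(ℝ, E); F, V⟯, IsLinearFun (pb (iota X) (iota Y)))
    (f g : C^∞⟮𝓘(ℝ, E), M; ℝ⟯) : pb (basic F V f) (basic F V g) = 0 := by
  choose act hact using fun X => exists_derivation_basic (hpb X)
  refine eq_zero_of_mul_iota_eq_basic fun X => ⟨act (smulSec f X) g - f * act X g, ?_⟩
  rw [map_sub, basic_mul, hact, hact, iota_smulSec, biderivation_mul_left skew, mul_comm,
    add_sub_cancel_left]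

theorem exists_basic_action (skew : ∀ f g, pb f g = -pb g f)
    (hpb : ∀ X Y : Cₛ^∞⟮𝓘(ℝ, E); F, V⟯, IsLinearFun (pb (iota X) (iota Y))) :
    ∃ act : Cₛ^∞⟮𝓘(ℝ, E); F, V⟯ →ₗ[ℝ]
        Derivation ℝ C^∞⟮𝓘(ℝ, E), M; ℝ⟯ C^∞⟮𝓘(ℝ, E), M; ℝ⟯,
      (∀ X f, basic F V (act X f) = pb (iota X) (basic F V f)) ∧
        ∀ g X f, act (smulSec g X) f = g * act X f := by
  choose act hact using fun X => exists_derivation_basic (hpb X)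
  have act_smulSec : ∀ g X f, act (smulSec g X) f = g * act X f := fun g X f =>
    basic_injective (F := F) (V := V) (by
      rw [hact, iota_smulSec, biderivation_mul_left skew, biderivation_basic_basic skew hpb,
        basic_mul, hact, mul_zero (iota X), add_zero])
  refine ⟨⟨⟨act, fun X Y => Derivation.ext fun f => basic_injective (F := F) (V := V) ?_⟩,
    fun r X => Derivation.ext fun f => basic_injective (F := F) (V := V) ?_⟩, hact, act_smulSec⟩
  · rw [hact, map_add iota, map_add pb, Derivation.add_apply, ← hact, ← hact,
      ← map_add (basic F V), Derivation.add_apply]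
  · rw [hact, map_smul iota, map_smul pb]
    exact congrArg (r • ·) (hact X f).symm

end BracketsOfBasicFunctions

variable [SecondCountableTopology M]
  {A : M → Type*} [∀ x, AddTorsor (V x) (A x)]
  [TopologicalSpace (TotalSpace F A)] [∀ x, TopologicalSpace (A x)] [FiberBundle F A]
  [AffineBundle F V A] [SmoothAffineBundle F V A 𝓘(ℝ, E)]
  {P : RhoSection 𝓘(ℝ, E) F V A → RhoSection 𝓘(ℝ, E) F V A → DualFun 𝓘(ℝ, E) F V}
  {B : Cₛ^∞⟮𝓘(ℝ, E); F, A⟯ → Cₛ^∞⟮𝓘(ℝ, E); F, A⟯ → Cₛ^∞⟮𝓘(ℝ, E); F, V⟯}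

theorem forall_linSec_iff_forall_vanishingSection :
    (∀ (σ₁ σ₂ : LinSec 𝓘(ℝ, E) F V A) (p : VDualTotal F V),
        P σ₁ σ₂ p = p.2 (B (linSecEquiv E F V A σ₁) (linSecEquiv E F V A σ₂) p.1)) ↔
      ∀ a b, P (vanishingSection a) (vanishingSection b) = iota (B a b) := by
  rw [(linSecEquiv E F V A).forall_congr_left]
  refine forall_congr' fun a => ?_
  rw [(linSecEquiv E F V A).forall_congr_left]
  refine forall_congr' fun b => ?_
  rw [Equiv.apply_symm_apply, Equiv.apply_symm_apply]
  exact (DFunLike.ext_iff (f := P (vanishingSection a) (vanishingSection b))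
    (g := iota (B a b))).symm

variable [Nontrivial F]

theorem IsAffPoisson.isLieAffgebroidBracket (hP : IsAffPoisson P)
    (h : ∀ a b, P (vanishingSection a) (vanishingSection b) = iota (B a b)) :
    IsLieAffgebroidBracket B := by
  have hvpart := map_vpart hP.isAffineLieBracket vanishingSection_vadd h
  have hbilin := map_bilinPart hP.isAffineLieBracket vanishingSection_vadd h
  obtain ⟨a₀⟩ := nonempty_section E (F := F) (V := V) A
  obtain ⟨Z₀, hZ₀⟩ := exists_derivation_basic (δ := -hP.vpartDerivation (vanishingSection a₀))
    fun X => by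
      change IsLinearFun (-vpart P _ _)
      rw [← hvpart]
      exact isLinearFun_iota _
  obtain ⟨act, hact, hact_smul⟩ := exists_basic_action
    (pb := hP.bilinPartDerivation (vanishingSection a₀))
    (hP.isAffineLieBracket.bilinPart_skew _) fun X Y => by
      change IsLinearFun (bilinPart P _ _ _)
      rw [← hbilin]
      exact isLinearFun_iota _
  obtain ⟨γ, hγ⟩ := exists_anchorMap a₀ Z₀ hact_smul
  refine ⟨isAffineLieBracket_of_injective hP.isAffineLieBracket iota_injective
    vanishingSection_vadd h, γ, fun a f X x => ?_⟩
  obtain ⟨Y, rfl⟩ := exists_vadd_section (V := V) a a₀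
  have hanchor : basic F V (act Y f + Z₀ f) =
      -vpart P (vanishingSection (Y +ᵥ a₀)) (basic F V f) := by
    rw [map_add, hact, hZ₀, vanishingSection_vadd, vpart_vadd,
      ← hP.isAffineLieBracket.bilinPartₗ_apply, map_neg, LinearMap.neg_apply, neg_add, neg_neg,
      add_comm]
    rfl
  have hleibniz : vpart B (Y +ᵥ a₀) (smulSec f X) =
      smulSec f (vpart B (Y +ᵥ a₀) X) + smulSec (act Y f + Z₀ f) X := iota_injective (by
    rw [map_add, iota_smulSec, iota_smulSec, hvpart, hvpart, iota_smulSec, hanchor, hP.leibniz]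
    ring)
  rw [hγ, hleibniz]
  rfl

theorem existsUnique_linearAffPoisson (hB : IsLieAffgebroidBracket B) :
    ∃! P : RhoSection 𝓘(ℝ, E) F V A → RhoSection 𝓘(ℝ, E) F V A → DualFun 𝓘(ℝ, E) F V,
      IsLinearAffPoisson P ∧
        ∀ a b, P (vanishingSection a) (vanishingSection b) = iota (B a b) := by
  obtain ⟨P, hP, hPB⟩ := exists_affPoisson hB
  refine ⟨P, ⟨⟨hP, fun σ τ hσ hτ => ?_⟩, hPB⟩, fun P' ⟨hP', hPB'⟩ =>
    hP'.isAffPoisson.ext hP fun a b => (hPB' a b).trans (hPB a b).symm⟩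
  obtain ⟨a, rfl⟩ := exists_vanishingSection_eq hσ
  obtain ⟨b, rfl⟩ := exists_vanishingSection_eq hτ
  rw [hPB]
  exact isLinearFun_iota _

theorem existsUnique_lieAffgebroidBracket (hP : IsLinearAffPoisson P) :
    ∃! B : Cₛ^∞⟮𝓘(ℝ, E); F, A⟯ → Cₛ^∞⟮𝓘(ℝ, E); F, A⟯ → Cₛ^∞⟮𝓘(ℝ, E); F, V⟯,
      IsLieAffgebroidBracket B ∧
        ∀ a b, P (vanishingSection a) (vanishingSection b) = iota (B a b) := by
  choose B hB using fun a b : Cₛ^∞⟮𝓘(ℝ, E); F, A⟯ => (hP.linear _ _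
    (isLinear_vanishingSection a) (isLinear_vanishingSection b)).exists_iota
  exact ⟨B, ⟨hP.isAffPoisson.isLieAffgebroidBracket hB, hB⟩, fun B' ⟨_, hB'⟩ =>
    funext₂ fun a b => iota_injective ((hB' a b).symm.trans (hB a b))⟩

end LinearPoissonBrackets

end AffBundle

end

theorem theorem19
    {E : Type*} [NormedAddCommGroup E] [NormedSpace ℝ E] [FiniteDimensional ℝ E]
    {M : Type*} [TopologicalSpace M] [ChartedSpace E M] [IsManifold 𝓘(ℝ, E) ∞ M]
    [T2Space M] [SecondCountableTopology M]
    {F : Type*} [NormedAddCommGroup F] [NormedSpace ℝ F] [FiniteDimensional ℝ F] [Nontrivial F]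
    {V : M → Type*} [∀ x, AddCommGroup (V x)] [∀ x, Module ℝ (V x)]
    [TopologicalSpace (TotalSpace F V)] [∀ x, TopologicalSpace (V x)] [FiberBundle F V]
    [VectorBundle ℝ F V] [ContMDiffVectorBundle ∞ F V 𝓘(ℝ, E)]
    {A : M → Type*} [∀ x, AddTorsor (V x) (A x)]
    [TopologicalSpace (TotalSpace F A)] [∀ x, TopologicalSpace (A x)] [FiberBundle F A]
    [AffBundle.AffineBundle F V A] [AffBundle.SmoothAffineBundle F V A 𝓘(ℝ, E)] :
    ∃ a : AffBundle.LinSec 𝓘(ℝ, E) F V A ≃ Cₛ^∞⟮𝓘(ℝ, E); F, A⟯,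
      (∀ (σ : AffBundle.LinSec 𝓘(ℝ, E) F V A) (x : M) (φ : AffBundle.AffDual F A x),
        φ (a σ x) • AffBundle.oneA F A x = φ - σ.1.toFun ⟨x, AffBundle.rho φ⟩) ∧
      (∀ B : Cₛ^∞⟮𝓘(ℝ, E); F, A⟯ → Cₛ^∞⟮𝓘(ℝ, E); F, A⟯ → Cₛ^∞⟮𝓘(ℝ, E); F, V⟯,
        AffBundle.IsLieAffgebroidBracket B →
        ∃! P : AffBundle.RhoSection 𝓘(ℝ, E) F V A → AffBundle.RhoSection 𝓘(ℝ, E) F V A →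
            AffBundle.DualFun 𝓘(ℝ, E) F V,
          AffBundle.IsLinearAffPoisson P ∧
          ∀ (σ₁ σ₂ : AffBundle.LinSec 𝓘(ℝ, E) F V A) (p : AffBundle.VDualTotal F V),
            P σ₁ σ₂ p = p.2 (B (a σ₁) (a σ₂) p.1)) ∧
      (∀ P : AffBundle.RhoSection 𝓘(ℝ, E) F V A → AffBundle.RhoSection 𝓘(ℝ, E) F V A →
          AffBundle.DualFun 𝓘(ℝ, E) F V,
        AffBundle.IsLinearAffPoisson P →
        ∃! B : Cₛ^∞⟮𝓘(ℝ, E); F, A⟯ → Cₛ^∞⟮𝓘(ℝ, E); F, A⟯ → Cₛ^∞⟮𝓘(ℝ, E); F, V⟯,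
          AffBundle.IsLieAffgebroidBracket B ∧
          ∀ (σ₁ σ₂ : AffBundle.LinSec 𝓘(ℝ, E) F V A) (p : AffBundle.VDualTotal F V),
            P σ₁ σ₂ p = p.2 (B (a σ₁) (a σ₂) p.1)) := by
  refine ⟨AffBundle.linSecEquiv E F V A, AffBundle.apply_linSecEquiv_smul_oneA,
    fun B hB => ?_, fun P hP => ?_⟩
  · simpa only [AffBundle.forall_linSec_iff_forall_vanishingSection] using
      AffBundle.existsUnique_linearAffPoisson hB
  · simpa only [AffBundle.forall_linSec_iff_forall_vanishingSection] using
      AffBundle.existsUnique_lieAffgebroidBracket hP
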